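/- Throughout, $\mathcal I\subseteq\mathbb R$ is an interval with more than one point and $E,F:\mathcal I\to\mathbb R^{m\times m}$ are sufficiently smooth matrix functions. **Equivalence.** $\{E,F\}\sim\{\bar E,\bar F\}$ (of class $C^n$, $n\ge 1$) means that there are pointwise nonsingular $L,K:\mathcal I\to\mathbb R^{m\times m}$ of class $C^n$ with $\bar E=LEK$ and $\bar F=LFK+LEK'$. **Regularity.** Put $S(t)=\{z\in\mathbb R^m: F(t)z\in\operatorname{im}E(t)\}$. The pair $\{E,F\}$ is *pre-regular* on $\mathcal I$ with characteristics $r,\theta$ if, for all $t\in\mathcal I$, $\operatorname{im}[E(t)\ F(t)]=\mathbb R^m$, $\operatorname{rank}E(t)=r$ and $\dim(\ker E(t)\cap S(t))=\theta$. A *reduction step* takes a pre-regular pair of size $m$ to the pair of size $r$ $$E_1=Y^{T}EC,\qquad F_1=Y^{T}FC+Y^{T}EC',$$ where the columns of the continuous function $Y:\mathcal I\to\mathbb R^{m\times r}$ form a pointwise basis of $\operatorname{im}E$ and those of the $C^1$ function $C:\mathcal I\to\mathbb R^{m\times r}$ a pointwise basis of $S$. The pair $\{E,F\}$ is *regular*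 on $\mathcal I$ if $r=\operatorname{rank} E<m$ and, for some index $\mu\ge1$, successive reduction steps starting from $\{E_0,F_0\}=\{E,F\}$ give pre-regular pairs $\{E_0,F_0\},\dots,\{E_{\mu-1},F_{\mu-1}\}$ whose characteristics satisfy $\theta_0,\dots,\theta_{\mu-2}>0$ and $\theta_{\mu-1}=0$. **QuasiSCF.** Let $\mu\ge1$, let $\ell_1,\dots,\ell_\mu\ge1$ be block sizes and $a=\ell_1+\dots+\ell_\mu$. If $\ell_1\ge\dots\ge\ell_\mu$, then $N^{(E_c)}\in\mathbb R^{a\times a}$ is the block matrix with blocks $N_{i,i+1}=\begin{bmatrix}I_{\ell_{i+1}}\\0\end{bmatrix}$ and all other blocks $0$; if $\ell_1\le\dots\le\ell_\mu$, then $N^{(E_r)}\in\mathbb R^{a\times a}$ is the block matrix with blocks $N_{i,i+1}=\begin{bmatrix}I_{\ell_i}&0\end{bmatrix}$ and all other blocks $0$ (for $\mu=1$ both are $0$). A pair is in *QuasiSCF of column type* (resp. *row type*) if it has the form $$\left\{\begin{bmatrix}I_d&0\\0&N\end{bmatrix},\begin{bmatrix}\Omega&0\\0&R\end{bmatrix}\right\},\qquad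 d\ge0,\quad d+a=m,$$ with $N=N^{(E_c)}$ (resp. $N=N^{(E_r)}$), $\Omega:\mathcal I\to\mathbb R^{d\times d}$, and $R:\mathcal I\to\mathbb R^{a\times a}$ pointwise nonsingular and block upper triangular with the block sizes $\ell_1,\dots,\ell_\mu$ of $N$. **Proposition.** For every $m$ there is an $s\in\mathbb N$, depending only on $m$, such that for all $n\in\{1,2,\dots\}\cup\{\infty\}$, all intervals $\mathcal I$ and all $E,F:\mathcal I\to\mathbb R^{m\times m}$ of class $C^{n+s}$ the following holds. 1. $\{E,F\}$ is regular on $\mathcal I$ if and only if it is equivalent, by $L,K$ of class $C^n$, to a pair in QuasiSCF of column type. 2. $\{E,F\}$ is regular on $\mathcal I$ if and only if it is equivalent, by $L,K$ of class $C^n$, to a pair in QuasiSCF of row type. -/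

import Mathlib

namespace LinearDAE

/-- A matrix function of class `C^n` on `I`, entrywise. -/
def SmoothOn (n : ℕ∞) (I : Set ℝ) {p q : Type*} (A : ℝ → Matrix p q ℝ) : Prop :=
  ∀ i j, ContDiffOn ℝ (n : WithTop ℕ∞) (fun t => A t i j) I

/-- The entrywise derivative `A'(t)` of a matrix function on the interval `I`
(one-sided at end points that belong to `I`). -/
noncomputable def derivOn (I : Set ℝ) {p q : Type*} (A : ℝ → Matrix p q ℝ) (t : ℝ) :
    Matrix p q ℝ :=
  Matrix.of fun i j => derivWithin (fun s => A s i j) I t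

/-- Equivalence of pairs, `{E, F} ∼ {LEK, LFK + LEK'}`, by pointwise nonsingular
matrix functions `L`, `K` of class `C^n` on `I`. -/
def PairEquiv (n : ℕ∞) (I : Set ℝ) {m : ℕ}
    (E F E' F' : ℝ → Matrix (Fin m) (Fin m) ℝ) : Prop :=
  ∃ L K : ℝ → Matrix (Fin m) (Fin m) ℝ,
    SmoothOn n I L ∧ SmoothOn n I K ∧
    ∀ t ∈ I, IsUnit (L t).det ∧ IsUnit (K t).det ∧
      E' t = L t * E t * K t ∧
      F' t = L t * F t * K t + L t * E t * derivOn I K t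

section Regularity

/-- The subspace `S = {z : F z ∈ im E}` belonging to a pair of matrices. -/
def constraintSpace {m : ℕ} (E F : Matrix (Fin m) (Fin m) ℝ) : Submodule ℝ (Fin m → ℝ) :=
  (LinearMap.range E.mulVecLin).comap F.mulVecLin

/-- The pair `{E, F}` is pre-regular on `I` with characteristics `r`, `θ`:
`im [E F] = ℝ^m`, `rank E = r` and `dim (ker E ∩ S) = θ` at every point of `I`. -/
def IsPreRegular (I : Set ℝ) {m : ℕ} (E F : ℝ → Matrix (Fin m) (Fin m) ℝ) (r θ : ℕ) : Prop :=
  ∀ t ∈ I,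
    LinearMap.range (Matrix.fromCols (E t) (F t)).mulVecLin = ⊤ ∧
    (E t).rank = r ∧
    Module.finrank ℝ
      (LinearMap.ker (E t).mulVecLin ⊓ constraintSpace (E t) (F t) : Submodule ℝ (Fin m → ℝ)) = θ

/-- `{E₁, F₁}` arises from `{E, F}` by one step of the basic reduction procedure: with
a (continuous) basis `Y` of `im E` and a (continuously differentiable) basis `C` of `S`, the
ansatz `x = C x₁` and premultiplication by `Yᵀ` give
`E₁ = Yᵀ E C` and `F₁ = Yᵀ F C + Yᵀ E C'`. -/
def IsReduction (I : Set ℝ) {m r : ℕ} (E F : ℝ → Matrix (Fin m) (Fin m) ℝ)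
    (E₁ F₁ : ℝ → Matrix (Fin r) (Fin r) ℝ) : Prop :=
  ∃ Y C : ℝ → Matrix (Fin m) (Fin r) ℝ,
    SmoothOn 0 I Y ∧ SmoothOn 1 I C ∧
    ∀ t ∈ I,
      LinearIndependent ℝ (Y t).col ∧
      LinearMap.range (Y t).mulVecLin = LinearMap.range (E t).mulVecLin ∧
      LinearIndependent ℝ (C t).col ∧
      LinearMap.range (C t).mulVecLin = constraintSpace (E t) (F t) ∧
      E₁ t = (Y t).transpose * E t * C t ∧
      F₁ t = (Y t).transpose * F t * C t + (Y t).transpose * E t * derivOn I C t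

/-- The pair `{E, F}` is regular on `I` with index `μ`: the reduction procedure yields
pre-regular pairs `{E_k, F_k}`, `k = 0, …, μ - 1`, with characteristics
`θ_0, …, θ_{μ-2} > 0` and `θ_{μ-1} = 0`, and `rank E < m`. The condition `r < m` is written
out for index one; for higher index it follows from `θ > 0`. -/
def IsRegularOfIndex (I : Set ℝ) :
    ℕ → ∀ {m : ℕ}, (ℝ → Matrix (Fin m) (Fin m) ℝ) → (ℝ → Matrix (Fin m) (Fin m) ℝ) → Prop
  | 0, _, _, _ => False
  | 1, m, E, F => ∃ r : ℕ, r < m ∧ IsPreRegular I E F r 0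
  | μ + 2, _, E, F => ∃ r θ : ℕ, 0 < θ ∧ IsPreRegular I E F r θ ∧
      ∃ E₁ F₁ : ℝ → Matrix (Fin r) (Fin r) ℝ,
        IsReduction I E F E₁ F₁ ∧ IsRegularOfIndex I (μ + 1) E₁ F₁

/-- Regularity of the pair `{E, F}` on `I` (with some index `μ ≥ 1`). -/
def IsRegular (I : Set ℝ) {m : ℕ} (E F : ℝ → Matrix (Fin m) (Fin m) ℝ) : Prop :=
  ∃ μ : ℕ, IsRegularOfIndex I μ E F

end Regularity

section QuasiSCF

/-- Index type of `ℓ × ℓ` block matrices, `ℓ = ℓ_1 + … + ℓ_μ`: the index `⟨i, k⟩` is the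
`k`-th position inside the `i`-th block. -/
abbrev BlockIdx {μ : ℕ} (l : Fin μ → ℕ) : Type := (i : Fin μ) × Fin (l i)

/-- The elementary nilpotent matrix with block sizes `l`. Only the blocks `(i, i+1)` are nonzero;
such a block has entries `1` on its main diagonal and `0` elsewhere, that is, it is
`[I; 0]` (full column rank) if the block sizes decrease, and `[I 0]` (full row rank) if they
increase. -/
def elemNilpotent {μ : ℕ} (l : Fin μ → ℕ) : Matrix (BlockIdx l) (BlockIdx l) ℝ :=
  Matrix.of fun p q =>
    if (p.1 : ℕ) + 1 = (q.1 : ℕ) ∧ (p.2 : ℕ) = (q.2 : ℕ) then 1 else 0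

/-- The order-preserving enumeration of the rows of `diag (d × d, ℓ × ℓ)` block matrices. -/
def blockEquiv {m d μ : ℕ} (l : Fin μ → ℕ) (h : d + ∑ i, l i = m) :
    Fin d ⊕ BlockIdx l ≃ Fin m :=
  ((Equiv.sumCongr (Equiv.refl (Fin d)) finSigmaFinEquiv).trans finSumFinEquiv).trans
    (finCongr h)

/-- The `m × m` matrix `diag (A, B)`. -/
def blockDiag {m d μ : ℕ} (l : Fin μ → ℕ) (h : d + ∑ i, l i = m)
    (A : Matrix (Fin d) (Fin d) ℝ) (B : Matrix (BlockIdx l) (BlockIdx l) ℝ) :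
    Matrix (Fin m) (Fin m) ℝ :=
  Matrix.reindex (blockEquiv l h) (blockEquiv l h) (Matrix.fromBlocks A 0 0 B)

/-- On `I` the pair `{E, F}` is `{diag (I_d, N), diag (Ω, R)}`, where `N` is the elementary
nilpotent matrix with block sizes `l` and `R` is pointwise nonsingular and block upper triangular
with the same block sizes. -/
def HasQuasiForm (I : Set ℝ) {m d μ : ℕ} (l : Fin μ → ℕ) (h : d + ∑ i, l i = m)
    (E F : ℝ → Matrix (Fin m) (Fin m) ℝ) : Prop :=
  ∃ (Ω : ℝ → Matrix (Fin d) (Fin d) ℝ) (R : ℝ → Matrix (BlockIdx l) (BlockIdx l) ℝ),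
    ∀ t ∈ I, (R t).BlockTriangular Sigma.fst ∧ IsUnit (R t).det ∧
      E t = blockDiag l h 1 (elemNilpotent l) ∧
      F t = blockDiag l h (Ω t) (R t)

/-- QuasiSCF with `N` of column type: `μ ≥ 1` blocks of positive, decreasing sizes. -/
def IsQuasiSCFColumn (I : Set ℝ) {m : ℕ} (E F : ℝ → Matrix (Fin m) (Fin m) ℝ) : Prop :=
  ∃ (d μ : ℕ) (l : Fin μ → ℕ) (h : d + ∑ i, l i = m),
    1 ≤ μ ∧ (∀ i, 0 < l i) ∧ Antitone l ∧ HasQuasiForm I l h E F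

/-- QuasiSCF with `N` of row type: `μ ≥ 1` blocks of positive, increasing sizes. -/
def IsQuasiSCFRow (I : Set ℝ) {m : ℕ} (E F : ℝ → Matrix (Fin m) (Fin m) ℝ) : Prop :=
  ∃ (d μ : ℕ) (l : Fin μ → ℕ) (h : d + ∑ i, l i = m),
    1 ≤ μ ∧ (∀ i, 0 < l i) ∧ Monotone l ∧ HasQuasiForm I l h E F

end QuasiSCF

end LinearDAE

namespace LinearDAE

open Set Filter Topology MeasureTheory

/-! ### Linear matrix differential equations on an arbitrary interval -/

section LinearODE

/-! A reduced pair is unique up to equivalence (`Red.unique`), and equivalent pairs have the same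
reductions (`Red.eqv_left`). Regularity may therefore be tested on any equivalent pair and with any
bases.

Row type. Kato's transport gives smooth orthonormal bases of `im E`, of `S` and of their complements
on all of `I` (`exists_smooth_frame`). In these bases a pre-regular pair becomes `{[E₁ B; 0 0], [F₁
G; 0 H]}` with `H` nonsingular and `[E₁ B]` of full row rank, and `{E₁, F₁}` is a reduction of it.
Once `{E₁, F₁}` is in row form, the full rank lets column operations turn `B` into the next block
column of `N`, while `H` clears `G`. So the form is built backwards from the end of the reduction,
one block per step and at the cost of two derivatives (`exists_qForm_succ`). Conversely, reducing a
row form deletes its last block (`regT_rowForm`), which costs no derivative.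

Column type. Passing to the adjoint pair `{Eᵀ, E'ᵀ - Fᵀ}` exchanges the two types and keeps the
class of the transformations (`QForm.adj`). It remains to carry regularity over to the adjoint, and
the link is that column forms are regular (`regT_columnForm`). Here every reduction step
differentiates the coefficients, so transformations of class `C^(m+1)` are required, whereas `n` may
be `1`. Both directions therefore make a detour. A regular pair has a row form of class `C^(m+1)`,
so its adjoint has such a column form and is regular; a row form of class `C^n` of the adjoint is
then a column form of the pair. In the other direction, a column form of class `C^n` makes the
adjoint regular through its row form, and the row form of class `C^(m+1)` of the adjoint yields a
column form of the pair that is smooth enough to give regularity. -/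

theorem exists_Icc_mem_nhdsWithin {I : Set ℝ} (hI : I.OrdConnected) {t₀ t : ℝ}
    (ht₀ : t₀ ∈ I) (ht : t ∈ I) :
    ∃ a b, a ≤ b ∧ Icc a b ⊆ I ∧ t₀ ∈ Icc a b ∧ t ∈ Icc a b ∧ Icc a b ∈ 𝓝[I] t := by
  -- If nothing in `I` lies to the left of `t`, then `t` is an end point and bounds `I` itself.
  obtain ⟨a, haI, hat, ha⟩ : ∃ a ∈ I, a ≤ t ∧ ∀ᶠ s in 𝓝[I] t, a ≤ s := by
    by_cases h : ∃ a ∈ I, a < t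
    · obtain ⟨a, haI, hat⟩ := h
      exact ⟨a, haI, hat.le, mem_nhdsWithin_of_mem_nhds (Ici_mem_nhds hat)⟩
    · push Not at h
      exact ⟨t, ht, le_rfl, eventually_mem_nhdsWithin.mono fun s hs => h s hs⟩
  obtain ⟨b, hbI, htb, hb⟩ : ∃ b ∈ I, t ≤ b ∧ ∀ᶠ s in 𝓝[I] t, s ≤ b := by
    by_cases h : ∃ b ∈ I, t < b
    · obtain ⟨b, hbI, htb⟩ := h
      exact ⟨b, hbI, htb.le, mem_nhdsWithin_of_mem_nhds (Iic_mem_nhds htb)⟩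
    · push Not at h
      exact ⟨t, ht, le_rfl, eventually_mem_nhdsWithin.mono fun s hs => h s hs⟩
  refine ⟨min a t₀, max b t₀, (min_le_right _ _).trans (le_max_right _ _), hI.out ?_ ?_,
    ⟨min_le_right _ _, le_max_right _ _⟩,
    ⟨(min_le_left _ _).trans hat, htb.trans (le_max_left _ _)⟩, ?_⟩
  · rcases min_choice a t₀ with h | h <;> rw [h] <;> assumption
  · rcases max_choice b t₀ with h | h <;> rw [h] <;> assumption
  · filter_upwards [ha, hb] with s h1 h2
    exact ⟨(min_le_left _ _).trans h1, h2.trans (le_max_left _ _)⟩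

variable {𝔸 : Type*} [NormedRing 𝔸] [NormedAlgebra ℝ 𝔸]

/-- The Picard iterates of `X' = A X`, `X t₀ = 1`, as a series. -/
noncomputable def picardTerm (A : ℝ → 𝔸) (t₀ : ℝ) : ℕ → ℝ → 𝔸
  | 0 => fun _ => 1
  | n + 1 => fun t => ∫ s in t₀..t, A s * picardTerm A t₀ n s

variable {A : ℝ → 𝔸} {t₀ a b : ℝ}

theorem continuousOn_picardTerm (hA : ContinuousOn A (Icc a b)) (h₀ : t₀ ∈ Icc a b) (n : ℕ) :
    ContinuousOn (picardTerm A t₀ n) (Icc a b) := by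
  have hab : a ≤ b := h₀.1.trans h₀.2
  induction n with
  | zero => exact continuousOn_const
  | succ n ih =>
    have h := intervalIntegral.continuousOn_primitive_interval' (μ := volume) (a := t₀)
      (ContinuousOn.intervalIntegrable (u := fun s => A s * picardTerm A t₀ n s)
        (by rw [uIcc_of_le hab]; exact hA.mul ih)) (by rwa [uIcc_of_le hab])
    rwa [uIcc_of_le hab] at h

theorem norm_picardTerm_le (hA : ContinuousOn A (Icc a b)) (h₀ : t₀ ∈ Icc a b) {M : ℝ}
    (hM : ∀ s ∈ Icc a b, ‖A s‖ ≤ M) (n : ℕ) {t : ℝ} (ht : t ∈ Icc a b) :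
    ‖picardTerm A t₀ n t‖ ≤ ‖(1 : 𝔸)‖ * (M ^ n * |t - t₀| ^ n / n.factorial) := by
  have hM0 : 0 ≤ M := (norm_nonneg _).trans (hM _ h₀)
  induction n generalizing t with
  | zero => simp [picardTerm]
  | succ n ih =>
    have hsub : uIcc t₀ t ⊆ Icc a b := (ordConnected_Icc.uIcc_subset h₀ ht)
    have hint : IntegrableOn (fun s => A s * picardTerm A t₀ n s) (uIoc t₀ t) := by
      have := (ContinuousOn.intervalIntegrable (μ := volume) (((hA.mul
        (continuousOn_picardTerm hA h₀ n)).mono hsub)))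
      exact intervalIntegrable_iff.1 this
    have hpow : IntegrableOn (fun s => M * (‖(1 : 𝔸)‖ * (M ^ n * |s - t₀| ^ n / n.factorial)))
        (uIoc t₀ t) := by
      refine intervalIntegrable_iff.1 (Continuous.intervalIntegrable ?_ _ _)
      fun_prop
    calc ‖picardTerm A t₀ (n + 1) t‖ ≤ ∫ s in uIoc t₀ t, ‖A s * picardTerm A t₀ n s‖ :=
          intervalIntegral.norm_integral_le_integral_norm_uIoc
      _ ≤ ∫ s in uIoc t₀ t, M * (‖(1 : 𝔸)‖ * (M ^ n * |s - t₀| ^ n / n.factorial)) := by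
          refine setIntegral_mono_on hint.norm hpow measurableSet_uIoc fun s hs => ?_
          have hs' := hsub (uIoc_subset_uIcc hs)
          exact (norm_mul_le _ _).trans (mul_le_mul (hM s hs') (ih hs') (norm_nonneg _) hM0)
      _ = ‖(1 : 𝔸)‖ * (M ^ (n + 1) * |t - t₀| ^ (n + 1) / (n + 1).factorial) := by
          have : ∀ s, M * (‖(1 : 𝔸)‖ * (M ^ n * |s - t₀| ^ n / n.factorial)) =
            (M * ‖(1 : 𝔸)‖ * M ^ n / n.factorial) * |s - t₀| ^ n := fun s => by ring
          simp_rw [this]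
          rw [integral_const_mul, integral_pow_abs_sub_uIoc, Nat.factorial_succ]
          push_cast
          have h1 : (n.factorial : ℝ) ≠ 0 := by positivity
          field_simp
          ring

/-- On compact subintervals the Picard series is dominated by an exponential series, so its sum is
continuous and solves the integral equation. Every point of `I` has such a subinterval through `t₀`
as a neighbourhood within `I`. -/
theorem exists_linearODE_solution [CompleteSpace 𝔸] {I : Set ℝ} (hI : I.OrdConnected)
    (hA : ContinuousOn A I) (ht₀ : t₀ ∈ I) :
    ∃ X : ℝ → 𝔸, X t₀ = 1 ∧ ∀ t ∈ I, HasDerivWithinAt X (A t * X t) I t := by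
  set X : ℝ → 𝔸 := fun t => ∑' n, picardTerm A t₀ n t with hX
  have key : ∀ {a b : ℝ}, Icc a b ⊆ I → t₀ ∈ Icc a b → ContinuousOn X (Icc a b) ∧
      ∀ t ∈ Icc a b, X t = 1 + ∫ s in t₀..t, A s * X s := by
    intro a b hab h₀
    have hAab := hA.mono hab
    obtain ⟨M, hM⟩ := isCompact_Icc.exists_bound_of_continuousOn hAab
    have hM0 : 0 ≤ M := (norm_nonneg _).trans (hM _ h₀)
    set u : ℕ → ℝ := fun n => ‖(1 : 𝔸)‖ * ((M * (b - a)) ^ n / n.factorial) with hu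
    have hus : Summable u := (Real.summable_pow_div_factorial _).mul_left _
    have hle : ∀ n, ∀ t ∈ Icc a b, ‖picardTerm A t₀ n t‖ ≤ u n := by
      intro n t ht
      refine (norm_picardTerm_le hAab h₀ hM n ht).trans ?_
      rw [← mul_pow]
      have : |t - t₀| ≤ b - a := abs_le.2 ⟨by linarith [ht.1, h₀.2], by linarith [ht.2, h₀.1]⟩
      simp only [hu]
      gcongr
    have hc : ContinuousOn X (Icc a b) :=
      continuousOn_tsum (fun n => continuousOn_picardTerm hAab h₀ n) hus hle
    have hsum : ∀ t ∈ Icc a b, Summable fun n => picardTerm A t₀ n t := fun t ht =>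
      Summable.of_norm_bounded hus fun n => hle n t ht
    refine ⟨hc, fun t ht => ?_⟩
    have hsub : uIcc t₀ t ⊆ Icc a b := (ordConnected_Icc.uIcc_subset h₀ ht)
    have hs : HasSum (fun n => ∫ s in t₀..t, A s * picardTerm A t₀ n s)
        (∫ s in t₀..t, A s * X s) := by
      refine intervalIntegral.hasSum_integral_of_dominated_convergence (fun n _ => M * u n)
        (fun n => ?_) (fun n => ?_) ?_ ?_ ?_
      · refine (ContinuousOn.aestronglyMeasurable ?_ measurableSet_uIoc)
        exact (hAab.mul (continuousOn_picardTerm hAab h₀ n)).mono (uIoc_subset_uIcc.trans hsub)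
      · refine Eventually.of_forall fun s hs => ?_
        have hs' := hsub (uIoc_subset_uIcc hs)
        exact (norm_mul_le _ _).trans (mul_le_mul (hM s hs') (hle n s hs') (norm_nonneg _) hM0)
      · exact Eventually.of_forall fun s _ => hus.mul_left M
      · simp
      · exact Eventually.of_forall fun s hs =>
          (hsum s (hsub (uIoc_subset_uIcc hs))).hasSum.mul_left _
    rw [hX]
    simp only
    rw [(hsum t ht).tsum_eq_zero_add, ← hs.tsum_eq]
    rfl
  refine ⟨X, ?_, fun t ht => ?_⟩
  · have := (key (a := t₀) (b := t₀) (by simpa using ht₀) (by simp)).2 t₀ (by simp)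
    simpa using this
  · obtain ⟨a, b, hle, hab, h₀, htab, hnhds⟩ := exists_Icc_mem_nhdsWithin hI ht₀ ht
    obtain ⟨hc, hint⟩ := key hab h₀
    have hcont : ContinuousOn (fun s => A s * X s) (Icc a b) := (hA.mono hab).mul hc
    have hF : Fact (t ∈ Icc a b) := ⟨htab⟩
    have h1 : HasDerivWithinAt (fun u => ∫ s in t₀..u, A s * X s) (A t * X t) (Icc a b) t := by
      refine intervalIntegral.integral_hasDerivWithinAt_right
        (ContinuousOn.intervalIntegrable (hcont.mono (ordConnected_Icc.uIcc_subset h₀ htab)))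
        (hcont.stronglyMeasurableAtFilter_nhdsWithin measurableSet_Icc t)
        (hcont t htab)
    have h2 : HasDerivWithinAt X (A t * X t) (Icc a b) t :=
      (h1.const_add 1).congr_of_mem (fun s hs => hint s hs) htab
    exact h2.mono_of_mem_nhdsWithin hnhds

end LinearODE

end LinearDAE

namespace LinearDAE

open Set Filter Topology Matrix

/-! ### Entrywise smoothness and differentiation of matrix functions -/

section Calculus

variable {I : Set ℝ} {n : ℕ∞} {p q r : Type*}

theorem uniqueDiffOn_of_ordConnected (hI : I.OrdConnected) (hI' : I.Nontrivial) :
    UniqueDiffOn ℝ I := by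
  obtain ⟨a, ha, b, hb, hab⟩ := hI'.exists_lt
  refine uniqueDiffOn_convex hI.convex ⟨(a + b) / 2, ?_⟩
  refine interior_mono (hI.out ha hb) ?_
  rw [interior_Icc]
  exact ⟨by linarith, by linarith⟩

theorem SmoothOn.mono {k : ℕ∞} {A : ℝ → Matrix p q ℝ} (h : SmoothOn n I A) (hk : k ≤ n) :
    SmoothOn k I A := fun i j => (h i j).of_le (by exact_mod_cast hk)

theorem SmoothOn.congr {A B : ℝ → Matrix p q ℝ} (h : SmoothOn n I A)
    (hAB : ∀ t ∈ I, B t = A t) : SmoothOn n I B := fun i j =>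
  (h i j).congr fun t ht => by rw [hAB t ht]

theorem smoothOn_const (A : Matrix p q ℝ) : SmoothOn n I fun _ => A :=
  fun _ _ => contDiffOn_const

theorem SmoothOn.add {A B : ℝ → Matrix p q ℝ} (hA : SmoothOn n I A) (hB : SmoothOn n I B) :
    SmoothOn n I fun t => A t + B t := fun i j => (hA i j).add (hB i j)

theorem SmoothOn.sub {A B : ℝ → Matrix p q ℝ} (hA : SmoothOn n I A) (hB : SmoothOn n I B) :
    SmoothOn n I fun t => A t - B t := fun i j => (hA i j).sub (hB i j)

theorem SmoothOn.neg {A : ℝ → Matrix p q ℝ} (hA : SmoothOn n I A) :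
    SmoothOn n I fun t => -A t := fun i j => (hA i j).neg

theorem SmoothOn.mul [Fintype q] {A : ℝ → Matrix p q ℝ} {B : ℝ → Matrix q r ℝ}
    (hA : SmoothOn n I A) (hB : SmoothOn n I B) : SmoothOn n I fun t => A t * B t := fun i j => by
  simp only [Matrix.mul_apply]
  exact ContDiffOn.sum fun k _ => (hA i k).mul (hB k j)

theorem SmoothOn.transpose {A : ℝ → Matrix p q ℝ} (hA : SmoothOn n I A) :
    SmoothOn n I fun t => (A t)ᵀ := fun i j => hA j i

theorem SmoothOn.submatrix {p' q' : Type*} {A : ℝ → Matrix p q ℝ} (hA : SmoothOn n I A)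
    (f : p' → p) (g : q' → q) : SmoothOn n I fun t => (A t).submatrix f g :=
  fun i j => hA (f i) (g j)

theorem SmoothOn.fromBlocks {p' q' : Type*} {A : ℝ → Matrix p q ℝ} {B : ℝ → Matrix p q' ℝ}
    {C : ℝ → Matrix p' q ℝ} {D : ℝ → Matrix p' q' ℝ} (hA : SmoothOn n I A) (hB : SmoothOn n I B)
    (hC : SmoothOn n I C) (hD : SmoothOn n I D) :
    SmoothOn n I fun t => Matrix.fromBlocks (A t) (B t) (C t) (D t) := by
  rintro (i | i) (j | j)
  exacts [hA i j, hB i j, hC i j, hD i j]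

theorem SmoothOn.fromRows {p' : Type*} {A : ℝ → Matrix p q ℝ} {B : ℝ → Matrix p' q ℝ}
    (hA : SmoothOn n I A) (hB : SmoothOn n I B) :
    SmoothOn n I fun t => Matrix.fromRows (A t) (B t) := by
  rintro (i | i) j
  exacts [hA i j, hB i j]

theorem SmoothOn.fromCols {q' : Type*} {A : ℝ → Matrix p q ℝ} {B : ℝ → Matrix p q' ℝ}
    (hA : SmoothOn n I A) (hB : SmoothOn n I B) :
    SmoothOn n I fun t => Matrix.fromCols (A t) (B t) := by
  rintro i (j | j)
  exacts [hA i j, hB i j]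

theorem SmoothOn.det [Fintype p] [DecidableEq p] {A : ℝ → Matrix p p ℝ} (hA : SmoothOn n I A) :
    ContDiffOn ℝ n (fun t => (A t).det) I := by
  simp only [Matrix.det_apply]
  exact ContDiffOn.sum fun σ _ => (contDiffOn_prod fun i _ => hA (σ i) i).const_smul _

theorem SmoothOn.adjugate [Fintype p] [DecidableEq p] {A : ℝ → Matrix p p ℝ}
    (hA : SmoothOn n I A) : SmoothOn n I fun t => (A t).adjugate := fun i j => by
  simp only [Matrix.adjugate_apply]
  refine SmoothOn.det (A := fun t => (A t).updateRow j (Pi.single i 1)) fun k l => ?_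
  simp only [Matrix.updateRow_apply]
  split_ifs
  · exact contDiffOn_const
  · exact hA k l

theorem SmoothOn.inv [Fintype p] [DecidableEq p] {A : ℝ → Matrix p p ℝ} (hA : SmoothOn n I A)
    (h : ∀ t ∈ I, IsUnit (A t).det) : SmoothOn n I fun t => (A t)⁻¹ := fun i j => by
  simp only [Matrix.inv_def, Matrix.smul_apply, smul_eq_mul, Ring.inverse_eq_inv']
  exact (hA.det.inv fun t ht => (h t ht).ne_zero).mul (hA.adjugate i j)

theorem SmoothOn.derivOn (hI : UniqueDiffOn ℝ I) {k : ℕ∞} {A : ℝ → Matrix p q ℝ}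
    (hA : SmoothOn n I A) (hk : k + 1 ≤ n) : SmoothOn k I (derivOn I A) := fun i j =>
  (hA i j).derivWithin hI (by exact_mod_cast hk)

theorem SmoothOn.differentiableOn {A : ℝ → Matrix p q ℝ} (hA : SmoothOn n I A) (hn : 1 ≤ n)
    (i : p) (j : q) : DifferentiableOn ℝ (fun t => A t i j) I :=
  (hA i j).differentiableOn (by
    have : (1 : WithTop ℕ∞) ≤ n := by exact_mod_cast hn
    exact (zero_lt_one.trans_le this).ne')

theorem derivOn_congr {A B : ℝ → Matrix p q ℝ} (h : ∀ t ∈ I, A t = B t) {t : ℝ} (ht : t ∈ I) :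
    derivOn I A t = derivOn I B t := by
  ext i j
  exact derivWithin_congr (fun s hs => by simp only [h s hs]) (by simp only [h t ht])

@[simp] theorem derivOn_const (A : Matrix p q ℝ) (t : ℝ) : derivOn I (fun _ => A) t = 0 := by
  ext i j
  simp [derivOn]

theorem derivOn_transpose (A : ℝ → Matrix p q ℝ) (t : ℝ) :
    derivOn I (fun t => (A t)ᵀ) t = (derivOn I A t)ᵀ := rfl

theorem derivOn_fromBlocks {p' q' : Type*} (A : ℝ → Matrix p q ℝ) (B : ℝ → Matrix p q' ℝ)
    (C : ℝ → Matrix p' q ℝ) (D : ℝ → Matrix p' q' ℝ) (t : ℝ) :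
    derivOn I (fun t => Matrix.fromBlocks (A t) (B t) (C t) (D t)) t =
      Matrix.fromBlocks (derivOn I A t) (derivOn I B t) (derivOn I C t) (derivOn I D t) := by
  ext (i | i) (j | j) <;> rfl

theorem derivOn_fromCols {q' : Type*} (A : ℝ → Matrix p q ℝ) (B : ℝ → Matrix p q' ℝ) (t : ℝ) :
    derivOn I (fun t => Matrix.fromCols (A t) (B t)) t =
      Matrix.fromCols (derivOn I A t) (derivOn I B t) := by
  ext i (j | j) <;> rfl

theorem derivOn_neg (A : ℝ → Matrix p q ℝ) (t : ℝ) :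
    derivOn I (fun t => -A t) t = -derivOn I A t := by
  ext i j
  exact derivWithin.fun_neg

theorem derivOn_mul [Fintype q] {A : ℝ → Matrix p q ℝ} {B : ℝ → Matrix q r ℝ}
    (hA : SmoothOn 1 I A) (hB : SmoothOn 1 I B) {t : ℝ} (ht : t ∈ I) :
    derivOn I (fun t => A t * B t) t = derivOn I A t * B t + A t * derivOn I B t := by
  ext i j
  have h : ∀ k, DifferentiableWithinAt ℝ (fun t => A t i k * B t k j) I t := fun k =>
    (hA.differentiableOn le_rfl i k t ht).mul (hB.differentiableOn le_rfl k j t ht)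
  simp only [derivOn, Matrix.mul_apply, Matrix.of_apply, Matrix.add_apply]
  rw [derivWithin_fun_sum fun k _ => h k, ← Finset.sum_add_distrib]
  exact Finset.sum_congr rfl fun k _ => derivWithin_fun_mul
    (hA.differentiableOn le_rfl i k t ht) (hB.differentiableOn le_rfl k j t ht)

theorem eq_of_derivOn_eq_zero (hI : I.OrdConnected) {A : ℝ → Matrix p q ℝ}
    (hA : SmoothOn 1 I A) (h : ∀ t ∈ I, derivOn I A t = 0) {s t : ℝ} (hs : s ∈ I) (ht : t ∈ I) :
    A s = A t := by
  ext i j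
  refine hI.convex.is_const_of_fderivWithin_eq_zero (𝕜 := ℝ) (hA.differentiableOn le_rfl i j)
    (fun x hx => ?_) hs ht
  have h1 : derivWithin (fun s => A s i j) I x = 0 := congrFun (congrFun (h x hx) i) j
  ext
  simpa [derivWithin] using h1

end Calculus

end LinearDAE

namespace LinearDAE

open Set Filter Topology Matrix

/-! ### Global smooth bases for matrix functions of constant rank -/

section Frames

variable {I : Set ℝ} {n : ℕ∞} {p q : Type*} [Fintype p] [Fintype q]

theorem exists_matrixODE_solution [DecidableEq p] (hI : I.OrdConnected) {A : ℝ → Matrix p p ℝ}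
    (hA : SmoothOn 0 I A) {t₀ : ℝ} (ht₀ : t₀ ∈ I) :
    ∃ X : ℝ → Matrix p p ℝ, X t₀ = 1 ∧
      ∀ t ∈ I, ∀ i j, HasDerivWithinAt (fun s => X s i j) ((A t * X t) i j) I t := by
  -- The Picard series needs a normed ring; the conclusion is entrywise and does not depend on the
  -- norm chosen.
  let _ : NormedRing (Matrix p p ℝ) := Matrix.linftyOpNormedRing
  let _ : NormedAlgebra ℝ (Matrix p p ℝ) := Matrix.linftyOpNormedAlgebra
  have _ : CompleteSpace (Matrix p p ℝ) := FiniteDimensional.complete ℝ _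
  have hc : ContinuousOn A I := by
    refine continuousOn_pi.2 fun i => continuousOn_pi.2 fun j => ?_
    exact (hA i j).continuousOn
  obtain ⟨X, h0, hX⟩ := exists_linearODE_solution hI hc ht₀
  refine ⟨X, h0, fun t ht i j => ?_⟩
  have := ((Matrix.entryLinearMap ℝ ℝ i j).toContinuousLinearMap.hasFDerivAt.comp_hasDerivWithinAt
    t (hX t ht))
  exact this

/-- Kato's transport: a smooth orthogonal projection is conjugate to a constant one. -/
theorem exists_smooth_conjugation [DecidableEq p] (hI : I.OrdConnected) (hI' : I.Nontrivial) (hn : 1 ≤ n)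
    {P : ℝ → Matrix p p ℝ} (hP : SmoothOn n I P) (hsymm : ∀ t ∈ I, (P t)ᵀ = P t)
    (hidem : ∀ t ∈ I, P t * P t = P t) {t₀ : ℝ} (ht₀ : t₀ ∈ I) :
    ∃ X : ℝ → Matrix p p ℝ, SmoothOn n I X ∧
      ∀ t ∈ I, (X t)ᵀ * X t = 1 ∧ P t = X t * P t₀ * (X t)ᵀ := by
  have hU := uniqueDiffOn_of_ordConnected hI hI'
  set D := derivOn I P with hD
  -- Kato's generator, the commutator of `P'` and `P`. It is skew-symmetric, so the solution `X` of
  -- `X' = A X` stays orthogonal, and `A P - P A = P'`, so `Xᵀ P X` is constant.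
  set A : ℝ → Matrix p p ℝ := fun t => D t * P t - P t * D t with hAdef
  have hAk : ∀ k : ℕ∞, k + 1 ≤ n → SmoothOn k I A := fun k hk => by
    have h1 : SmoothOn k I D := hP.derivOn hU hk
    have h2 : SmoothOn k I P := hP.mono (le_self_add.trans hk)
    exact (h1.mul h2).sub (h2.mul h1)
  obtain ⟨X, h0, hX⟩ := exists_matrixODE_solution hI (hAk 0 (by simpa using hn)) ht₀
  have hXd : ∀ t ∈ I, derivOn I X t = A t * X t := fun t ht => by
    ext i j
    exact (hX t ht i j).derivWithin (hU t ht)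
  -- Bootstrapping: `A` has one derivative less than `P`, and `X' = A X` gains it back.
  have hXs : ∀ k : ℕ, (k : ℕ∞) ≤ n → SmoothOn k I X := by
    intro k
    induction k with
    | zero =>
      intro _ i j
      exact contDiffOn_zero.2 fun t ht => (hX t ht i j).continuousWithinAt
    | succ k ih =>
      intro hk i j
      have hk' : (k : ℕ∞) + 1 ≤ n := by exact_mod_cast hk
      have h1 : SmoothOn k I (derivOn I X) :=
        ((hAk k hk').mul (ih (le_self_add.trans hk'))).congr hXd
      have := (contDiffOn_succ_iff_derivWithin (n := ((k : ℕ∞) : WithTop ℕ∞))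
        (f := fun s => X s i j) hU).2
        ⟨fun t ht => (hX t ht i j).differentiableWithinAt, by simp, h1 i j⟩
      exact_mod_cast this
  have hXn : SmoothOn n I X := fun i j => contDiffOn_iff_forall_nat_le.2 fun k hk => by
    simpa using hXs k hk i j
  have hX1 : SmoothOn 1 I X := hXn.mono hn
  have hP1 : SmoothOn 1 I P := hP.mono hn
  have hDP : ∀ t ∈ I, D t * P t + P t * D t = D t := fun t ht => by
    rw [hD, ← derivOn_mul hP1 hP1 ht]
    exact derivOn_congr hidem ht
  have hDt : ∀ t ∈ I, (D t)ᵀ = D t := fun t ht => by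
    rw [hD, ← derivOn_transpose]
    exact derivOn_congr hsymm ht
  have hAt : ∀ t ∈ I, (A t)ᵀ = -A t := fun t ht => by
    simp only [hAdef, transpose_sub, transpose_mul, hDt t ht, hsymm t ht, neg_sub]
  have hXX : ∀ t ∈ I, (X t)ᵀ * X t = 1 := fun t ht => by
    have := eq_of_derivOn_eq_zero hI (hX1.transpose.mul hX1) (fun t ht => by
      rw [derivOn_mul hX1.transpose hX1 ht, derivOn_transpose, hXd t ht, transpose_mul, hAt t ht]
      simp [Matrix.mul_assoc]) ht ht₀
    simpa [h0] using this
  refine ⟨X, hXn, fun t ht => ⟨hXX t ht, ?_⟩⟩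
  have hconst : (X t)ᵀ * P t * X t = P t₀ := by
    have := eq_of_derivOn_eq_zero hI ((hX1.transpose.mul hP1).mul hX1) (fun t ht => by
      rw [derivOn_mul (hX1.transpose.mul hP1) hX1 ht, derivOn_mul hX1.transpose hP1 ht,
        derivOn_transpose, hXd t ht, transpose_mul, hAt t ht]
      -- Multiply `P'P + PP' = P'` by `P` from the left.
      have hPDP : P t * D t * P t = 0 := by
        have h := congrArg (P t * ·) (hDP t ht)
        simp only [Matrix.mul_add, ← Matrix.mul_assoc, hidem t ht] at h
        simpa using h
      have : (X t)ᵀ * (-(A t * P t) + D t + P t * A t) * X t = 0 := by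
        have h : -(A t * P t) + D t + P t * A t = 0 := by
          simp only [hAdef, Matrix.sub_mul, Matrix.mul_sub, ← Matrix.mul_assoc, hPDP, hidem t ht]
          rw [Matrix.mul_assoc (D t), hidem t ht]
          nth_rw 2 [← hDP t ht]
          abel
        rw [h]; simp
      rw [← this]
      simp only [hD]
      noncomm_ring) ht ht₀
    simpa [h0] using this
  have hXX' : X t * (X t)ᵀ = 1 := mul_eq_one_comm.1 (hXX t ht)
  rw [← hconst]
  calc P t = (X t * (X t)ᵀ) * P t * (X t * (X t)ᵀ) := by simp [hXX']
    _ = _ := by simp only [Matrix.mul_assoc]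

theorem isUnit_det_gram [DecidableEq q] {B : Matrix p q ℝ} (hB : Function.Injective B.mulVec) :
    IsUnit (Bᵀ * B).det := by
  rw [← Matrix.isUnit_iff_isUnit_det, ← Matrix.mulVec_injective_iff_isUnit]
  rw [← Matrix.coe_mulVecLin, ← LinearMap.ker_eq_bot, Matrix.ker_mulVecLin_transpose_mul_self,
    LinearMap.ker_eq_bot]
  exact hB

theorem injective_mulVec_of_gram [DecidableEq q] {B : Matrix p q ℝ}
    (hB : IsUnit (Bᵀ * B).det) : Function.Injective B.mulVec := by
  rw [← Matrix.coe_mulVecLin, ← LinearMap.ker_eq_bot, ← Matrix.ker_mulVecLin_transpose_mul_self,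
    LinearMap.ker_eq_bot, Matrix.coe_mulVecLin, Matrix.mulVec_injective_iff_isUnit,
    Matrix.isUnit_iff_isUnit_det]
  exact hB

/-- The columns of `Q` are preimages of a basis of `im A`. Thus `A Q` has full column rank and its
Gram matrix can be inverted. -/
theorem exists_injective_mul {A : Matrix p q ℝ} {k : ℕ} (hA : A.rank = k) :
    ∃ Q : Matrix q (Fin k) ℝ, Function.Injective (A * Q).mulVec := by
  classical
  obtain ⟨b⟩ : Nonempty (Module.Basis (Fin k) ℝ (LinearMap.range A.mulVecLin)) :=
    ⟨Module.finBasisOfFinrankEq ℝ _ hA⟩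
  have hb : LinearIndependent ℝ fun i => (b i : p → ℝ) :=
    b.linearIndependent.map' (LinearMap.range A.mulVecLin).subtype (Submodule.ker_subtype _)
  have hv : ∀ i, ∃ v, A *ᵥ v = (b i : p → ℝ) := fun i => (b i).2
  choose v hv using hv
  refine ⟨(Matrix.of v)ᵀ, Matrix.mulVec_injective_iff.2 ?_⟩
  have : (A * (Matrix.of v)ᵀ).col = fun i => (b i : p → ℝ) := by
    funext i
    rw [← hv i]
    rfl
  rw [this]
  exact hb

theorem exists_eq_mul_of_forall_mem_range {p r : Type*} [Fintype r] {A : Matrix p q ℝ}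
    {B : Matrix p r ℝ} (h : ∀ v, ∃ w, B *ᵥ w = A *ᵥ v) : ∃ Y : Matrix r q ℝ, A = B * Y := by
  classical
  choose w hw using h
  refine ⟨(Matrix.of fun j => w (Pi.single j 1))ᵀ, ?_⟩
  ext i j
  have := congrFun (hw (Pi.single j 1)) i
  rw [Matrix.mulVec_single_one] at this
  exact this.symm

/-- `P` is the orthogonal projection onto the column space of `A`. -/
structure IsOrthProj (A : Matrix p q ℝ) (P : Matrix p p ℝ) : Prop where
  symm : Pᵀ = P
  mul_left : P * A = A
  exists_eq : ∃ Y : Matrix q p ℝ, P = A * Y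

theorem IsOrthProj.idem {A : Matrix p q ℝ} {P : Matrix p p ℝ} (h : IsOrthProj A P) :
    P * P = P := by
  obtain ⟨Y, hY⟩ := h.exists_eq
  nth_rw 2 [hY]
  rw [← Matrix.mul_assoc, h.mul_left, ← hY]

theorem IsOrthProj.unique {A : Matrix p q ℝ} {P Q : Matrix p p ℝ} (hP : IsOrthProj A P)
    (hQ : IsOrthProj A Q) : P = Q := by
  have aux : ∀ {P Q : Matrix p p ℝ}, IsOrthProj A P → IsOrthProj A Q → Q * P = P := by
    intro P Q hP hQ
    obtain ⟨Y, hY⟩ := hP.exists_eq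
    rw [hY, ← Matrix.mul_assoc, hQ.mul_left]
  have h1 := congrArg Matrix.transpose (aux hP hQ)
  rw [transpose_mul, hP.symm, hQ.symm, aux hQ hP] at h1
  exact h1.symm

theorem isOrthProj_formula {A : Matrix p q ℝ} {k : ℕ} (hA : A.rank = k) {Q : Matrix q (Fin k) ℝ}
    (hQ : Function.Injective (A * Q).mulVec) :
    IsOrthProj A ((A * Q) * ((A * Q)ᵀ * (A * Q))⁻¹ * (A * Q)ᵀ) := by
  have hunit := isUnit_det_gram hQ
  obtain ⟨Y, hY⟩ : ∃ Y : Matrix (Fin k) q ℝ, A = (A * Q) * Y := by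
    have hle : LinearMap.range (A * Q).mulVecLin ≤ LinearMap.range A.mulVecLin := by
      rw [Matrix.mulVecLin_mul]
      exact LinearMap.range_comp_le_range _ _
    have heq := Submodule.eq_of_le_of_finrank_eq hle (by
      rw [show Module.finrank ℝ (LinearMap.range A.mulVecLin) = k from hA,
        LinearMap.finrank_range_of_inj (by rwa [Matrix.coe_mulVecLin])]
      simp)
    refine exists_eq_mul_of_forall_mem_range fun v => ?_
    have : A *ᵥ v ∈ LinearMap.range (A * Q).mulVecLin := by
      rw [heq]; exact ⟨v, rfl⟩
    exact this
  set B := A * Q with hB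
  refine ⟨?_, ?_, ⟨Q * (Bᵀ * B)⁻¹ * Bᵀ, ?_⟩⟩
  · simp only [transpose_mul, transpose_transpose, transpose_nonsing_inv, Matrix.mul_assoc]
  · rw [hY]
    calc B * (Bᵀ * B)⁻¹ * Bᵀ * (B * Y) = B * ((Bᵀ * B)⁻¹ * (Bᵀ * B)) * Y := by
          simp only [Matrix.mul_assoc]
      _ = B * Y := by rw [Matrix.nonsing_inv_mul _ hunit, Matrix.mul_one]
  · simp only [hB, Matrix.mul_assoc]

/-- The Gram formula with a `Q` frozen at `t₀` stays valid, and smooth, near `t₀`. Orthogonal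
projections are unique, so these local formulas all describe the same `P`. -/
theorem exists_smooth_orthProj [DecidableEq p] {A : ℝ → Matrix p q ℝ} (hA : SmoothOn n I A) {k : ℕ}
    (hk : ∀ t ∈ I, (A t).rank = k) :
    ∃ P : ℝ → Matrix p p ℝ, SmoothOn n I P ∧ ∀ t ∈ I, IsOrthProj (A t) (P t) := by
  have hex : ∀ t, ∃ P, t ∈ I → IsOrthProj (A t) P := fun t => by
    by_cases ht : t ∈ I
    · obtain ⟨Q, hQ⟩ := exists_injective_mul (hk t ht)
      exact ⟨_, fun _ => isOrthProj_formula (hk t ht) hQ⟩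
    · exact ⟨0, fun h => absurd h ht⟩
  choose P hP using hex
  refine ⟨P, fun i j t₀ ht₀ => ?_, hP⟩
  obtain ⟨Q, hQ⟩ := exists_injective_mul (hk t₀ ht₀)
  have hB : SmoothOn n I fun t => A t * Q := hA.mul (smoothOn_const Q)
  set g : ℝ → ℝ := fun t => ((A t * Q)ᵀ * (A t * Q)).det with hg
  have hgc : ContinuousOn g I := (hB.transpose.mul hB).det.continuousOn
  set J : Set ℝ := {t ∈ I | g t ≠ 0} with hJ
  have hJI : J ∈ 𝓝[I] t₀ := by
    have := (hgc t₀ ht₀).eventually_ne (isUnit_det_gram hQ).ne_zero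
    filter_upwards [this, self_mem_nhdsWithin] with t h1 h2 using ⟨h2, h1⟩
  have hBJ : SmoothOn n J fun t => A t * Q := fun i j => (hB i j).mono fun t ht => ht.1
  have hform : SmoothOn n J P := by
    refine ((hBJ.mul ((hBJ.transpose.mul hBJ).inv fun t ht => isUnit_iff_ne_zero.2 ht.2)).mul
      hBJ.transpose).congr fun t ht => ?_
    exact (hP t ht.1).unique (isOrthProj_formula (hk t ht.1)
      (injective_mulVec_of_gram (isUnit_iff_ne_zero.2 ht.2)))
  exact (hform i j t₀ (mem_of_mem_nhdsWithin ht₀ hJI)).mono_of_mem_nhdsWithin hJI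

/-- The eigenvalues of `P` are `0` and `1`; the orthonormal eigenvectors are sorted accordingly into
`V` and `U`. -/
theorem exists_orthonormal_splitting [DecidableEq p] {P : Matrix p p ℝ} (hs : Pᵀ = P) (hi : P * P = P) {k l : ℕ}
    (hk : P.rank = k) (hl : k + l = Fintype.card p) :
    ∃ (U : Matrix p (Fin k) ℝ) (V : Matrix p (Fin l) ℝ), Uᵀ * U = 1 ∧ Vᵀ * V = 1 ∧
      Uᵀ * V = 0 ∧ U * Uᵀ = P ∧ U * Uᵀ + V * Vᵀ = 1 := by
  have hH : P.IsHermitian := by simpa [Matrix.IsHermitian] using hs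
  set W : Matrix p p ℝ := hH.eigenvectorUnitary.1 with hW
  have hWW : Wᵀ * W = 1 := by
    have := (Matrix.mem_unitaryGroup_iff' (A := W)).1 hH.eigenvectorUnitary.2
    simpa [Matrix.star_eq_conjTranspose] using this
  have hWW' : W * Wᵀ = 1 := mul_eq_one_comm.1 hWW
  set ev := hH.eigenvalues with hev
  have hspec : P = W * Matrix.diagonal ev * Wᵀ := by
    have := hH.spectral_theorem
    simpa [Matrix.star_eq_conjTranspose, Unitary.conjStarAlgAut_apply] using this
  have hdiag : Wᵀ * P * W = Matrix.diagonal ev := by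
    rw [hspec]
    calc Wᵀ * (W * Matrix.diagonal ev * Wᵀ) * W
        = (Wᵀ * W) * Matrix.diagonal ev * (Wᵀ * W) := by simp only [Matrix.mul_assoc]
      _ = _ := by simp [hWW]
  have hev01 : ∀ i, ev i * ev i = ev i := fun i => by
    have : Matrix.diagonal ev * Matrix.diagonal ev = Matrix.diagonal ev := by
      nth_rw 1 2 [← hdiag]
      calc Wᵀ * P * W * (Wᵀ * P * W) = Wᵀ * P * (W * Wᵀ) * P * W := by
            simp only [Matrix.mul_assoc]
        _ = Wᵀ * (P * P) * W := by rw [hWW']; simp [Matrix.mul_assoc]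
        _ = _ := by rw [hi, hdiag]
    rw [Matrix.diagonal_mul_diagonal] at this
    exact Matrix.diagonal_injective this |> fun h => congrFun h i
  have hc1 : Fintype.card {i // ev i ≠ 0} = k := by
    rw [← hk, hH.rank_eq_card_non_zero_eigs]
  have hc2 : Fintype.card {i // ¬ ev i ≠ 0} = l := by
    rw [Fintype.card_subtype_compl, hc1]; omega
  let e₁ := (Fintype.equivFinOfCardEq hc1).symm
  let e₂ := (Fintype.equivFinOfCardEq hc2).symm
  have hent : ∀ i j, ∑ x, W x i * W x j = (1 : Matrix p p ℝ) i j := fun i j => by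
    rw [← hWW]; rfl
  have hent' : ∀ i j, ∑ x, W i x * W j x = (1 : Matrix p p ℝ) i j := fun i j => by
    rw [← hWW']; rfl
  refine ⟨W.submatrix id (fun i => (e₁ i : p)), W.submatrix id (fun i => (e₂ i : p)),
    ?_, ?_, ?_, ?_, ?_⟩
  · ext i j
    simp only [Matrix.mul_apply, transpose_apply, submatrix_apply, id, hent, Matrix.one_apply]
    simp [Subtype.val_injective.eq_iff]
  · ext i j
    simp only [Matrix.mul_apply, transpose_apply, submatrix_apply, id, hent, Matrix.one_apply]
    simp [Subtype.val_injective.eq_iff]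
  · ext i j
    simp only [Matrix.mul_apply, transpose_apply, submatrix_apply, id, hent, Matrix.one_apply]
    rw [if_neg fun h : (e₁ i : p) = e₂ j => (e₂ j).2 (h ▸ (e₁ i).2)]
    rfl
  · rw [hspec]
    ext i j
    have hR : (W * Matrix.diagonal ev * Wᵀ) i j = ∑ x, W i x * ev x * W j x := by
      rw [Matrix.mul_apply]
      simp only [Matrix.mul_diagonal, transpose_apply]
    rw [hR]
    simp only [Matrix.mul_apply, transpose_apply, submatrix_apply, id]
    rw [e₁.sum_comp (fun x => W i x * W j x),
      ← Fintype.sum_subtype_add_sum_subtype (fun x => ev x ≠ 0) (fun x => W i x * ev x * W j x),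
      Finset.sum_eq_zero (s := (Finset.univ : Finset {x // ¬ ev x ≠ 0}))
        (fun x _ => by simp [not_not.1 x.2]), add_zero]
    refine Finset.sum_congr rfl fun x _ => ?_
    rw [(mul_eq_left₀ x.2).1 (hev01 x), mul_one]
  · ext i j
    simp only [Matrix.add_apply, Matrix.mul_apply, transpose_apply, submatrix_apply, id]
    rw [e₁.sum_comp (fun x => W i x * W j x), e₂.sum_comp (fun x => W i x * W j x),
      Fintype.sum_subtype_add_sum_subtype (fun x => ev x ≠ 0) (fun x => W i x * W j x), hent']

/-- Bases chosen at one point `t₀` are carried along the interval by Kato's orthogonal `X`. `U` is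
an orthonormal basis of `im A` and `V` one of its orthogonal complement. -/
theorem exists_smooth_frame [DecidableEq p] (hI : I.OrdConnected) (hI' : I.Nontrivial)
    (hn : 1 ≤ n) {A : ℝ → Matrix p q ℝ} (hA : SmoothOn n I A) {k l : ℕ}
    (hk : ∀ t ∈ I, (A t).rank = k) (hl : k + l = Fintype.card p) :
    ∃ (U : ℝ → Matrix p (Fin k) ℝ) (V : ℝ → Matrix p (Fin l) ℝ), SmoothOn n I U ∧
      SmoothOn n I V ∧ ∀ t ∈ I, (U t)ᵀ * U t = 1 ∧ (V t)ᵀ * V t = 1 ∧ (U t)ᵀ * V t = 0 ∧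
        (V t)ᵀ * U t = 0 ∧ U t * (U t)ᵀ + V t * (V t)ᵀ = 1 ∧ (V t)ᵀ * A t = 0 ∧
        ∃ Y : Matrix q (Fin k) ℝ, U t = A t * Y := by
  obtain ⟨t₀, ht₀⟩ := hI'.nonempty
  obtain ⟨P, hP, hPA⟩ := exists_smooth_orthProj hA hk
  obtain ⟨X, hX, hXP⟩ := exists_smooth_conjugation hI hI' hn hP (fun t ht => (hPA t ht).symm)
    (fun t ht => (hPA t ht).idem) ht₀
  have hrank : (P t₀).rank = k := by
    refine le_antisymm ?_ ?_
    · obtain ⟨Y, hY⟩ := (hPA t₀ ht₀).exists_eq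
      rw [hY, ← hk t₀ ht₀]
      exact Matrix.rank_mul_le_left _ _
    · rw [← hk t₀ ht₀]
      nth_rw 1 [← (hPA t₀ ht₀).mul_left]
      exact Matrix.rank_mul_le_left _ _
  obtain ⟨U, V, hUU, hVV, hUV, hUP, hsum⟩ := exists_orthonormal_splitting (hPA t₀ ht₀).symm
    (hPA t₀ ht₀).idem hrank hl
  have hVU : Vᵀ * U = 0 := by
    have := congrArg Matrix.transpose hUV
    simpa using this
  refine ⟨fun t => X t * U, fun t => X t * V, hX.mul (smoothOn_const U),
    hX.mul (smoothOn_const V), fun t ht => ?_⟩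
  obtain ⟨hXX, hPt⟩ := hXP t ht
  have hXX' : X t * (X t)ᵀ = 1 := mul_eq_one_comm.1 hXX
  have hconj : ∀ {a b : ℕ} (M : Matrix p (Fin a) ℝ) (N : Matrix p (Fin b) ℝ),
      (X t * M)ᵀ * (X t * N) = Mᵀ * N := fun M N => by
    calc (X t * M)ᵀ * (X t * N) = Mᵀ * ((X t)ᵀ * X t) * N := by
          simp only [transpose_mul, Matrix.mul_assoc]
      _ = Mᵀ * N := by rw [hXX, Matrix.mul_one]
  have hVP : Vᵀ * P t₀ = 0 := by rw [← hUP, ← Matrix.mul_assoc, hVU, Matrix.zero_mul]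
  have hPU : P t₀ * U = U := by rw [← hUP, Matrix.mul_assoc, hUU, Matrix.mul_one]
  refine ⟨by rw [hconj, hUU], by rw [hconj, hVV], by rw [hconj, hUV], by rw [hconj, hVU], ?_, ?_,
    ?_⟩
  · calc X t * U * (X t * U)ᵀ + X t * V * (X t * V)ᵀ = X t * (U * Uᵀ + V * Vᵀ) * (X t)ᵀ := by
          simp only [transpose_mul, Matrix.mul_assoc, Matrix.mul_add, Matrix.add_mul]
      _ = 1 := by rw [hsum, Matrix.mul_one, hXX']
  · rw [← (hPA t ht).mul_left, hPt]
    calc (X t * V)ᵀ * (X t * P t₀ * (X t)ᵀ * A t)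
        = Vᵀ * ((X t)ᵀ * X t) * P t₀ * (X t)ᵀ * A t := by
          simp only [transpose_mul, Matrix.mul_assoc]
      _ = 0 := by rw [hXX, Matrix.mul_one, hVP]; simp
  · obtain ⟨Y, hY⟩ := (hPA t ht).exists_eq
    refine ⟨Y * (X t * U), ?_⟩
    rw [← Matrix.mul_assoc, ← hY, hPt]
    calc X t * U = X t * P t₀ * U := by rw [Matrix.mul_assoc, hPU]
      _ = X t * P t₀ * ((X t)ᵀ * X t) * U := by rw [hXX, Matrix.mul_one]
      _ = _ := by simp only [Matrix.mul_assoc]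

end Frames

end LinearDAE

namespace LinearDAE

open Set Matrix

/-! ### Equivalence of pairs over arbitrary finite index types -/

section Equivalence

variable {I : Set ℝ} {ι ι' ι'' κ κ' : Type*} [Fintype ι] [DecidableEq ι] [Fintype ι']
  [DecidableEq ι'] [Fintype ι''] [DecidableEq ι''] [Fintype κ] [DecidableEq κ] [Fintype κ']
  [DecidableEq κ']

/-- Equivalence of pairs on arbitrary finite index types, with left and right transformations
of class `C^a` and `C^b`. -/
def Eqv (a b : ℕ∞) (I : Set ℝ) (E F : ℝ → Matrix ι ι ℝ) (E' F' : ℝ → Matrix ι' ι' ℝ) : Prop :=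
  ∃ (L : ℝ → Matrix ι' ι ℝ) (Li : ℝ → Matrix ι ι' ℝ) (K : ℝ → Matrix ι ι' ℝ)
    (Ki : ℝ → Matrix ι' ι ℝ),
    SmoothOn a I L ∧ SmoothOn a I Li ∧ SmoothOn b I K ∧ SmoothOn b I Ki ∧
    ∀ t ∈ I, L t * Li t = 1 ∧ Li t * L t = 1 ∧ K t * Ki t = 1 ∧ Ki t * K t = 1 ∧
      E' t = L t * E t * K t ∧ F' t = L t * F t * K t + L t * E t * derivOn I K t

theorem derivOn_mul_inv_add {K : ℝ → Matrix ι ι' ℝ} {Ki : ℝ → Matrix ι' ι ℝ}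
    (hK : SmoothOn 1 I K) (hKi : SmoothOn 1 I Ki) (h : ∀ t ∈ I, K t * Ki t = 1) {t : ℝ}
    (ht : t ∈ I) : derivOn I K t * Ki t + K t * derivOn I Ki t = 0 := by
  rw [← derivOn_mul hK hKi ht, derivOn_congr h ht, derivOn_const]

variable {a b : ℕ∞} {E F : ℝ → Matrix ι ι ℝ} {E' F' : ℝ → Matrix ι' ι' ℝ}
  {E'' F'' : ℝ → Matrix ι'' ι'' ℝ}

theorem Eqv.mono {a' b' : ℕ∞} (h : Eqv a b I E F E' F') (ha : a' ≤ a) (hb : b' ≤ b) :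
    Eqv a' b' I E F E' F' := by
  obtain ⟨L, Li, K, Ki, hL, hLi, hK, hKi, h⟩ := h
  exact ⟨L, Li, K, Ki, hL.mono ha, hLi.mono ha, hK.mono hb, hKi.mono hb, h⟩

theorem Eqv.symm (hb : 1 ≤ b) (h : Eqv a b I E F E' F') : Eqv a b I E' F' E F := by
  obtain ⟨L, Li, K, Ki, hL, hLi, hK, hKi, h⟩ := h
  refine ⟨Li, L, Ki, K, hLi, hL, hKi, hK, fun t ht => ?_⟩
  obtain ⟨h1, h2, h3, h4, h5, h6⟩ := h t ht
  have h7 := derivOn_mul_inv_add (hK.mono hb) (hKi.mono hb) (fun t ht => (h t ht).2.2.1) ht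
  refine ⟨h2, h1, h4, h3, ?_, ?_⟩
  · rw [h5]
    calc E t = (Li t * L t) * E t * (K t * Ki t) := by rw [h2, h3]; simp
      _ = _ := by simp only [Matrix.mul_assoc]
  · rw [h6, h5]
    calc F t = (Li t * L t) * F t * (K t * Ki t) +
          (Li t * L t) * E t * (derivOn I K t * Ki t + K t * derivOn I Ki t) := by
            rw [h2, h3, h7]; simp
      _ = _ := by simp only [Matrix.mul_assoc, Matrix.mul_add, Matrix.add_mul, add_assoc]

theorem Eqv.trans (hb : 1 ≤ b) (h : Eqv a b I E F E' F') (h' : Eqv a b I E' F' E'' F'') :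
    Eqv a b I E F E'' F'' := by
  obtain ⟨L, Li, K, Ki, hL, hLi, hK, hKi, h⟩ := h
  obtain ⟨M, Mi, N, Ni, hM, hMi, hN, hNi, h'⟩ := h'
  refine ⟨_, _, _, _, hM.mul hL, hLi.mul hMi, hK.mul hN, hNi.mul hKi, fun t ht => ?_⟩
  obtain ⟨h1, h2, h3, h4, h5, h6⟩ := h t ht
  obtain ⟨k1, k2, k3, k4, k5, k6⟩ := h' t ht
  refine ⟨?_, ?_, ?_, ?_, ?_, ?_⟩
  · rw [Matrix.mul_assoc, ← Matrix.mul_assoc (L t), h1, Matrix.one_mul, k1]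
  · rw [Matrix.mul_assoc, ← Matrix.mul_assoc (Mi t), k2, Matrix.one_mul, h2]
  · rw [Matrix.mul_assoc, ← Matrix.mul_assoc (N t), k3, Matrix.one_mul, h3]
  · rw [Matrix.mul_assoc, ← Matrix.mul_assoc (Ki t), h4, Matrix.one_mul, k4]
  · rw [k5, h5]; simp only [Matrix.mul_assoc]
  · rw [k6, h5, h6, derivOn_mul (hK.mono hb) (hN.mono hb) ht]
    simp only [Matrix.mul_assoc, Matrix.mul_add, Matrix.add_mul, add_assoc]

theorem Eqv.of_eq (h : Eqv a b I E F E' F')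
    {E₂ F₂ : ℝ → Matrix ι' ι' ℝ} (h₁ : ∀ t ∈ I, E₂ t = E' t) (h₂ : ∀ t ∈ I, F₂ t = F' t) :
    Eqv a b I E F E₂ F₂ := by
  obtain ⟨L, Li, K, Ki, hL, hLi, hK, hKi, h⟩ := h
  refine ⟨L, Li, K, Ki, hL, hLi, hK, hKi, fun t ht => ?_⟩
  rw [h₁ t ht, h₂ t ht]
  exact h t ht

theorem eqv_submatrix (a b : ℕ∞) (I : Set ℝ) (E F : ℝ → Matrix ι ι ℝ) (e : ι' ≃ ι) :
    Eqv a b I E F (fun t => (E t).submatrix e e) (fun t => (F t).submatrix e e) := by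
  refine ⟨fun _ => (1 : Matrix ι ι ℝ).submatrix e id, fun _ => (1 : Matrix ι ι ℝ).submatrix id e,
    fun _ => (1 : Matrix ι ι ℝ).submatrix id e, fun _ => (1 : Matrix ι ι ℝ).submatrix e id,
    smoothOn_const _, smoothOn_const _, smoothOn_const _, smoothOn_const _, fun t _ => ?_⟩
  have h1 : (1 : Matrix ι ι ℝ).submatrix e id * (1 : Matrix ι ι ℝ).submatrix id e =
      (1 : Matrix ι' ι' ℝ) := by
    ext i j
    simp [Matrix.mul_apply, Matrix.one_apply]
  have h2 : (1 : Matrix ι ι ℝ).submatrix id e * (1 : Matrix ι ι ℝ).submatrix e id =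
      (1 : Matrix ι ι ℝ) := by
    rw [Matrix.submatrix_mul_equiv]; simp
  have h3 : ∀ M : Matrix ι ι ℝ, M.submatrix e e =
      (1 : Matrix ι ι ℝ).submatrix e id * M * (1 : Matrix ι ι ℝ).submatrix id e := fun M => by
    ext i j
    simp [Matrix.mul_apply, Matrix.one_apply]
  refine ⟨h1, h2, h2, h1, h3 _, ?_⟩
  rw [derivOn_const, Matrix.mul_zero, add_zero]
  exact h3 _

end Equivalence

/-! ### Reduction steps, their uniqueness and their invariance under equivalence -/

section Reduction

variable {I : Set ℝ} {ι ι' κ κ' : Type*} [Fintype ι] [DecidableEq ι] [Fintype ι']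
  [DecidableEq ι'] [Fintype κ] [DecidableEq κ] [Fintype κ'] [DecidableEq κ']

/-- `im [E F]` is the whole space on `I`. -/
def IsFull (I : Set ℝ) (E F : ℝ → Matrix ι ι ℝ) : Prop :=
  ∀ t ∈ I, ∀ y, ∃ v w, E t *ᵥ v + F t *ᵥ w = y

/-- A reduction step, written with bases `Z` of `im E` and `C` of the constraint space:
`E C = Z E₁` and `F C + E C' = Z F₁`. -/
def Red (I : Set ℝ) (E F : ℝ → Matrix ι ι ℝ) (E₁ F₁ : ℝ → Matrix κ κ ℝ) : Prop :=
  ∃ Z C : ℝ → Matrix ι κ ℝ, SmoothOn 0 I Z ∧ SmoothOn 1 I C ∧ ∀ t ∈ I,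
    Function.Injective (Z t).mulVec ∧
    (∀ v, (∃ u, Z t *ᵥ u = v) ↔ ∃ w, E t *ᵥ w = v) ∧
    Function.Injective (C t).mulVec ∧
    (∀ v, (∃ u, C t *ᵥ u = v) ↔ ∃ w, E t *ᵥ w = F t *ᵥ v) ∧
    E t * C t = Z t * E₁ t ∧ F t * C t + E t * derivOn I C t = Z t * F₁ t

theorem injective_mulVec_of_left_inverse {A : Matrix ι κ ℝ} {B : Matrix κ ι ℝ} (h : B * A = 1) :
    Function.Injective A.mulVec := fun u v huv => by
  have := congrArg (B *ᵥ ·) huv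
  simpa [Matrix.mulVec_mulVec, h] using this

theorem injective_mulVec_mul {A : Matrix ι κ ℝ} {B : Matrix κ κ' ℝ}
    (hA : Function.Injective A.mulVec) (hB : Function.Injective B.mulVec) :
    Function.Injective (A * B).mulVec := fun u v huv =>
  hB (hA (by simpa only [Matrix.mulVec_mulVec] using huv))

theorem mul_left_cancel_of_injective {p q r : Type*} [Fintype q] {A : Matrix p q ℝ}
    (hA : Function.Injective A.mulVec) {B C : Matrix q r ℝ} (h : A * B = A * C) : B = C := by
  ext i j
  have : B.col j = C.col j := hA (by
    funext i
    exact congrFun (congrFun h i) j)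
  exact congrFun this i

/-- Coordinates with respect to `B` are computed by the left inverse `(BᵀB)⁻¹Bᵀ`, which is as smooth
as `B`. -/
theorem exists_smooth_change_of_basis {n : ℕ∞} {A : ℝ → Matrix ι κ ℝ} {B : ℝ → Matrix ι κ' ℝ}
    (hA : SmoothOn n I A) (hB : SmoothOn n I B)
    (hAi : ∀ t ∈ I, Function.Injective (A t).mulVec)
    (hBi : ∀ t ∈ I, Function.Injective (B t).mulVec)
    (hAB : ∀ t ∈ I, ∀ v, (∃ u, A t *ᵥ u = v) ↔ ∃ u, B t *ᵥ u = v) :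
    ∃ (T : ℝ → Matrix κ' κ ℝ) (Ti : ℝ → Matrix κ κ' ℝ), SmoothOn n I T ∧ SmoothOn n I Ti ∧
      ∀ t ∈ I, T t * Ti t = 1 ∧ Ti t * T t = 1 ∧ A t = B t * T t := by
  have hTA : ∀ t ∈ I, A t = B t * (((B t)ᵀ * B t)⁻¹ * (B t)ᵀ * A t) := fun t ht => by
    obtain ⟨Y, hY⟩ := exists_eq_mul_of_forall_mem_range (A := A t) (B := B t)
      fun v => (hAB t ht _).1 ⟨v, rfl⟩
    rw [hY, Matrix.mul_assoc, ← Matrix.mul_assoc _ (B t) Y,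
      Matrix.nonsing_inv_mul_cancel_left _ _ (isUnit_det_gram (hBi t ht))]
  have hTB : ∀ t ∈ I, B t = A t * (((A t)ᵀ * A t)⁻¹ * (A t)ᵀ * B t) := fun t ht => by
    obtain ⟨Y, hY⟩ := exists_eq_mul_of_forall_mem_range (A := B t) (B := A t)
      fun v => (hAB t ht _).2 ⟨v, rfl⟩
    rw [hY, Matrix.mul_assoc, ← Matrix.mul_assoc _ (A t) Y,
      Matrix.nonsing_inv_mul_cancel_left _ _ (isUnit_det_gram (hAi t ht))]
  refine ⟨_, _, (((hB.transpose.mul hB).inv fun t ht => isUnit_det_gram (hBi t ht)).mul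
    hB.transpose).mul hA, (((hA.transpose.mul hA).inv fun t ht => isUnit_det_gram (hAi t ht)).mul
    hA.transpose).mul hB, fun t ht => ⟨?_, ?_, hTA t ht⟩⟩
  · apply mul_left_cancel_of_injective (hBi t ht)
    rw [← Matrix.mul_assoc, ← hTA t ht, ← hTB t ht, Matrix.mul_one]
  · apply mul_left_cancel_of_injective (hAi t ht)
    rw [← Matrix.mul_assoc, ← hTB t ht, ← hTA t ht, Matrix.mul_one]

variable {E F : ℝ → Matrix ι ι ℝ} {E' F' : ℝ → Matrix ι' ι' ℝ} {E₁ F₁ : ℝ → Matrix κ κ ℝ}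
  {E₂ F₂ : ℝ → Matrix κ' κ' ℝ}

theorem IsFull.eqv (hf : IsFull I E F) (h : Eqv 0 1 I E F E' F') : IsFull I E' F' := by
  obtain ⟨L, Li, K, Ki, -, -, -, -, h⟩ := h
  intro t ht y
  obtain ⟨h1, h2, h3, h4, h5, h6⟩ := h t ht
  obtain ⟨v, w, hvw⟩ := hf t ht (Li t *ᵥ y)
  -- The contribution of `L E K'` is absorbed by the `E` part.
  refine ⟨Ki t *ᵥ (v - derivOn I K t *ᵥ (Ki t *ᵥ w)), Ki t *ᵥ w, ?_⟩
  have e1 : L t * E t * K t * Ki t = L t * E t := by rw [Matrix.mul_assoc, h3, Matrix.mul_one]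
  have e2 : L t * F t * K t * Ki t = L t * F t := by rw [Matrix.mul_assoc, h3, Matrix.mul_one]
  rw [h5, h6, Matrix.mulVec_mulVec, e1, Matrix.mulVec_sub, Matrix.mulVec_mulVec,
    Matrix.mulVec_mulVec, Matrix.mulVec_mulVec, Matrix.add_mul, Matrix.add_mulVec, e2]
  have := congrArg (L t *ᵥ ·) hvw
  simp only [Matrix.mulVec_add, Matrix.mulVec_mulVec, h1, Matrix.one_mulVec] at this
  rw [← this]
  abel

/-- `L E D v` already lies in `im (L E K)`, so the derivative term does not affect membership: the
constraint space of the transformed pair is `K⁻¹ S`. -/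
theorem exists_mulVec_eq_iff {E F : Matrix ι ι ℝ} {L : Matrix ι' ι ℝ} {Li K D : Matrix ι ι' ℝ}
    {Ki : Matrix ι' ι ℝ} (h2 : Li * L = 1) (h3 : K * Ki = 1) (v : ι' → ℝ) :
    (∃ w, (L * E * K) *ᵥ w = (L * F * K + L * E * D) *ᵥ v) ↔ ∃ w, E *ᵥ w = F *ᵥ (K *ᵥ v) := by
  constructor
  · rintro ⟨w, hw⟩
    refine ⟨K *ᵥ w - D *ᵥ v, ?_⟩
    have := congrArg (Li *ᵥ ·) hw
    simp only [Matrix.mulVec_mulVec, ← Matrix.mul_assoc, h2, Matrix.one_mul, Matrix.mulVec_add,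
      Matrix.add_mulVec] at this
    rw [Matrix.mulVec_sub, Matrix.mulVec_mulVec, this]
    simp only [Matrix.mulVec_mulVec, add_sub_cancel_right]
  · rintro ⟨w, hw⟩
    refine ⟨Ki *ᵥ (w + D *ᵥ v), ?_⟩
    rw [Matrix.mulVec_mulVec, Matrix.mul_assoc, h3, Matrix.mul_one, Matrix.mulVec_add,
      ← Matrix.mulVec_mulVec, hw, Matrix.add_mulVec]
    simp only [Matrix.mulVec_mulVec, Matrix.mul_assoc]

/-- The bases `L Z` and `K⁻¹ C` produce the very same reduced pair, since `K' K⁻¹ + K (K⁻¹)' = 0`.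
-/
theorem Red.eqv_left (hr : Red I E F E₁ F₁) (h : Eqv 0 1 I E F E' F') : Red I E' F' E₁ F₁ := by
  obtain ⟨L, Li, K, Ki, hL, hLi, hK, hKi, h⟩ := h
  obtain ⟨Z, C, hZ, hC, hr⟩ := hr
  refine ⟨_, _, hL.mul hZ, hKi.mul hC, fun t ht => ?_⟩
  obtain ⟨h1, h2, h3, h4, h5, h6⟩ := h t ht
  obtain ⟨r1, r2, r3, r4, r5, r6⟩ := hr t ht
  have h7 := derivOn_mul_inv_add hK hKi (fun t ht => (h t ht).2.2.1) ht
  refine ⟨injective_mulVec_mul (injective_mulVec_of_left_inverse h2) r1, fun v => ?_,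
    injective_mulVec_mul (injective_mulVec_of_left_inverse h3) r3, fun v => ?_, ?_, ?_⟩
  · rw [h5]
    constructor
    · rintro ⟨u, rfl⟩
      obtain ⟨w, hw⟩ := (r2 _).1 ⟨u, rfl⟩
      refine ⟨Ki t *ᵥ w, ?_⟩
      rw [Matrix.mulVec_mulVec, Matrix.mul_assoc, h3, Matrix.mul_one, ← Matrix.mulVec_mulVec, hw,
        Matrix.mulVec_mulVec]
    · rintro ⟨w, rfl⟩
      obtain ⟨u, hu⟩ := (r2 (E t *ᵥ (K t *ᵥ w))).2 ⟨_, rfl⟩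
      refine ⟨u, ?_⟩
      rw [← Matrix.mulVec_mulVec, hu]
      simp only [Matrix.mulVec_mulVec, Matrix.mul_assoc]
  · have hv : (∃ u, (Ki t * C t) *ᵥ u = v) ↔ ∃ u, C t *ᵥ u = K t *ᵥ v := by
      refine exists_congr fun u => ⟨?_, fun hu => ?_⟩
      · rintro rfl
        rw [Matrix.mulVec_mulVec, ← Matrix.mul_assoc, h3, Matrix.one_mul]
      · rw [← Matrix.mulVec_mulVec, hu, Matrix.mulVec_mulVec, h4, Matrix.one_mulVec]
    rw [hv, r4, h5, h6, exists_mulVec_eq_iff h2 h3]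
  · rw [h5, Matrix.mul_assoc (L t) (Z t), ← r5, Matrix.mul_assoc, ← Matrix.mul_assoc (K t), h3,
      Matrix.one_mul, Matrix.mul_assoc]
  · rw [derivOn_mul hKi hC ht, h5, h6, Matrix.mul_assoc (L t) (Z t), ← r6]
    calc _ = L t * F t * (K t * Ki t) * C t + L t * E t * (K t * Ki t) * derivOn I C t
          + L t * E t * (derivOn I K t * Ki t + K t * derivOn I Ki t) * C t := by
          simp only [Matrix.mul_assoc, Matrix.mul_add, Matrix.add_mul]
          abel
      _ = _ := by
          rw [h3, h7]
          simp only [Matrix.mul_assoc, Matrix.mul_add, Matrix.mul_one, Matrix.mul_zero,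
            Matrix.zero_mul, add_zero]

/-- An equivalence of the reduced pair is a change of the bases to `Z L⁻¹` and `C K`. The classes
`0` and `1` are those required of the bases. -/
theorem Red.eqv_right (hr : Red I E F E₁ F₁) (h : Eqv 0 1 I E₁ F₁ E₂ F₂) :
    Red I E F E₂ F₂ := by
  obtain ⟨L, Li, K, Ki, hL, hLi, hK, hKi, h⟩ := h
  obtain ⟨Z, C, hZ, hC, hr⟩ := hr
  refine ⟨_, _, hZ.mul hLi, hC.mul hK, fun t ht => ?_⟩
  obtain ⟨h1, h2, h3, h4, h5, h6⟩ := h t ht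
  obtain ⟨r1, r2, r3, r4, r5, r6⟩ := hr t ht
  refine ⟨injective_mulVec_mul r1 (injective_mulVec_of_left_inverse h1), fun v => ?_,
    injective_mulVec_mul r3 (injective_mulVec_of_left_inverse h4), fun v => ?_, ?_, ?_⟩
  · rw [← r2]
    refine ⟨fun ⟨u, hu⟩ => ⟨Li t *ᵥ u, by rw [← hu, Matrix.mulVec_mulVec]⟩,
      fun ⟨u, hu⟩ => ⟨L t *ᵥ u, ?_⟩⟩
    rw [← hu, Matrix.mulVec_mulVec, Matrix.mul_assoc, h2, Matrix.mul_one]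
  · rw [← r4]
    refine ⟨fun ⟨u, hu⟩ => ⟨K t *ᵥ u, by rw [← hu, Matrix.mulVec_mulVec]⟩,
      fun ⟨u, hu⟩ => ⟨Ki t *ᵥ u, ?_⟩⟩
    rw [← hu, Matrix.mulVec_mulVec, Matrix.mul_assoc, h3, Matrix.mul_one]
  · rw [h5, ← Matrix.mul_assoc, r5]
    calc _ = Z t * (1 : Matrix κ κ ℝ) * E₁ t * K t := by rw [Matrix.mul_one]
      _ = _ := by rw [← h2]; simp only [Matrix.mul_assoc]
  · rw [h6, derivOn_mul hC hK ht]
    calc _ = (F t * C t + E t * derivOn I C t) * K t + E t * C t * derivOn I K t := by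
          simp only [Matrix.mul_assoc, Matrix.mul_add, Matrix.add_mul, add_assoc]
      _ = Z t * (Li t * L t) * (F₁ t * K t + E₁ t * derivOn I K t) := by
          rw [r5, r6, h2, Matrix.mul_one]
          simp only [Matrix.mul_assoc, Matrix.mul_add]
      _ = _ := by simp only [Matrix.mul_assoc, Matrix.mul_add]

/-- Two choices of bases span the same spaces; the change of basis of `im E` serves as `L`, that of
`S` as `K`. -/
theorem Red.unique (hr : Red I E F E₁ F₁) (hr' : Red I E F E₂ F₂) : Eqv 0 1 I E₁ F₁ E₂ F₂ := by
  obtain ⟨Z, C, hZ, hC, hr⟩ := hr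
  obtain ⟨Z', C', hZ', hC', hr'⟩ := hr'
  obtain ⟨M, Mi, hM, hMi, hM'⟩ := exists_smooth_change_of_basis hZ hZ' (fun t ht => (hr t ht).1)
    (fun t ht => (hr' t ht).1) fun t ht v => ((hr t ht).2.1 v).trans ((hr' t ht).2.1 v).symm
  obtain ⟨T, Ti, hT, hTi, hT'⟩ := exists_smooth_change_of_basis hC' hC
    (fun t ht => (hr' t ht).2.2.1) (fun t ht => (hr t ht).2.2.1)
    fun t ht v => ((hr' t ht).2.2.2.1 v).trans ((hr t ht).2.2.2.1 v).symm
  refine ⟨M, Mi, T, Ti, hM, hMi, hT, hTi, fun t ht => ?_⟩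
  obtain ⟨m1, m2, m3⟩ := hM' t ht
  obtain ⟨t1, t2, t3⟩ := hT' t ht
  obtain ⟨-, -, -, -, r5, r6⟩ := hr t ht
  obtain ⟨s1, -, -, -, s5, s6⟩ := hr' t ht
  refine ⟨m1, m2, t1, t2, ?_, ?_⟩
  · apply mul_left_cancel_of_injective s1
    rw [← s5, t3, ← Matrix.mul_assoc, r5, m3]
    simp only [Matrix.mul_assoc]
  · apply mul_left_cancel_of_injective s1
    have hd : derivOn I C' t = derivOn I C t * T t + C t * derivOn I T t := by
      rw [← derivOn_mul hC hT ht]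
      exact derivOn_congr (fun t ht => (hT' t ht).2.2) ht
    rw [← s6, hd, t3]
    calc _ = (F t * C t + E t * derivOn I C t) * T t + E t * C t * derivOn I T t := by
          simp only [Matrix.mul_assoc, Matrix.mul_add, Matrix.add_mul, add_assoc]
      _ = _ := by
          rw [r5, r6, m3]
          simp only [Matrix.mul_assoc, Matrix.mul_add]

/-- Regularity on arbitrary finite index types; the last pair of the reduction has a nonsingular
leading matrix. -/
def RegT (I : Set ℝ) : ℕ → ∀ {ι : Type} [Fintype ι] [DecidableEq ι],
    (ℝ → Matrix ι ι ℝ) → (ℝ → Matrix ι ι ℝ) → Prop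
  | 0, _, _, _, E, _ => ∀ t ∈ I, IsUnit (E t).det
  | μ + 1, ι, _, _, E, F => IsFull I E F ∧ ∃ (κ : Type) (_ : Fintype κ) (_ : DecidableEq κ)
      (E₁ F₁ : ℝ → Matrix κ κ ℝ), Fintype.card κ < Fintype.card ι ∧ Red I E F E₁ F₁ ∧
      RegT I μ E₁ F₁

theorem Eqv.card_eq {a b : ℕ∞} (hI : I.Nonempty) (h : Eqv a b I E F E' F') :
    Fintype.card ι = Fintype.card ι' := by
  obtain ⟨t, ht⟩ := hI
  obtain ⟨L, Li, K, Ki, -, -, -, -, h⟩ := h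
  obtain ⟨h1, h2, -⟩ := h t ht
  exact (Matrix.square_of_invertible _ _ h1 h2).symm

theorem Eqv.isUnit_det {a b : ℕ∞} (h : Eqv a b I E F E' F') (hE : ∀ t ∈ I, IsUnit (E t).det) :
    ∀ t ∈ I, IsUnit (E' t).det := fun t ht => by
  obtain ⟨L, Li, K, Ki, -, -, -, -, h⟩ := h
  obtain ⟨h1, h2, h3, h4, h5, h6⟩ := h t ht
  refine Matrix.isUnit_det_of_right_inverse (B := Ki t * (E t)⁻¹ * Li t) ?_
  rw [h5]
  calc _ = L t * (E t * (K t * Ki t) * (E t)⁻¹) * Li t := by simp only [Matrix.mul_assoc]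
    _ = 1 := by rw [h3, Matrix.mul_one, Matrix.mul_nonsing_inv _ (hE t ht), Matrix.mul_one, h1]

/-- Only the first reduction step involves the pair itself, and it may lead to the same reduced
pair. -/
theorem RegT.eqv (hI : I.Nonempty) {μ : ℕ} {ι ι' : Type} [Fintype ι] [DecidableEq ι]
    [Fintype ι'] [DecidableEq ι'] {E F : ℝ → Matrix ι ι ℝ} {E' F' : ℝ → Matrix ι' ι' ℝ}
    (hr : RegT I μ E F) (h : Eqv 0 1 I E F E' F') : RegT I μ E' F' := by
  cases μ with
  | zero => exact h.isUnit_det hr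
  | succ μ =>
    obtain ⟨hf, κ, _, _, E₁, F₁, hc, hred, hreg⟩ := hr
    exact ⟨hf.eqv h, κ, _, _, E₁, F₁, by rwa [← h.card_eq hI], hred.eqv_left h, hreg⟩

theorem Red.rank_eq (hr : Red I E F E₁ F₁) {t : ℝ} (ht : t ∈ I) :
    (E t).rank = Fintype.card κ := by
  obtain ⟨Z, C, -, -, hr⟩ := hr
  obtain ⟨r1, r2, -⟩ := hr t ht
  have : LinearMap.range (E t).mulVecLin = LinearMap.range (Z t).mulVecLin := by
    ext v
    exact (r2 v).symm
  rw [Matrix.rank, this, LinearMap.finrank_range_of_inj (by rwa [Matrix.coe_mulVecLin])]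
  simp

/-- From `E C = Z E₁` with `Z` injective, `C` maps `ker E₁` onto `ker E ∩ S`. Hence `θ = r - rank
E₁`, and `θ = 0` means that `E₁` is nonsingular. -/
theorem Red.finrank_add_rank {m : ℕ} {E F : ℝ → Matrix (Fin m) (Fin m) ℝ}
    (hr : Red I E F E₁ F₁) {t : ℝ} (ht : t ∈ I) :
    Module.finrank ℝ (LinearMap.ker (E t).mulVecLin ⊓ constraintSpace (E t) (F t) :
      Submodule ℝ (Fin m → ℝ)) + (E₁ t).rank = Fintype.card κ := by
  obtain ⟨Z, C, -, -, hr⟩ := hr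
  obtain ⟨r1, r2, r3, r4, r5, r6⟩ := hr t ht
  have hmap : (LinearMap.ker (E t).mulVecLin ⊓ constraintSpace (E t) (F t) :
      Submodule ℝ (Fin m → ℝ)) = (LinearMap.ker (E₁ t).mulVecLin).map (C t).mulVecLin := by
    ext v
    simp only [Submodule.mem_inf, LinearMap.mem_ker, Matrix.mulVecLin_apply, Submodule.mem_map,
      constraintSpace, Submodule.mem_comap, LinearMap.mem_range]
    rw [← r4 v]
    have key : ∀ u, E t *ᵥ (C t *ᵥ u) = 0 ↔ E₁ t *ᵥ u = 0 := fun u => by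
      rw [Matrix.mulVec_mulVec, r5, ← Matrix.mulVec_mulVec]
      exact ⟨fun h => r1 (by rw [h, Matrix.mulVec_zero]), fun h => by rw [h, Matrix.mulVec_zero]⟩
    constructor
    · rintro ⟨h, u, rfl⟩
      exact ⟨u, (key u).1 h, rfl⟩
    · rintro ⟨u, hu, rfl⟩
      exact ⟨(key u).2 hu, u, rfl⟩
  have hinj : Function.Injective (C t).mulVecLin := by rwa [Matrix.coe_mulVecLin]
  rw [hmap, ← (Submodule.equivMapOfInjective _ hinj _).finrank_eq]
  have := LinearMap.finrank_range_add_finrank_ker (E₁ t).mulVecLin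
  rw [Module.finrank_fintype_fun_eq_card] at this
  rw [Matrix.rank, add_comm, this]

theorem isFull_iff {m : ℕ} {E F : ℝ → Matrix (Fin m) (Fin m) ℝ} :
    IsFull I E F ↔
      ∀ t ∈ I, LinearMap.range (Matrix.fromCols (E t) (F t)).mulVecLin = ⊤ := by
  refine forall₂_congr fun t _ => ?_
  rw [LinearMap.range_eq_top]
  refine forall_congr' fun y => ⟨fun ⟨v, w, h⟩ => ⟨Sum.elim v w, ?_⟩, fun ⟨x, h⟩ =>
    ⟨x ∘ Sum.inl, x ∘ Sum.inr, ?_⟩⟩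
  · rw [Matrix.mulVecLin_apply, Matrix.fromCols_mulVec_sumElim, h]
  · rw [Matrix.mulVecLin_apply, Matrix.fromCols_mulVec] at h
    exact h

/-- For `Z = Y (YᵀY)⁻¹` the product `Z Yᵀ` is the projection onto `im E`, where the columns of `E C`
and `F C + E C'` lie. -/
theorem IsReduction.red {m r : ℕ} {E F : ℝ → Matrix (Fin m) (Fin m) ℝ}
    {E₁ F₁ : ℝ → Matrix (Fin r) (Fin r) ℝ} (h : IsReduction I E F E₁ F₁) :
    Red I E F E₁ F₁ := by
  obtain ⟨Y, C, hY, hC, h⟩ := h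
  have hYi : ∀ t ∈ I, Function.Injective (Y t).mulVec := fun t ht =>
    Matrix.mulVec_injective_iff.2 (h t ht).1
  have hG : ∀ t ∈ I, IsUnit ((Y t)ᵀ * Y t).det := fun t ht => isUnit_det_gram (hYi t ht)
  have hGi : ∀ t ∈ I, Function.Injective (((Y t)ᵀ * Y t)⁻¹).mulVec := fun t ht =>
    injective_mulVec_of_left_inverse (Matrix.mul_nonsing_inv _ (hG t ht))
  refine ⟨_, C, hY.mul ((hY.transpose.mul hY).inv hG), hC, fun t ht => ?_⟩
  obtain ⟨h1, h2, h3, h4, h5, h6⟩ := h t ht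
  have key : ∀ M : Matrix (Fin m) (Fin r) ℝ, (∀ v, ∃ w, Y t *ᵥ w = M *ᵥ v) →
      M = Y t * ((Y t)ᵀ * Y t)⁻¹ * ((Y t)ᵀ * M) := fun M hM => by
    obtain ⟨X, rfl⟩ := exists_eq_mul_of_forall_mem_range hM
    rw [← Matrix.mul_assoc (Y t)ᵀ, Matrix.mul_assoc (Y t),
      Matrix.nonsing_inv_mul_cancel_left _ _ (hG t ht)]
  have hmem : ∀ v, (∃ u, Y t *ᵥ u = v) ↔ ∃ w, E t *ᵥ w = v := fun v => SetLike.ext_iff.1 h2 v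
  have hS : ∀ v, (∃ u, C t *ᵥ u = v) ↔ ∃ w, E t *ᵥ w = F t *ᵥ v := fun v =>
    SetLike.ext_iff.1 h4 v
  refine ⟨injective_mulVec_mul (hYi t ht) (hGi t ht), fun v => ?_,
    Matrix.mulVec_injective_iff.2 h3, hS, ?_, ?_⟩
  · rw [← hmem]
    refine ⟨fun ⟨u, hu⟩ => ⟨_, by rw [← hu, ← Matrix.mulVec_mulVec]⟩,
      fun ⟨u, hu⟩ => ⟨((Y t)ᵀ * Y t) *ᵥ u, ?_⟩⟩
    rw [← hu, Matrix.mulVec_mulVec, Matrix.mul_assoc, Matrix.nonsing_inv_mul _ (hG t ht),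
      Matrix.mul_one]
  · rw [h5, Matrix.mul_assoc (Y t)ᵀ]
    exact key _ fun v => (hmem _).2 ⟨C t *ᵥ v, by rw [Matrix.mulVec_mulVec]⟩
  · rw [h6, Matrix.mul_assoc (Y t)ᵀ, Matrix.mul_assoc (Y t)ᵀ, ← Matrix.mul_add]
    refine key _ fun v => (hmem _).2 ?_
    obtain ⟨w, hw⟩ := (hS _).1 ⟨v, rfl⟩
    refine ⟨w + derivOn I C t *ᵥ v, ?_⟩
    rw [Matrix.mulVec_add, hw, Matrix.add_mulVec, Matrix.mulVec_mulVec, Matrix.mulVec_mulVec]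

theorem Red.isReduction {m r : ℕ} {E F : ℝ → Matrix (Fin m) (Fin m) ℝ}
    {E₁ F₁ : ℝ → Matrix (Fin r) (Fin r) ℝ} (h : Red I E F E₁ F₁) :
    IsReduction I E F E₁ F₁ := by
  obtain ⟨Z, C, hZ, hC, h⟩ := h
  have hG : ∀ t ∈ I, IsUnit ((Z t)ᵀ * Z t).det := fun t ht => isUnit_det_gram (h t ht).1
  have hGi : ∀ t ∈ I, Function.Injective (((Z t)ᵀ * Z t)⁻¹).mulVec := fun t ht =>
    injective_mulVec_of_left_inverse (Matrix.mul_nonsing_inv _ (hG t ht))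
  refine ⟨_, C, hZ.mul ((hZ.transpose.mul hZ).inv hG), hC, fun t ht => ?_⟩
  obtain ⟨h1, h2, h3, h4, h5, h6⟩ := h t ht
  have key : (Z t * ((Z t)ᵀ * Z t)⁻¹)ᵀ * Z t = 1 := by
    rw [transpose_mul, transpose_nonsing_inv, transpose_mul, transpose_transpose,
      Matrix.mul_assoc, Matrix.nonsing_inv_mul _ (hG t ht)]
  refine ⟨Matrix.mulVec_injective_iff.1 (injective_mulVec_mul h1 (hGi t ht)), ?_,
    Matrix.mulVec_injective_iff.1 h3, SetLike.ext fun v => h4 v, ?_, ?_⟩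
  · ext v
    refine Iff.trans ⟨fun ⟨u, hu⟩ => ⟨((Z t)ᵀ * Z t)⁻¹ *ᵥ u, ?_⟩, fun ⟨u, hu⟩ => ⟨((Z t)ᵀ * Z t) *ᵥ u, ?_⟩⟩ (h2 v)
    · rw [← hu, Matrix.mulVecLin_apply, ← Matrix.mulVec_mulVec]
    · rw [← hu, Matrix.mulVecLin_apply, Matrix.mulVec_mulVec, Matrix.mul_assoc,
        Matrix.nonsing_inv_mul _ (hG t ht), Matrix.mul_one]
  · rw [Matrix.mul_assoc, h5, ← Matrix.mul_assoc, key, Matrix.one_mul]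
  · rw [Matrix.mul_assoc, Matrix.mul_assoc, ← Matrix.mul_add, h6, ← Matrix.mul_assoc, key,
      Matrix.one_mul]

theorem RegT.isRegularOfIndex (hI : I.Nonempty) {μ : ℕ} : ∀ {m : ℕ}
    {E F : ℝ → Matrix (Fin m) (Fin m) ℝ}, RegT I (μ + 1) E F → IsRegularOfIndex I (μ + 1) E F := by
  induction μ with
  | zero =>
    rintro m E F ⟨hf, κ, _, _, E₁, F₁, hc, hred, hreg⟩
    refine ⟨Fintype.card κ, by simpa using hc, fun t ht =>
      ⟨isFull_iff.1 hf t ht, hred.rank_eq ht, ?_⟩⟩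
    have := hred.finrank_add_rank ht
    rw [Matrix.rank_of_isUnit _ ((Matrix.isUnit_iff_isUnit_det _).2 (hreg t ht))] at this
    omega
  | succ μ ih =>
    rintro m E F ⟨hf, κ, _, _, E₁, F₁, hc, hred, hreg⟩
    have he := eqv_submatrix 0 1 I E₁ F₁ (Fintype.equivFin κ).symm
    obtain ⟨t₀, ht₀⟩ := hI
    have hreg' := hreg
    obtain ⟨-, κ', _, _, E₂, F₂, hc', hred', -⟩ := hreg
    -- `θ = r - rank E₁`, and `rank E₁` is the size of the pair obtained by the next reduction.
    refine ⟨Fintype.card κ, Fintype.card κ - Fintype.card κ', by omega, fun t ht =>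
      ⟨isFull_iff.1 hf t ht, hred.rank_eq ht, ?_⟩, _, _, (hred.eqv_right he).isReduction,
      ih (hreg'.eqv ⟨t₀, ht₀⟩ he)⟩
    have := hred.finrank_add_rank ht
    rw [hred'.rank_eq ht] at this
    omega

theorem IsPreRegular.eqv {m r θ : ℕ} {E F E' F' : ℝ → Matrix (Fin m) (Fin m) ℝ}
    (h : IsPreRegular I E F r θ) (he : Eqv 0 1 I E F E' F') : IsPreRegular I E' F' r θ := by
  have hf : IsFull I E' F' := (isFull_iff.2 fun t ht => (h t ht).1).eqv he
  obtain ⟨L, Li, K, Ki, -, -, -, -, he⟩ := he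
  intro t ht
  obtain ⟨h1, h2, h3, h4, h5, h6⟩ := he t ht
  obtain ⟨-, p2, p3⟩ := h t ht
  refine ⟨isFull_iff.1 hf t ht, ?_, ?_⟩
  · rw [h5, Matrix.rank_mul_eq_left_of_isUnit_det _ _ (Matrix.isUnit_det_of_right_inverse h3),
      Matrix.rank_mul_eq_right_of_isUnit_det _ _ (Matrix.isUnit_det_of_right_inverse h1), p2]
  · have hinj : Function.Injective (K t).mulVecLin := by
      rw [Matrix.coe_mulVecLin]; exact injective_mulVec_of_left_inverse h4
    have hmap : (LinearMap.ker (E t).mulVecLin ⊓ constraintSpace (E t) (F t) :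
        Submodule ℝ (Fin m → ℝ)) =
        (LinearMap.ker (E' t).mulVecLin ⊓ constraintSpace (E' t) (F' t)).map (K t).mulVecLin := by
      have key : ∀ u, K t *ᵥ u ∈ (LinearMap.ker (E t).mulVecLin ⊓ constraintSpace (E t) (F t) :
          Submodule ℝ (Fin m → ℝ)) ↔
          u ∈ LinearMap.ker (E' t).mulVecLin ⊓ constraintSpace (E' t) (F' t) := fun u => by
        refine and_congr ?_ ?_
        · simp only [LinearMap.mem_ker, Matrix.mulVecLin_apply, SetLike.mem_coe]
          rw [h5, Matrix.mul_assoc, ← Matrix.mulVec_mulVec, ← Matrix.mulVec_mulVec]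
          exact ⟨fun h => by rw [h, Matrix.mulVec_zero], fun h =>
            injective_mulVec_of_left_inverse h2 (by rw [h, Matrix.mulVec_zero])⟩
        · simp only [constraintSpace, SetLike.mem_coe, Submodule.mem_comap, LinearMap.mem_range,
            Matrix.mulVecLin_apply]
          rw [h5, h6, exists_mulVec_eq_iff h2 h3]
      ext v
      constructor
      · intro hv
        have hKv : K t *ᵥ (Ki t *ᵥ v) = v := by rw [Matrix.mulVec_mulVec, h3, Matrix.one_mulVec]
        exact ⟨Ki t *ᵥ v, (key _).1 (by rwa [hKv]), hKv⟩
      · rintro ⟨u, hu, rfl⟩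
        exact (key u).2 hu
    rw [← p3, hmap, ← (Submodule.equivMapOfInjective _ hinj _).finrank_eq]

theorem IsRegularOfIndex.eqv {μ m : ℕ} {E F E' F' : ℝ → Matrix (Fin m) (Fin m) ℝ}
    (h : IsRegularOfIndex I μ E F) (he : Eqv 0 1 I E F E' F') : IsRegularOfIndex I μ E' F' := by
  match μ, h with
  | 1, ⟨r, hr, hp⟩ => exact ⟨r, hr, hp.eqv he⟩
  | μ + 2, ⟨r, θ, hθ, hp, E₁, F₁, hred, hreg⟩ =>
    exact ⟨r, θ, hθ, hp.eqv he, E₁, F₁, (hred.red.eqv_left he).isReduction, hreg⟩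

end Reduction

end LinearDAE

namespace LinearDAE

open Set Matrix

/-! ### Reduction of block triangular pairs -/

section BlockReduction

variable {I : Set ℝ}

theorem fromBlocks_mulVec_elim {l m n o : Type*} [Fintype l] [Fintype m] (A : Matrix n l ℝ)
    (B : Matrix n m ℝ) (C : Matrix o l ℝ) (D : Matrix o m ℝ) (x : l → ℝ) (y : m → ℝ) :
    fromBlocks A B C D *ᵥ Sum.elim x y = Sum.elim (A *ᵥ x + B *ᵥ y) (C *ᵥ x + D *ᵥ y) := by
  rw [fromBlocks_mulVec, Sum.elim_comp_inl, Sum.elim_comp_inr]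

theorem exists_eq_sum_elim {α β : Type*} (v : α ⊕ β → ℝ) : ∃ x y, v = Sum.elim x y :=
  ⟨_, _, (Sum.elim_comp_inl_inr v).symm⟩

/-- Surjectivity of `[E₁ B]` makes `im E` the first summand, and `H v₂ = 0` makes `S` the first
summand too. The constant basis `[1; 0]` serves for both, so no derivative appears. -/
theorem red_fromBlocks {κ α : Type*} [Fintype κ] [DecidableEq κ] [Fintype α] [DecidableEq α]
    {E₁ F₁ : ℝ → Matrix κ κ ℝ} {B G : ℝ → Matrix κ α ℝ} {H : ℝ → Matrix α α ℝ}
    (hsurj : ∀ t ∈ I, ∀ y, ∃ u v, E₁ t *ᵥ u + B t *ᵥ v = y) (hH : ∀ t ∈ I, IsUnit (H t).det) :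
    IsFull I (fun t => fromBlocks (E₁ t) (B t) 0 0) (fun t => fromBlocks (F₁ t) (G t) 0 (H t)) ∧
    Red I (fun t => fromBlocks (E₁ t) (B t) 0 0) (fun t => fromBlocks (F₁ t) (G t) 0 (H t))
      E₁ F₁ := by
  have hJ : ∀ u : κ → ℝ, fromRows (1 : Matrix κ κ ℝ) (0 : Matrix α κ ℝ) *ᵥ u = Sum.elim u 0 :=
    fun u => by rw [fromRows_mulVec, Matrix.one_mulVec, Matrix.zero_mulVec]
  have hJi : Function.Injective (fromRows (1 : Matrix κ κ ℝ) (0 : Matrix α κ ℝ)).mulVec :=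
    fun u v huv => by
      rw [hJ, hJ] at huv
      exact (Sum.elim_eq_iff.1 huv).1
  refine ⟨fun t ht y => ?_, fun _ => fromRows 1 0, fun _ => fromRows 1 0, smoothOn_const _,
    smoothOn_const _, fun t ht => ⟨hJi, fun v => ?_, hJi, fun v => ?_, ?_, ?_⟩⟩
  · obtain ⟨y₁, y₂, rfl⟩ := exists_eq_sum_elim y
    obtain ⟨u, v, huv⟩ := hsurj t ht (y₁ - G t *ᵥ ((H t)⁻¹ *ᵥ y₂))
    refine ⟨Sum.elim u v, Sum.elim 0 ((H t)⁻¹ *ᵥ y₂), ?_⟩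
    rw [fromBlocks_mulVec_elim, fromBlocks_mulVec_elim, huv, Matrix.mulVec_mulVec (v := y₂) (M := H t),
      Matrix.mul_nonsing_inv _ (hH t ht)]
    ext (i | i) <;> simp
  · constructor
    · rintro ⟨y, rfl⟩
      obtain ⟨u, v, huv⟩ := hsurj t ht y
      refine ⟨Sum.elim u v, ?_⟩
      rw [fromBlocks_mulVec_elim, huv, hJ]
      simp
    · rintro ⟨w, rfl⟩
      obtain ⟨u, v, rfl⟩ := exists_eq_sum_elim w
      refine ⟨E₁ t *ᵥ u + B t *ᵥ v, ?_⟩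
      rw [fromBlocks_mulVec_elim, hJ]
      simp
  · obtain ⟨v₁, v₂, rfl⟩ := exists_eq_sum_elim v
    simp only [hJ, fromBlocks_mulVec_elim, Sum.elim_eq_iff, Matrix.zero_mulVec, zero_add]
    constructor
    · rintro ⟨u, rfl, rfl⟩
      obtain ⟨x, y, hxy⟩ := hsurj t ht (F₁ t *ᵥ u)
      refine ⟨Sum.elim x y, ?_⟩
      rw [fromBlocks_mulVec_elim, hxy]
      simp
    · rintro ⟨w, hw⟩
      obtain ⟨x, y, rfl⟩ := exists_eq_sum_elim w
      rw [fromBlocks_mulVec_elim, Sum.elim_eq_iff] at hw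
      have h0 : H t *ᵥ v₂ = 0 := by rw [← hw.2]; simp
      refine ⟨v₁, rfl, ?_⟩
      have := congrArg ((H t)⁻¹ *ᵥ ·) h0
      simp only [Matrix.mulVec_mulVec, Matrix.nonsing_inv_mul _ (hH t ht), Matrix.one_mulVec,
        Matrix.mulVec_zero] at this
      exact this.symm
  · rw [fromBlocks_mul_fromRows, fromRows_mul]
    simp
  · rw [derivOn_const, fromBlocks_mul_fromRows, fromRows_mul]
    simp

end BlockReduction

/-! ### Pairs in row form are regular -/

section RowForm

/-- The positions in the blocks before the last one. -/
def initIdx {μ : ℕ} (l : Fin (μ + 1) → ℕ) (p : BlockIdx fun i => l (Fin.castSucc i)) :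
    BlockIdx l := ⟨p.1.castSucc, p.2⟩

/-- The positions in the last block. -/
def lastIdx {μ : ℕ} (l : Fin (μ + 1) → ℕ) (k : Fin (l (Fin.last μ))) : BlockIdx l :=
  ⟨Fin.last μ, k⟩

theorem blockIdx_ext {μ : ℕ} {l : Fin μ → ℕ} {p q : BlockIdx l} (h₁ : (p.1 : ℕ) = q.1)
    (h₂ : (p.2 : ℕ) = q.2) : p = q := by
  obtain ⟨i, k⟩ := p
  obtain ⟨j, k'⟩ := q
  obtain rfl : i = j := Fin.ext h₁
  obtain rfl : k = k' := Fin.ext h₂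
  rfl

/-- Splitting off the last block. -/
noncomputable def lastEquiv {μ : ℕ} (l : Fin (μ + 1) → ℕ) :
    (BlockIdx fun i => l (Fin.castSucc i)) ⊕ Fin (l (Fin.last μ)) ≃ BlockIdx l :=
  Equiv.ofBijective (Sum.elim (initIdx l) (lastIdx l)) <| by
    constructor
    · rintro (p | k) (q | k') h
      · have h1 : (p.1 : ℕ) = q.1 := congrArg (fun x : BlockIdx l => (x.1 : ℕ)) h
        have h2 : (p.2 : ℕ) = q.2 := congrArg (fun x : BlockIdx l => (x.2 : ℕ)) h
        rw [blockIdx_ext h1 h2]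
      · have h1 : (p.1 : ℕ) = μ := congrArg (fun x : BlockIdx l => (x.1 : ℕ)) h
        exact absurd h1 p.1.2.ne
      · have h1 : μ = (q.1 : ℕ) := congrArg (fun x : BlockIdx l => (x.1 : ℕ)) h
        exact absurd h1 q.1.2.ne'
      · have h2 : (k : ℕ) = k' := congrArg (fun x : BlockIdx l => (x.2 : ℕ)) h
        rw [Fin.ext h2]
    · rintro ⟨i, k⟩
      induction i using Fin.lastCases with
      | last => exact ⟨Sum.inr k, rfl⟩
      | cast i => exact ⟨Sum.inl ⟨i, k⟩, rfl⟩

/-- Splitting off the last block, in the presence of a leading block. -/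
noncomputable def sumLastEquiv (δ : Type*) {μ : ℕ} (l : Fin (μ + 1) → ℕ) :
    (δ ⊕ BlockIdx fun i => l (Fin.castSucc i)) ⊕ Fin (l (Fin.last μ)) ≃ δ ⊕ BlockIdx l :=
  (Equiv.sumAssoc _ _ _).trans (Equiv.sumCongr (Equiv.refl δ) (lastEquiv l))

theorem submatrix_sumLastEquiv {δ : Type*} {μ : ℕ} (l : Fin (μ + 1) → ℕ) (A : Matrix δ δ ℝ)
    (M : Matrix (BlockIdx l) (BlockIdx l) ℝ) :
    (fromBlocks A 0 0 M).submatrix (sumLastEquiv δ l) (sumLastEquiv δ l) =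
      fromBlocks (fromBlocks A 0 0 (M.submatrix (initIdx l) (initIdx l)))
        (fromRows 0 (M.submatrix (initIdx l) (lastIdx l)))
        (fromCols 0 (M.submatrix (lastIdx l) (initIdx l)))
        (M.submatrix (lastIdx l) (lastIdx l)) := by
  ext ((i | i) | i) ((j | j) | j) <;> rfl

theorem elemNilpotent_submatrix_last {μ : ℕ} (l : Fin (μ + 1) → ℕ) {ρ : Type*}
    (f : ρ → BlockIdx l) : (elemNilpotent l).submatrix (lastIdx l) f = 0 := by
  ext k j
  refine if_neg fun h => ?_
  have h1 : μ + 1 = ((f j).1 : ℕ) := h.1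
  exact absurd h1 (f j).1.2.ne'

/-- With increasing sizes every row before the last block has exactly one entry `1`, distinct rows
in distinct columns; the rows of the last block vanish. -/
theorem elemNilpotent_mul_transpose {μ : ℕ} {l : Fin μ → ℕ} (hl : Monotone l) :
    elemNilpotent l * (elemNilpotent l)ᵀ =
      Matrix.diagonal fun p => if (p.1 : ℕ) + 1 < μ then 1 else 0 := by
  ext p q
  rw [Matrix.mul_apply, Matrix.diagonal_apply]
  by_cases h : (p.1 : ℕ) + 1 < μ
  · have hk : (p.2 : ℕ) < l ⟨p.1 + 1, h⟩ :=
      p.2.2.trans_le (hl (Fin.mk_le_mk.2 (Nat.le_succ _) : p.1 ≤ ⟨p.1 + 1, h⟩))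
    rw [Finset.sum_eq_single (⟨⟨p.1 + 1, h⟩, ⟨p.2, hk⟩⟩ : BlockIdx l), if_pos h]
    · by_cases hpq : p = q
      · subst hpq
        simp [elemNilpotent]
      · rw [if_neg hpq]
        have : ¬((q.1 : ℕ) = p.1 ∧ (q.2 : ℕ) = p.2) := fun h =>
          hpq (blockIdx_ext h.1.symm h.2.symm)
        simp only [elemNilpotent, transpose_apply, Matrix.of_apply]
        simp [this]
    · intro s _ hs
      have : ¬((p.1 : ℕ) + 1 = s.1 ∧ (p.2 : ℕ) = s.2) := fun h =>
        hs (blockIdx_ext h.1.symm h.2.symm)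
      simp only [elemNilpotent, transpose_apply, Matrix.of_apply]
      simp [this]
    · simp
  · rw [if_neg h, ite_self]
    refine Finset.sum_eq_zero fun s _ => ?_
    have : ¬((p.1 : ℕ) + 1 = s.1 ∧ (p.2 : ℕ) = s.2) := fun h' => h (h'.1 ▸ s.1.2)
    simp only [elemNilpotent, transpose_apply, Matrix.of_apply]
    simp [this]

/-- A right inverse for the block rows before the last one, which is the surjectivity needed in
`red_fromBlocks`. -/
theorem elemNilpotent_row_mul_transpose {μ : ℕ} {l : Fin (μ + 1) → ℕ} (hl : Monotone l) :
    elemNilpotent (fun i => l (Fin.castSucc i)) * (elemNilpotent fun i => l (Fin.castSucc i))ᵀ +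
      (elemNilpotent l).submatrix (initIdx l) (lastIdx l) *
        ((elemNilpotent l).submatrix (initIdx l) (lastIdx l))ᵀ = 1 := by
  ext p q
  have h := congrFun (congrFun (elemNilpotent_mul_transpose hl) (initIdx l p)) (initIdx l q)
  rw [Matrix.mul_apply, ← (lastEquiv l).sum_comp, Fintype.sum_sum_type] at h
  rw [Matrix.add_apply, Matrix.mul_apply, Matrix.mul_apply]
  refine Eq.trans h ?_
  rw [Matrix.diagonal_apply, Matrix.one_apply]
  have h1 : ((initIdx l p).1 : ℕ) + 1 < μ + 1 := Nat.succ_lt_succ p.1.2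
  rw [if_pos h1]
  refine if_congr ⟨fun h => ?_, fun h => by rw [h]⟩ rfl rfl
  exact Sum.inl_injective ((lastEquiv l).injective h)

variable {I : Set ℝ}

theorem isUnit_det_submatrix_of_blockTriangular {β γ : Type*} [Fintype β] [DecidableEq β]
    [Fintype γ] [DecidableEq γ] {M : Matrix (β ⊕ γ) (β ⊕ γ) ℝ} (h : M.toBlocks₂₁ = 0)
    (hM : IsUnit M.det) : IsUnit M.toBlocks₁₁.det ∧ IsUnit M.toBlocks₂₂.det := by
  rw [← Matrix.fromBlocks_toBlocks M, h, Matrix.det_fromBlocks_zero₂₁] at hM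
  exact ⟨isUnit_of_mul_isUnit_left hM, isUnit_of_mul_isUnit_right hM⟩

/-- The last block row of `N` is zero and that of `R` is zero off its nonsingular diagonal block. So
`red_fromBlocks` applies, and a reduction step deletes the last block without differentiating
anything. -/
theorem regT_rowForm {δ : Type} [Fintype δ] [DecidableEq δ] (hI : I.Nonempty)
    {Ω : ℝ → Matrix δ δ ℝ} : ∀ {μ : ℕ} {l : Fin μ → ℕ}, Monotone l → (∀ i, 0 < l i) →
    ∀ {R : ℝ → Matrix (BlockIdx l) (BlockIdx l) ℝ},
    (∀ t ∈ I, (R t).BlockTriangular Sigma.fst ∧ IsUnit (R t).det) →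
    RegT I μ (fun _ => fromBlocks 1 0 0 (elemNilpotent l)) (fun t => fromBlocks (Ω t) 0 0 (R t))
  | 0, l, _, _, R, _ => fun t _ => by simp
  | μ + 1, l, hl, hpos, R, hR => by
    have h21 : ∀ t ∈ I, (R t).submatrix (lastIdx l) (initIdx l) = 0 := fun t ht => by
      ext k p
      exact (hR t ht).1 (Fin.castSucc_lt_last p.1)
    have hdet : ∀ t ∈ I, IsUnit ((R t).submatrix (initIdx l) (initIdx l)).det ∧
        IsUnit ((R t).submatrix (lastIdx l) (lastIdx l)).det := fun t ht =>
      isUnit_det_submatrix_of_blockTriangular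
        (M := (R t).submatrix (lastEquiv l) (lastEquiv l)) (h21 t ht)
        (by rw [Matrix.det_submatrix_equiv_self]; exact (hR t ht).2)
    have ih := regT_rowForm (Ω := Ω) hI (l := fun i => l (Fin.castSucc i))
      (fun i j hij => hl (Fin.castSucc_le_castSucc_iff.2 hij)) (fun i => hpos _)
      (R := fun t => (R t).submatrix (initIdx l) (initIdx l)) fun t ht =>
        ⟨fun p q hpq => (hR t ht).1 (Fin.castSucc_lt_castSucc_iff.2 hpq), (hdet t ht).1⟩
    obtain ⟨hf, hred⟩ := red_fromBlocks (I := I)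
      (E₁ := fun _ => fromBlocks 1 0 0 (elemNilpotent fun i => l (Fin.castSucc i)))
      (F₁ := fun t => fromBlocks (Ω t) 0 0 ((R t).submatrix (initIdx l) (initIdx l)))
      (B := fun _ => fromRows (0 : Matrix δ _ ℝ) ((elemNilpotent l).submatrix (initIdx l) (lastIdx l)))
      (G := fun t => fromRows (0 : Matrix δ _ ℝ) ((R t).submatrix (initIdx l) (lastIdx l)))
      (H := fun t => (R t).submatrix (lastIdx l) (lastIdx l))
      (fun t _ y => by
        obtain ⟨x, y, rfl⟩ := exists_eq_sum_elim y
        refine ⟨Sum.elim x ((elemNilpotent fun i => l (Fin.castSucc i))ᵀ *ᵥ y),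
          ((elemNilpotent l).submatrix (initIdx l) (lastIdx l))ᵀ *ᵥ y, ?_⟩
        rw [fromBlocks_mulVec_elim, fromRows_mulVec, Matrix.mulVec_mulVec, Matrix.mulVec_mulVec,
          Matrix.mulVec_mulVec]
        have := congrArg (· *ᵥ y) (elemNilpotent_row_mul_transpose hl)
        simp only [Matrix.add_mulVec, Matrix.one_mulVec] at this
        ext (i | i)
        · simp
        · simpa using congrFun this i) fun t ht => (hdet t ht).2
    have hreg : RegT I (μ + 1) _ _ := ⟨hf, _, _, _, _, _, by
      have : 0 < Fintype.card (Fin (l (Fin.last μ))) := by simpa using hpos _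
      rw [Fintype.card_sum (α := _ ⊕ _)]; omega, hred, ih⟩
    refine hreg.eqv hI (Eqv.symm le_rfl ?_)
    refine (eqv_submatrix 0 1 I _ _ (sumLastEquiv δ l)).of_eq (fun t ht => ?_) fun t ht => ?_
    · rw [submatrix_sumLastEquiv, elemNilpotent_submatrix_last, elemNilpotent_submatrix_last]
      congr 1
      exact fromCols_zero.symm
    · rw [submatrix_sumLastEquiv, h21 t ht]
      congr 1
      exact fromCols_zero.symm

end RowForm

end LinearDAE

namespace LinearDAE

open Set Matrix

/-! ### Pairs in column form are regular -/

section ColumnForm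

variable {I : Set ℝ} {β : Type} [Fintype β] [DecidableEq β]

/-- Extension by zero from a subtype. -/
def extendZero (P : β → Prop) [DecidablePred P] (u : {q // P q} → ℝ) (q : β) : ℝ :=
  if h : P q then u ⟨q, h⟩ else 0

theorem mulVec_extendZero {ρ : Type*} (P : β → Prop) [DecidablePred P] (A : Matrix ρ β ℝ)
    (u : {q // P q} → ℝ) :
    A *ᵥ extendZero P u = A.submatrix id (Subtype.val : {q // P q} → β) *ᵥ u := by
  ext i
  simp only [Matrix.mulVec, dotProduct, submatrix_apply, id]
  rw [← Fintype.sum_subtype_add_sum_subtype P,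
    Finset.sum_eq_zero (s := (Finset.univ : Finset {x // ¬ P x}))
      (fun x _ => by simp [extendZero, x.2]), add_zero]
  exact Finset.sum_congr rfl fun x _ => by simp [extendZero, x.2]

theorem mul_eq_submatrix_mul_submatrix {ρ σ : Type*} (P : β → Prop) [DecidablePred P]
    {A : Matrix ρ β ℝ} (hA : ∀ i q, ¬ P q → A i q = 0) (B : Matrix β σ ℝ) :
    A * B = A.submatrix id (Subtype.val : {q // P q} → β) * B.submatrix Subtype.val id := by
  ext i j
  rw [Matrix.mul_apply, ← Fintype.sum_subtype_add_sum_subtype P,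
    Finset.sum_eq_zero (s := (Finset.univ : Finset {x // ¬ P x}))
      (fun x _ => by rw [hA _ _ x.2, zero_mul]), add_zero]
  rfl

theorem mulVec_eq_submatrix_mulVec {ρ : Type*} (P : β → Prop) [DecidablePred P]
    {A : Matrix ρ β ℝ} (hA : ∀ i q, ¬ P q → A i q = 0) (v : β → ℝ) :
    A *ᵥ v = A.submatrix id (Subtype.val : {q // P q} → β) *ᵥ fun q => v q := by
  ext i
  simp only [Matrix.mulVec, dotProduct, submatrix_apply, id]
  rw [← Fintype.sum_subtype_add_sum_subtype P,
    Finset.sum_eq_zero (s := (Finset.univ : Finset {x // ¬ P x}))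
      (fun x _ => by rw [hA _ _ x.2, zero_mul]), add_zero]

/-- The diagonal blocks of `1 + M` are identities. -/
theorem isUnit_det_one_add_of_strict {b : β → ℕ} {M : Matrix β β ℝ}
    (hM : ∀ p q, b q ≤ b p → M p q = 0) :
    (1 + M).BlockTriangular b ∧ IsUnit (1 + M).det := by
  have hbt : (1 + M).BlockTriangular b := by
    refine Matrix.blockTriangular_one.add fun p q h => hM p q h.le
  refine ⟨hbt, ?_⟩
  rw [hbt.det]
  refine isUnit_iff_ne_zero.2 (Finset.prod_ne_zero_iff.2 fun k _ => ?_)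
  have : (1 + M).toSquareBlock b k = 1 := by
    ext ⟨p, hp⟩ ⟨q, hq⟩
    simp [Matrix.toSquareBlock_def, hM p q (by rw [hp, hq]), Matrix.one_apply]
  rw [this, Matrix.det_one]
  exact one_ne_zero

theorem inv_blockTriangular {b : β → ℕ} {R : Matrix β β ℝ} (h : R.BlockTriangular b)
    (hu : IsUnit R.det) : R⁻¹.BlockTriangular b := by
  have := Matrix.invertibleOfIsUnitDet R hu
  exact Matrix.blockTriangular_inv_of_blockTriangular h

/-- Block strictly upper triangular matrices, with respect to a level function `b`, all of whose
lower right corners have trivial kernel apart from the columns of lowest level. -/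
structure IsColumnNilpotent (b : β → ℕ) (N : Matrix β β ℝ) : Prop where
  strict : ∀ p q, b q ≤ b p → N p q = 0
  inj : ∀ (j : ℕ) (v : β → ℝ), (∀ p, j ≤ b p → (N *ᵥ v) p = 0) → ∀ q, j < b q → v q = 0

theorem IsColumnNilpotent.injective {b : β → ℕ} {N : Matrix β β ℝ} (h : IsColumnNilpotent b N) :
    Function.Injective (N.submatrix id (Subtype.val : {q // 0 < b q} → β)).mulVec := by
  rw [← Matrix.coe_mulVecLin, ← LinearMap.ker_eq_bot, LinearMap.ker_eq_bot']
  intro u hu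
  rw [Matrix.mulVecLin_apply, ← mulVec_extendZero (fun q => 0 < b q)] at hu
  ext ⟨q, hq⟩
  have := h.inj 0 (extendZero (fun q => 0 < b q) u) (fun p _ => by rw [hu]; rfl) q hq
  rwa [extendZero, dif_pos hq] at this

/-- Block upper triangular `R` and `R⁻¹` preserve the vectors that vanish on all levels `≥ j`, so
the kernel condition passes from `N` to `R⁻¹ N`. Removing level `0` shifts the levels by one. -/
theorem IsColumnNilpotent.reduce {b : β → ℕ} {N R : Matrix β β ℝ} (h : IsColumnNilpotent b N)
    (hR : R.BlockTriangular b) (hu : IsUnit R.det) :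
    IsColumnNilpotent (fun p : {q // 0 < b q} => b p - 1)
      ((R⁻¹ * N).submatrix Subtype.val Subtype.val) := by
  refine ⟨fun p q hpq => ?_, fun j v hv q hq => ?_⟩
  · rw [submatrix_apply, Matrix.mul_apply]
    refine Finset.sum_eq_zero fun s _ => ?_
    rcases lt_or_ge (b s) (b p) with hs | hs
    · rw [inv_blockTriangular hR hu hs, zero_mul]
    · have := p.2
      have := q.2
      rw [h.strict s q (by omega), mul_zero]
  · have key : ∀ p, j + 1 ≤ b p → ((R⁻¹ * N) *ᵥ extendZero (fun q => 0 < b q) v) p = 0 := by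
      intro p hp
      rw [mulVec_extendZero]
      exact hv ⟨p, by omega⟩ (by simp only; omega)
    have h2 : ∀ p, j + 1 ≤ b p → (N *ᵥ extendZero (fun q => 0 < b q) v) p = 0 := by
      intro p hp
      have : N *ᵥ extendZero (fun q => 0 < b q) v =
          R *ᵥ ((R⁻¹ * N) *ᵥ extendZero (fun q => 0 < b q) v) := by
        rw [Matrix.mulVec_mulVec, Matrix.mul_nonsing_inv_cancel_left _ _ hu]
      rw [this]
      refine Finset.sum_eq_zero fun s _ => ?_
      rcases lt_or_ge (b s) (b p) with hs | hs
      · exact mul_eq_zero_of_left (hR hs) _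
      · rw [key s (by omega), mul_zero]
    have := h.inj (j + 1) _ h2 q (by omega)
    simpa [extendZero, q.2] using this

/-- Reduction makes `N` depend on `t`, so the induction runs over variable `N`. The columns `W` of
`N` of positive level are a basis of `im N`, and `D = R⁻¹ W` is one of the constraint space. As the
columns of level `0` vanish, `N D = W M` and `R D + N D' = W (1 + M')`, where `M` is `R⁻¹ N` without
level `0`. The reduced pair thus has `M` and `1 + M'` in place of `N` and `R`; `M'` costs one
derivative per step. -/
theorem regT_columnForm {δ : Type} [Fintype δ] [DecidableEq δ] (hI : UniqueDiffOn ℝ I) {μ : ℕ} :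
    ∀ {β : Type} [Fintype β] [DecidableEq β] {b : β → ℕ}, (∀ p, b p < μ) →
    (∀ k < μ, ∃ p, b p = k) → ∀ {N R : ℝ → Matrix β β ℝ} {Ω : ℝ → Matrix δ δ ℝ},
    SmoothOn μ I N → SmoothOn μ I R →
    (∀ t ∈ I, IsColumnNilpotent b (N t) ∧ (R t).BlockTriangular b ∧ IsUnit (R t).det) →
    RegT I μ (fun t => fromBlocks 1 0 0 (N t)) (fun t => fromBlocks (Ω t) 0 0 (R t)) := by
  induction μ with
  | zero =>
    intro β _ _ b hb _ N R Ω _ _ _ t _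
    have : IsEmpty β := ⟨fun p => absurd (hb p) (Nat.not_lt_zero _)⟩
    simp
  | succ μ ih =>
    intro β _ _ b hb hne N R Ω hN hR h
    set W : ℝ → Matrix β {q // 0 < b q} ℝ := fun t => (N t).submatrix id Subtype.val with hW
    set D : ℝ → Matrix β {q // 0 < b q} ℝ := fun t => (R t)⁻¹ * W t with hD
    set M : ℝ → Matrix {q // 0 < b q} {q // 0 < b q} ℝ :=
      fun t => ((R t)⁻¹ * N t).submatrix Subtype.val Subtype.val with hM
    have hWs : SmoothOn (μ + 1 : ℕ) I W := hN.submatrix _ _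
    have hRi : SmoothOn (μ + 1 : ℕ) I fun t => (R t)⁻¹ := hR.inv fun t ht => (h t ht).2.2
    have hDs : SmoothOn (μ + 1 : ℕ) I D := hRi.mul hWs
    have hMs : SmoothOn (μ + 1 : ℕ) I M := (hRi.mul hN).submatrix _ _
    have h1 : (1 : ℕ∞) ≤ (μ + 1 : ℕ) := by exact_mod_cast Nat.le_add_left 1 μ
    have hμ : (μ : ℕ∞) + 1 ≤ (μ + 1 : ℕ) := by push_cast; exact le_rfl
    have hcol : ∀ t ∈ I, ∀ p q, ¬ 0 < b q → N t p q = 0 := fun t ht p q hq =>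
      (h t ht).1.strict p q (by omega)
    have hstrict : ∀ t ∈ I, ∀ p q : {q // 0 < b q}, b q - 1 ≤ b p - 1 →
        derivOn I M t p q = 0 := fun t ht p q hpq => by
      have h0 : ∀ s ∈ I, M s p q = 0 := fun s hs =>
        ((h s hs).1.reduce (h s hs).2.1 (h s hs).2.2).strict p q hpq
      have : derivOn I M t p q = derivWithin (fun _ => (0 : ℝ)) I t :=
        derivWithin_congr h0 (h0 t ht)
      rw [this]; simp
    have hND : ∀ t ∈ I, N t * D t = W t * M t := fun t ht => by
      rw [mul_eq_submatrix_mul_submatrix (fun q => 0 < b q) (hcol t ht)]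
      rfl
    have hNW : ∀ t ∈ I, N t * derivOn I D t = W t * derivOn I M t := fun t ht => by
      rw [mul_eq_submatrix_mul_submatrix (fun q => 0 < b q) (hcol t ht)]
      rfl
    have hRD : ∀ t ∈ I, R t * D t = W t := fun t ht => by
      rw [hD]
      exact Matrix.mul_nonsing_inv_cancel_left _ _ (h t ht).2.2
    have hdiag : ∀ {X : Matrix β {q // 0 < b q} ℝ}, Function.Injective X.mulVec →
        Function.Injective (fromBlocks (1 : Matrix δ δ ℝ) 0 0 X).mulVec := by
      intro X hX u v huv
      obtain ⟨u₁, u₂, rfl⟩ := exists_eq_sum_elim u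
      obtain ⟨v₁, v₂, rfl⟩ := exists_eq_sum_elim v
      rw [fromBlocks_mulVec_elim, fromBlocks_mulVec_elim, Sum.elim_eq_iff] at huv
      simp only [Matrix.one_mulVec, Matrix.zero_mulVec, add_zero, zero_add] at huv
      rw [huv.1, hX huv.2]
    refine ⟨fun t ht y => ?_, δ ⊕ {q // 0 < b q}, inferInstance, inferInstance,
      fun t => fromBlocks 1 0 0 (M t), fun t => fromBlocks (Ω t) 0 0 (1 + derivOn I M t), ?_,
      ⟨fun t => fromBlocks 1 0 0 (W t), fun t => fromBlocks 1 0 0 (D t), ?_, ?_,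
        fun t ht => ⟨hdiag (h t ht).1.injective, fun v => ?_, hdiag ?_, fun v => ?_, ?_, ?_⟩⟩, ?_⟩
    · obtain ⟨y₁, y₂, rfl⟩ := exists_eq_sum_elim y
      refine ⟨Sum.elim y₁ 0, Sum.elim 0 ((R t)⁻¹ *ᵥ y₂), ?_⟩
      rw [fromBlocks_mulVec_elim, fromBlocks_mulVec_elim, Matrix.mulVec_mulVec (v := y₂) (M := R t),
        Matrix.mul_nonsing_inv _ (h t ht).2.2]
      ext (i | i) <;> simp
    · obtain ⟨p, hp⟩ := hne 0 (Nat.succ_pos _)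
      rw [Fintype.card_sum, Fintype.card_sum]
      have := Fintype.card_subtype_lt (p := fun q => 0 < b q) (x := p) (by omega)
      omega
    · exact (smoothOn_const _).fromBlocks (smoothOn_const _) (smoothOn_const _)
        (hWs.mono (zero_le))
    · exact (smoothOn_const _).fromBlocks (smoothOn_const _) (smoothOn_const _) (hDs.mono h1)
    · constructor
      · rintro ⟨u, rfl⟩
        obtain ⟨u₁, u₂, rfl⟩ := exists_eq_sum_elim u
        refine ⟨Sum.elim u₁ (extendZero _ u₂), ?_⟩
        rw [fromBlocks_mulVec_elim, fromBlocks_mulVec_elim, mulVec_extendZero _ (N t)]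
        ext (i | i) <;> simp [hW]
      · rintro ⟨w, rfl⟩
        obtain ⟨w₁, w₂, rfl⟩ := exists_eq_sum_elim w
        refine ⟨Sum.elim w₁ fun q => w₂ q, ?_⟩
        rw [fromBlocks_mulVec_elim, fromBlocks_mulVec_elim,
          mulVec_eq_submatrix_mulVec _ (hcol t ht)]
        ext (i | i) <;> simp [hW]
    · refine injective_mulVec_mul (injective_mulVec_of_left_inverse
        (Matrix.mul_nonsing_inv _ (h t ht).2.2)) (h t ht).1.injective
    · obtain ⟨v₁, v₂, rfl⟩ := exists_eq_sum_elim v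
      constructor
      · rintro ⟨u, hu⟩
        obtain ⟨u₁, u₂, rfl⟩ := exists_eq_sum_elim u
        rw [fromBlocks_mulVec_elim, Sum.elim_eq_iff] at hu
        refine ⟨Sum.elim (Ω t *ᵥ v₁) (extendZero _ u₂), ?_⟩
        have h2 : D t *ᵥ u₂ = v₂ := by simpa using hu.2
        rw [fromBlocks_mulVec_elim, fromBlocks_mulVec_elim, mulVec_extendZero _ (N t), ← h2,
          Matrix.mulVec_mulVec (M := R t), hRD t ht]
        ext (i | i) <;> simp [hW]
      · rintro ⟨w, hw⟩
        obtain ⟨w₁, w₂, rfl⟩ := exists_eq_sum_elim w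
        rw [fromBlocks_mulVec_elim, fromBlocks_mulVec_elim, Sum.elim_eq_iff] at hw
        have h2 : N t *ᵥ w₂ = R t *ᵥ v₂ := by simpa using hw.2
        refine ⟨Sum.elim v₁ fun q => w₂ q, ?_⟩
        have h3 : D t *ᵥ (fun q => w₂ q) = v₂ := by
          rw [hD, ← Matrix.mulVec_mulVec, hW, ← mulVec_eq_submatrix_mulVec _ (hcol t ht), h2,
            Matrix.mulVec_mulVec, Matrix.nonsing_inv_mul _ (h t ht).2.2, Matrix.one_mulVec]
        rw [fromBlocks_mulVec_elim, h3]
        ext (i | i) <;> simp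
    · rw [fromBlocks_multiply, fromBlocks_multiply, hND t ht]
      simp
    · rw [derivOn_fromBlocks, fromBlocks_multiply, fromBlocks_multiply, fromBlocks_multiply,
        hRD t ht, hNW t ht, fromBlocks_add]
      simp [Matrix.mul_add]
    · refine ih (b := fun p : {q // 0 < b q} => b p - 1) (fun p => ?_) (fun k hk => ?_)
        (hMs.mono (le_self_add.trans hμ))
        ((smoothOn_const _).add (hMs.derivOn hI hμ)) fun t ht =>
          ⟨(h t ht).1.reduce (h t ht).2.1 (h t ht).2.2, isUnit_det_one_add_of_strict (hstrict t ht)⟩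
      · have := hb p
        have := p.2
        omega
      · obtain ⟨p, hp⟩ := hne (k + 1) (by omega)
        exact ⟨⟨p, by omega⟩, by simp only; omega⟩

/-- With decreasing sizes each entry of `v` in block `i + 1` reappears in `N v`, at the same
position of block `i`. -/
theorem isColumnNilpotent_elemNilpotent {μ : ℕ} {l : Fin μ → ℕ} (hl : Antitone l) :
    IsColumnNilpotent (fun p : BlockIdx l => (p.1 : ℕ)) (elemNilpotent l) := by
  refine ⟨fun p q h => if_neg fun h' => by omega, fun j v hv q hq => ?_⟩
  obtain ⟨⟨i, hi⟩, k, hk⟩ := q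
  obtain ⟨i, rfl⟩ : ∃ i', i = i' + 1 := ⟨i - 1, by simp only at hq; omega⟩
  have hk' : k < l ⟨i, by omega⟩ := hk.trans_le (hl (Fin.mk_le_mk.2 (Nat.le_succ _)))
  have := hv ⟨⟨i, by omega⟩, ⟨k, hk'⟩⟩ (by simp only at hq ⊢; omega)
  rw [Matrix.mulVec, dotProduct, Finset.sum_eq_single
    (⟨⟨i + 1, hi⟩, ⟨k, hk⟩⟩ : BlockIdx l)] at this
  · simpa [elemNilpotent] using this
  · intro s _ hs
    have h2 : ¬(i + 1 = (s.1 : ℕ) ∧ k = (s.2 : ℕ)) := fun h =>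
      hs (blockIdx_ext h.1.symm h.2.symm)
    simp [elemNilpotent, h2]
  · simp

end ColumnForm

/-! ### Quasi-SCF up to equivalence, and the adjoint pair -/

section QForm

variable {I : Set ℝ} {ι : Type} [Fintype ι] [DecidableEq ι]

/-- The pair is equivalent, with transformations of class `C^n`, to a pair in quasi-SCF with block
sizes `l`. -/
def QForm (n : ℕ∞) (I : Set ℝ) (E F : ℝ → Matrix ι ι ℝ) (d : ℕ) {μ : ℕ} (l : Fin μ → ℕ) : Prop :=
  ∃ (Ω : ℝ → Matrix (Fin d) (Fin d) ℝ) (R : ℝ → Matrix (BlockIdx l) (BlockIdx l) ℝ),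
    (∀ t ∈ I, (R t).BlockTriangular Sigma.fst ∧ IsUnit (R t).det) ∧
    Eqv n n I E F (fun _ => fromBlocks 1 0 0 (elemNilpotent l))
      (fun t => fromBlocks (Ω t) 0 0 (R t))

variable {E F : ℝ → Matrix ι ι ℝ} {n : ℕ∞} {d μ : ℕ} {l : Fin μ → ℕ}

theorem QForm.regT_of_monotone (hI : I.Nonempty) (hn : 1 ≤ n) (h : QForm n I E F d l)
    (hl : Monotone l) (hpos : ∀ i, 0 < l i) : RegT I μ E F := by
  obtain ⟨Ω, R, hR, he⟩ := h
  exact (regT_rowForm hI hl hpos hR).eqv hI ((he.mono (zero_le) hn).symm le_rfl)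

theorem QForm.regT_of_antitone (hI : UniqueDiffOn ℝ I) (hI' : I.Nonempty) (hn : μ + 1 ≤ n)
    (hE : SmoothOn μ I E) (hF : SmoothOn μ I F) (h : QForm n I E F d l)
    (hl : Antitone l) (hpos : ∀ i, 0 < l i) : RegT I μ E F := by
  obtain ⟨Ω, R, hR, he⟩ := h
  have hn1 : 1 ≤ n := le_add_self.trans hn
  -- Smoothness of `R` is read off the equivalence; its formula contains `K'`, whence `μ + 1 ≤ n`.
  have hRs : SmoothOn μ I R := by
    obtain ⟨L, Li, K, Ki, hL, hLi, hK, hKi, h⟩ := he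
    have hLμ := hL.mono (le_self_add.trans hn)
    have hKμ := hK.mono (le_self_add.trans hn)
    have hF' : SmoothOn μ I (fun t => fromBlocks (Ω t) 0 0 (R t)) :=
      (((hLμ.mul hF).mul hKμ).add ((hLμ.mul hE).mul (hK.derivOn hI hn))).congr
        fun t ht => (h t ht).2.2.2.2.2
    exact fun i j => hF' (Sum.inr i) (Sum.inr j)
  refine RegT.eqv hI' ?_ ((he.mono (zero_le) hn1).symm le_rfl)
  exact regT_columnForm hI (b := fun p : BlockIdx l => (p.1 : ℕ)) (fun p => p.1.2)
    (fun k hk => ⟨⟨⟨k, hk⟩, ⟨0, hpos _⟩⟩, rfl⟩) (smoothOn_const _) hRs fun t ht =>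
      ⟨isColumnNilpotent_elemNilpotent hl, fun p q hpq => (hR t ht).1 hpq, (hR t ht).2⟩

/-- The leading coefficient of the adjoint pair. -/
def adjE (E : ℝ → Matrix ι ι ℝ) (t : ℝ) : Matrix ι ι ℝ := (E t)ᵀ

/-- The second coefficient of the adjoint pair. -/
noncomputable def adjF (I : Set ℝ) (E F : ℝ → Matrix ι ι ℝ) (t : ℝ) : Matrix ι ι ℝ :=
  (derivOn I E t)ᵀ - (F t)ᵀ

theorem adjF_adjF (I : Set ℝ) (E F : ℝ → Matrix ι ι ℝ) : adjF I (adjE E) (adjF I E F) = F := by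
  ext t i j
  simp [adjF, adjE, derivOn]

/-- `Kᵀ` acts from the left and `Lᵀ` from the right. In `(L E K)'` the term with `K'` cancels the
one in `F'`, and the term with `L'` is the derivative term of the adjoint equivalence. -/
theorem Eqv.adj {ι' : Type} [Fintype ι'] [DecidableEq ι'] (hn : 1 ≤ n) (hE : SmoothOn 1 I E)
    {E' F' : ℝ → Matrix ι' ι' ℝ} (h : Eqv n n I E F E' F') :
    Eqv n n I (adjE E) (adjF I E F) (adjE E') (adjF I E' F') := by
  obtain ⟨L, Li, K, Ki, hL, hLi, hK, hKi, h⟩ := h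
  refine ⟨fun t => (K t)ᵀ, fun t => (Ki t)ᵀ, fun t => (L t)ᵀ, fun t => (Li t)ᵀ, hK.transpose,
    hKi.transpose, hL.transpose, hLi.transpose, fun t ht => ?_⟩
  obtain ⟨h1, h2, h3, h4, h5, h6⟩ := h t ht
  simp only [← Matrix.transpose_mul, h1, h2, h3, h4, Matrix.transpose_one, true_and]
  have hL1 := hL.mono hn
  have hK1 := hK.mono hn
  have hd : derivOn I E' t = derivOn I L t * E t * K t + L t * derivOn I E t * K t +
      L t * E t * derivOn I K t := by
    rw [derivOn_congr (fun t ht => (h t ht).2.2.2.2.1) ht, derivOn_mul (hL1.mul hE) hK1 ht,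
      derivOn_mul hL1 hE ht, Matrix.add_mul]
  constructor
  · simp only [adjE, h5, Matrix.transpose_mul, Matrix.mul_assoc]
  · simp only [adjE, adjF, hd, h6, derivOn_transpose, ← Matrix.transpose_mul,
      ← Matrix.transpose_add, ← Matrix.transpose_sub]
    simp only [Matrix.mul_sub, Matrix.sub_mul, Matrix.mul_assoc]
    abel_nf

/-- `N` is constant, so the adjoint has `Nᵀ` and `-Rᵀ` as its blocks. Reversing the order of the
blocks makes `Rᵀ` upper triangular again and `Nᵀ` elementary nilpotent with the reversed sizes, so
row and column type are exchanged. -/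
theorem QForm.adj (hn : 1 ≤ n) (hE : SmoothOn 1 I E) (h : QForm n I E F d l) :
    QForm n I (adjE E) (adjF I E F) d fun i => l (Fin.rev i) := by
  obtain ⟨Ω, R, hR, he⟩ := h
  let e : (BlockIdx fun i => l (Fin.rev i)) ≃ BlockIdx l :=
    Equiv.sigmaCongrLeft (β := fun i => Fin (l i)) Fin.revPerm
  have hrev : ∀ p, (e p).1 = Fin.rev p.1 := fun p => rfl
  have hpos : ∀ p, ((e p).2 : ℕ) = p.2 := fun p => rfl
  refine ⟨fun t => -(Ω t)ᵀ, fun t => (-(R t)ᵀ).submatrix e e, fun t ht => ⟨fun p q hpq => ?_, ?_⟩,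
    ((he.adj hn hE).trans hn (eqv_submatrix n n I _ _ ((Equiv.refl _).sumCongr e))).of_eq
      (fun t ht => ?_) fun t ht => ?_⟩
  · refine neg_eq_zero.2 ((hR t ht).1 ?_)
    rw [hrev, hrev]
    exact Fin.rev_lt_rev.2 hpq
  · rw [Matrix.det_submatrix_equiv_self, ← Matrix.isUnit_iff_isUnit_det]
    exact ((Matrix.isUnit_iff_isUnit_det _).2 (by
      rw [Matrix.det_transpose]; exact (hR t ht).2)).neg
  · have hN : elemNilpotent (fun i => l (Fin.rev i)) = (elemNilpotent l)ᵀ.submatrix e e := by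
      ext p q
      simp only [elemNilpotent, submatrix_apply, transpose_apply, Matrix.of_apply, hrev, hpos,
        Fin.val_rev]
      refine if_congr ?_ rfl rfl
      have := p.1.2
      have := q.1.2
      omega
    rw [hN]
    ext (i | i) (j | j) <;> simp [adjE, Matrix.one_apply, eq_comm]
  · ext (i | i) (j | j) <;> simp [adjF]

end QForm

end LinearDAE

namespace LinearDAE

open Set Matrix

/-! ### Block triangular form of a pre-regular pair -/

section BlockForm

variable {I : Set ℝ}

theorem rank_eq_card_of_surjective {α β : Type*} [Fintype α] [Fintype β] {Q : Matrix α β ℝ}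
    (h : ∀ y, ∃ v, Q *ᵥ v = y) : Q.rank = Fintype.card α := by
  have hs : Function.Surjective Q.mulVecLin := h
  rw [Matrix.rank, LinearMap.range_eq_top.2 hs, finrank_top, Module.finrank_fintype_fun_eq_card]

theorem isUnit_det_of_injective {α : Type*} [Fintype α] [DecidableEq α] {A : Matrix α α ℝ}
    (h : ∀ v, A *ᵥ v = 0 → v = 0) : IsUnit A.det := by
  rw [← Matrix.isUnit_iff_isUnit_det, ← Matrix.mulVec_injective_iff_isUnit,
    ← Matrix.coe_mulVecLin, ← LinearMap.ker_eq_bot, LinearMap.ker_eq_bot']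
  exact h

/-- `Z`, `W` are bases of `im E` and its complement, so `Wᵀ E = 0`. `D` spans `im (Fᵀ W)` and `C`
its complement `ker (Wᵀ F) = S`. Pre-regularity makes `Wᵀ F` surjective, hence `H = Wᵀ F D`
nonsingular. `C'` and `D'` cost the coefficients one derivative, but not the transformations. -/
theorem exists_eqv_fromBlocks (hI : I.OrdConnected) (hI' : I.Nontrivial) {m r a θ : ℕ}
    (ha : r + a = m) {E F : ℝ → Matrix (Fin m) (Fin m) ℝ} {n k : ℕ∞} (hk : k + 1 ≤ n)
    (hE : SmoothOn n I E) (hF : SmoothOn n I F) (h : IsPreRegular I E F r θ) :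
    ∃ (E₁ F₁ : ℝ → Matrix (Fin r) (Fin r) ℝ) (B G : ℝ → Matrix (Fin r) (Fin a) ℝ)
      (H : ℝ → Matrix (Fin a) (Fin a) ℝ),
      SmoothOn k I E₁ ∧ SmoothOn k I F₁ ∧ SmoothOn k I B ∧ SmoothOn k I G ∧ SmoothOn k I H ∧
      Eqv n n I E F (fun t => fromBlocks (E₁ t) (B t) 0 0)
        (fun t => fromBlocks (F₁ t) (G t) 0 (H t)) ∧
      (∀ t ∈ I, ∀ y, ∃ u v, E₁ t *ᵥ u + B t *ᵥ v = y) ∧ ∀ t ∈ I, IsUnit (H t).det := by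
  have hn : 1 ≤ n := le_add_self.trans hk
  have hkn : k ≤ n := le_self_add.trans hk
  have hU := uniqueDiffOn_of_ordConnected hI hI'
  obtain ⟨Z, W, hZ, hW, hZW⟩ := exists_smooth_frame hI hI' hn hE (fun t ht => (h t ht).2.1)
    (l := a) (by simpa using ha)
  have hfull : IsFull I E F := isFull_iff.2 fun t ht => (h t ht).1
  have hrank : ∀ t ∈ I, ((F t)ᵀ * W t).rank = a := fun t ht => by
    obtain ⟨-, h2, -, -, -, h6, -⟩ := hZW t ht
    rw [← Matrix.rank_transpose, transpose_mul, transpose_transpose, rank_eq_card_of_surjective,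
      Fintype.card_fin]
    intro y
    obtain ⟨v, w, hvw⟩ := hfull t ht (W t *ᵥ y)
    refine ⟨w, ?_⟩
    have := congrArg ((W t)ᵀ *ᵥ ·) hvw
    simpa [Matrix.mulVec_add, Matrix.mulVec_mulVec, h2, h6] using this
  obtain ⟨D, C, hD, hC, hDC⟩ := exists_smooth_frame hI hI' hn (hF.transpose.mul hW) hrank
    (l := r) (by simpa [add_comm] using ha)
  have hC' := hC.derivOn hU hk
  have hD' := hD.derivOn hU hk
  have hEk := hE.mono hkn
  have hFk := hF.mono hkn
  have hZk := (hZ.mono hkn).transpose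
  have hWk := (hW.mono hkn).transpose
  have hCk := hC.mono hkn
  have hDk := hD.mono hkn
  refine ⟨fun t => (Z t)ᵀ * E t * C t, fun t => (Z t)ᵀ * F t * C t + (Z t)ᵀ * E t * derivOn I C t,
    fun t => (Z t)ᵀ * E t * D t, fun t => (Z t)ᵀ * F t * D t + (Z t)ᵀ * E t * derivOn I D t,
    fun t => (W t)ᵀ * F t * D t, (hZk.mul hEk).mul hCk,
    ((hZk.mul hFk).mul hCk).add ((hZk.mul hEk).mul hC'), (hZk.mul hEk).mul hDk,
    ((hZk.mul hFk).mul hDk).add ((hZk.mul hEk).mul hD'), (hWk.mul hFk).mul hDk,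
    ⟨fun t => fromRows (Z t)ᵀ (W t)ᵀ, fun t => fromCols (Z t) (W t),
      fun t => fromCols (C t) (D t), fun t => fromRows (C t)ᵀ (D t)ᵀ,
      hZ.transpose.fromRows hW.transpose, hZ.fromCols hW, hC.fromCols hD,
      hC.transpose.fromRows hD.transpose, fun t ht => ?_⟩, fun t ht y => ?_, fun t ht => ?_⟩
  · obtain ⟨a1, a2, a3, a4, a5, a6, Y, a7⟩ := hZW t ht
    obtain ⟨b1, b2, b3, b4, b5, b6, Y', b7⟩ := hDC t ht
    have hWFC : (W t)ᵀ * F t * C t = 0 := by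
      have := congrArg Matrix.transpose b6
      simpa [Matrix.mul_assoc] using this
    refine ⟨?_, ?_, ?_, ?_, ?_, ?_⟩
    · rw [fromRows_mul_fromCols, a1, a2, a3, a4, fromBlocks_one]
    · rw [fromCols_mul_fromRows, a5]
    · rw [fromCols_mul_fromRows, add_comm, b5]
    · rw [fromRows_mul_fromCols, b1, b2, b3, b4, fromBlocks_one]
    · rw [fromRows_mul, fromRows_mul_fromCols, a6, Matrix.zero_mul, Matrix.zero_mul]
    · rw [derivOn_fromCols, fromRows_mul, fromRows_mul_fromCols, fromRows_mul,
        fromRows_mul_fromCols, a6, hWFC, fromBlocks_add]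
      simp only [Matrix.zero_mul, add_zero]
  · obtain ⟨a1, a2, a3, a4, a5, a6, Y, a7⟩ := hZW t ht
    obtain ⟨b1, b2, b3, b4, b5, b6, Y', b7⟩ := hDC t ht
    refine ⟨((C t)ᵀ * Y) *ᵥ y, ((D t)ᵀ * Y) *ᵥ y, ?_⟩
    rw [Matrix.mulVec_mulVec, Matrix.mulVec_mulVec, ← Matrix.add_mulVec]
    have : (Z t)ᵀ * E t * C t * ((C t)ᵀ * Y) + (Z t)ᵀ * E t * D t * ((D t)ᵀ * Y) = 1 := by
      calc _ = (Z t)ᵀ * E t * (D t * (D t)ᵀ + C t * (C t)ᵀ) * Y := by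
            simp only [Matrix.mul_assoc, Matrix.mul_add, Matrix.add_mul]
            rw [add_comm]
        _ = 1 := by rw [b5, Matrix.mul_one, Matrix.mul_assoc, ← a7, a1]
    rw [this, Matrix.one_mulVec]
  · obtain ⟨b1, b2, b3, b4, b5, b6, Y', b7⟩ := hDC t ht
    refine isUnit_det_of_injective fun v hv => ?_
    have : (D t)ᵀ * D t = Y'ᵀ * ((W t)ᵀ * F t * D t) := by
      nth_rw 1 [b7]
      simp only [transpose_mul, transpose_transpose, Matrix.mul_assoc]
    rw [← Matrix.one_mulVec v, ← b1, this, ← Matrix.mulVec_mulVec, hv, Matrix.mulVec_zero]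

variable {κ κ' α : Type*} [Fintype κ] [DecidableEq κ] [Fintype κ'] [DecidableEq κ'] [Fintype α]
  [DecidableEq α] {n : ℕ∞}

/-- An equivalence of the reduced pair extends by the identity on the split-off block. -/
theorem Eqv.exists_fromBlocks {E₁ F₁ : ℝ → Matrix κ κ ℝ} {E₂ F₂ : ℝ → Matrix κ' κ' ℝ}
    {B G : ℝ → Matrix κ α ℝ} {H : ℝ → Matrix α α ℝ} (h : Eqv n n I E₁ F₁ E₂ F₂)
    (hB : SmoothOn n I B) (hG : SmoothOn n I G)
    (hsurj : ∀ t ∈ I, ∀ y, ∃ u v, E₁ t *ᵥ u + B t *ᵥ v = y) :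
    ∃ B' G' : ℝ → Matrix κ' α ℝ, SmoothOn n I B' ∧ SmoothOn n I G' ∧
      (∀ t ∈ I, ∀ y, ∃ u v, E₂ t *ᵥ u + B' t *ᵥ v = y) ∧
      Eqv n n I (fun t => fromBlocks (E₁ t) (B t) 0 0) (fun t => fromBlocks (F₁ t) (G t) 0 (H t))
        (fun t => fromBlocks (E₂ t) (B' t) 0 0) (fun t => fromBlocks (F₂ t) (G' t) 0 (H t)) := by
  obtain ⟨L, Li, K, Ki, hL, hLi, hK, hKi, h⟩ := h
  refine ⟨fun t => L t * B t, fun t => L t * G t, hL.mul hB, hL.mul hG, fun t ht y => ?_,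
    fun t => fromBlocks (L t) 0 0 1, fun t => fromBlocks (Li t) 0 0 1,
    fun t => fromBlocks (K t) 0 0 1, fun t => fromBlocks (Ki t) 0 0 1,
    hL.fromBlocks (smoothOn_const _) (smoothOn_const _) (smoothOn_const _),
    hLi.fromBlocks (smoothOn_const _) (smoothOn_const _) (smoothOn_const _),
    hK.fromBlocks (smoothOn_const _) (smoothOn_const _) (smoothOn_const _),
    hKi.fromBlocks (smoothOn_const _) (smoothOn_const _) (smoothOn_const _), fun t ht => ?_⟩
  · obtain ⟨h1, h2, h3, h4, h5, h6⟩ := h t ht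
    obtain ⟨u, v, huv⟩ := hsurj t ht (Li t *ᵥ y)
    refine ⟨Ki t *ᵥ u, v, ?_⟩
    have := congrArg (L t *ᵥ ·) huv
    simp only [Matrix.mulVec_add, Matrix.mulVec_mulVec, h1, Matrix.one_mulVec] at this
    rw [Matrix.mulVec_mulVec, h5, Matrix.mul_assoc, h3, Matrix.mul_one, this]
  · obtain ⟨h1, h2, h3, h4, h5, h6⟩ := h t ht
    simp only [derivOn_fromBlocks, derivOn_const, fromBlocks_multiply, fromBlocks_add, h1, h2, h3,
      h4, h5, h6]
    simp [fromBlocks_one]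

/-- The column operation `K = [1 -X; 0 P]` produces `J`. Since `H P` is invertible, a row operation
then clears the upper right block of `F`, and leaves `E` alone because the lower row of `E` is zero.
`X'` and `P'` cost one derivative. -/
theorem eqv_fromBlocks_of_eq {E₁ F₁ : ℝ → Matrix κ κ ℝ} {B G X J : ℝ → Matrix κ α ℝ}
    {H P Pi : ℝ → Matrix α α ℝ} (hI : UniqueDiffOn ℝ I) (hE₁ : SmoothOn n I E₁)
    (hF₁ : SmoothOn n I F₁) (hB : SmoothOn n I B) (hG : SmoothOn n I G) (hH : SmoothOn n I H)
    (hX : SmoothOn (n + 1) I X) (hP : SmoothOn (n + 1) I P) (hPi : SmoothOn (n + 1) I Pi)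
    (h : ∀ t ∈ I, P t * Pi t = 1 ∧ Pi t * P t = 1 ∧ B t * P t - E₁ t * X t = J t ∧
      IsUnit (H t).det) :
    Eqv n n I (fun t => fromBlocks (E₁ t) (B t) 0 0) (fun t => fromBlocks (F₁ t) (G t) 0 (H t))
      (fun t => fromBlocks (E₁ t) (J t) 0 0) (fun t => fromBlocks (F₁ t) 0 0 (H t * P t)) := by
  have hXn := hX.mono le_self_add
  have hPn := hP.mono le_self_add
  have hPin := hPi.mono le_self_add
  have hHi : SmoothOn n I fun t => (H t)⁻¹ := hH.inv fun t ht => (h t ht).2.2.2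
  set G' : ℝ → Matrix κ α ℝ := fun t =>
    (G t * P t - F₁ t * X t) + (B t * derivOn I P t - E₁ t * derivOn I X t) with hG'
  have hG's : SmoothOn n I G' := ((hG.mul hPn).sub (hF₁.mul hXn)).add
    ((hB.mul (hP.derivOn hI le_rfl)).sub (hE₁.mul (hX.derivOn hI le_rfl)))
  set T : ℝ → Matrix κ α ℝ := fun t => G' t * (Pi t * (H t)⁻¹) with hT
  have hTs : SmoothOn n I T := hG's.mul (hPin.mul hHi)
  refine ⟨fun t => fromBlocks 1 (-T t) 0 1, fun t => fromBlocks 1 (T t) 0 1,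
    fun t => fromBlocks 1 (-X t) 0 (P t), fun t => fromBlocks 1 (X t * Pi t) 0 (Pi t),
    (smoothOn_const _).fromBlocks hTs.neg (smoothOn_const _) (smoothOn_const _),
    (smoothOn_const _).fromBlocks hTs (smoothOn_const _) (smoothOn_const _),
    (smoothOn_const _).fromBlocks hXn.neg (smoothOn_const _) hPn,
    (smoothOn_const _).fromBlocks (hXn.mul hPin) (smoothOn_const _) hPin, fun t ht => ?_⟩
  obtain ⟨h1, h2, h3, h4⟩ := h t ht
  have hTH : T t * (H t * P t) = G' t := by
    rw [hT]
    calc G' t * (Pi t * (H t)⁻¹) * (H t * P t) = G' t * (Pi t * ((H t)⁻¹ * H t) * P t) := by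
          simp only [Matrix.mul_assoc]
      _ = G' t := by rw [Matrix.nonsing_inv_mul _ h4, Matrix.mul_one, h2, Matrix.mul_one]
  refine ⟨?_, ?_, ?_, ?_, ?_, ?_⟩
  · simp [fromBlocks_multiply, fromBlocks_one]
  · simp [fromBlocks_multiply, fromBlocks_one]
  · simp [fromBlocks_multiply, fromBlocks_one, h1]
  · simp [fromBlocks_multiply, fromBlocks_one, h2, Matrix.mul_assoc]
  · simp [fromBlocks_multiply, ← h3, sub_eq_neg_add]
  · have h12 : F₁ t * -X t + (G t + -T t * H t) * P t +
        (E₁ t * derivOn I (fun t => -X t) t + B t * derivOn I P t) = 0 := by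
      rw [derivOn_neg, Matrix.add_mul, Matrix.neg_mul, Matrix.neg_mul, Matrix.mul_assoc (T t), hTH,
        hG']
      simp only [Matrix.mul_neg]
      abel
    simp only [derivOn_fromBlocks, derivOn_const, fromBlocks_multiply, fromBlocks_add]
    simp only [Matrix.one_mul, Matrix.mul_one, Matrix.mul_zero, Matrix.zero_mul, add_zero,
      zero_add, h12]

end BlockForm

/-! ### From regularity to the row form, block by block -/

section RowStep

variable {I : Set ℝ}

/-- The last block row of `N` is zero, so there only `B` contributes. -/
theorem surjective_lastRows {δ α : Type*} [Fintype δ] [DecidableEq δ] [Fintype α] {μ : ℕ}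
    {l : Fin (μ + 1) → ℕ} {B : Matrix (δ ⊕ BlockIdx l) α ℝ}
    (hsurj : ∀ y, ∃ u v, fromBlocks (1 : Matrix δ δ ℝ) 0 0 (elemNilpotent l) *ᵥ u +
      B *ᵥ v = y) (y : Fin (l (Fin.last μ)) → ℝ) :
    ∃ v, B.submatrix (fun k => Sum.inr (lastIdx l k)) id *ᵥ v = y := by
  obtain ⟨u, v, huv⟩ := hsurj (Sum.elim 0 (Sum.elim 0 y ∘ (lastEquiv l).symm))
  obtain ⟨u₁, u₂, rfl⟩ := exists_eq_sum_elim u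
  refine ⟨v, funext fun k => ?_⟩
  have h := congrFun huv (Sum.inr (lastIdx l k))
  have h0 : (elemNilpotent l *ᵥ u₂) (lastIdx l k) = 0 := by
    have := congrFun (congrArg (· *ᵥ u₂) (elemNilpotent_submatrix_last l id)) k
    exact this.trans (by simp)
  have h1 : (lastEquiv l).symm (lastIdx l k) = Sum.inr k := (lastEquiv l).symm_apply_apply (Sum.inr k)
  rw [fromBlocks_mulVec_elim] at h
  have : (B *ᵥ v) (Sum.inr (lastIdx l k)) = y k := by simpa [h0, h1] using h
  exact this

/-- Ensures that a block of size `card α` can be appended to an increasing sequence of sizes. -/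
theorem le_card_of_surjective {δ α : Type*} [Fintype δ] [DecidableEq δ] [Fintype α] {μ : ℕ}
    {l : Fin μ → ℕ} (hl : Monotone l) {B : Matrix (δ ⊕ BlockIdx l) α ℝ}
    (hsurj : ∀ y, ∃ u v, fromBlocks (1 : Matrix δ δ ℝ) 0 0 (elemNilpotent l) *ᵥ u +
      B *ᵥ v = y) (i : Fin μ) : l i ≤ Fintype.card α := by
  cases μ with
  | zero => exact i.elim0
  | succ μ =>
    refine (hl (Fin.le_last i)).trans ?_
    have := rank_eq_card_of_surjective (surjective_lastRows hsurj)
    rw [Fintype.card_fin] at this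
    rw [← this]
    exact Matrix.rank_le_card_width _

/-- A smooth matrix function of full row rank is brought to the form `[I 0]`. -/
theorem exists_smooth_rightNormalForm (hI : I.OrdConnected) (hI' : I.Nontrivial) {n : ℕ∞}
    (hn : 1 ≤ n) {k a : ℕ} (hka : k ≤ a) {Q : ℝ → Matrix (Fin k) (Fin a) ℝ} (hQ : SmoothOn n I Q)
    (hsurj : ∀ t ∈ I, ∀ y, ∃ v, Q t *ᵥ v = y) :
    ∃ P Pi : ℝ → Matrix (Fin a) (Fin a) ℝ, SmoothOn n I P ∧ SmoothOn n I Pi ∧ ∀ t ∈ I,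
      P t * Pi t = 1 ∧ Pi t * P t = 1 ∧
      ∀ i j, (Q t * P t) i j = if (i : ℕ) = j then 1 else 0 := by
  obtain ⟨σ, rfl⟩ := Nat.exists_eq_add_of_le hka
  obtain ⟨U, V, hU, hV, hUV⟩ := exists_smooth_frame hI hI' hn hQ.transpose (k := k) (l := σ)
    (fun t ht => by
      rw [Matrix.rank_transpose, rank_eq_card_of_surjective (hsurj t ht), Fintype.card_fin])
    (by simp)
  -- The rows of `Q` completed by a basis `V` of `ker Q`. With `P` the inverse, `Q P` consists of
  -- the first `k` rows of the identity.
  set Pi : ℝ → Matrix (Fin (k + σ)) (Fin (k + σ)) ℝ := fun t =>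
    (fromRows (Q t) (V t)ᵀ).submatrix finSumFinEquiv.symm id with hPi
  have hPis : SmoothOn n I Pi := (hQ.fromRows hV.transpose).submatrix _ _
  have hdet : ∀ t ∈ I, IsUnit (Pi t).det := fun t ht => by
    obtain ⟨-, -, -, -, h5, -, Y, h7⟩ := hUV t ht
    refine isUnit_det_of_injective fun v hv => ?_
    have hrow : ∀ x, (fromRows (Q t) (V t)ᵀ *ᵥ v) x = 0 := fun x => by
      have := congrFun hv (finSumFinEquiv x)
      rw [← finSumFinEquiv.symm_apply_apply x]
      exact this
    have h1 : Q t *ᵥ v = 0 := funext fun i => hrow (Sum.inl i)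
    have h2 : (V t)ᵀ *ᵥ v = 0 := funext fun i => hrow (Sum.inr i)
    have h3 : (U t)ᵀ *ᵥ v = 0 := by
      rw [h7, transpose_mul, transpose_transpose, ← Matrix.mulVec_mulVec, h1, Matrix.mulVec_zero]
    rw [← Matrix.one_mulVec v, ← h5, Matrix.add_mulVec, ← Matrix.mulVec_mulVec,
      ← Matrix.mulVec_mulVec, h2, h3, Matrix.mulVec_zero, Matrix.mulVec_zero, add_zero]
  refine ⟨fun t => (Pi t)⁻¹, Pi, hPis.inv hdet, hPis, fun t ht =>
    ⟨Matrix.nonsing_inv_mul _ (hdet t ht), Matrix.mul_nonsing_inv _ (hdet t ht), fun i j => ?_⟩⟩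
  have h1 : (Q t * (Pi t)⁻¹) i j = (Pi t * (Pi t)⁻¹) (Fin.castAdd σ i) j := by
    rw [Matrix.mul_apply, Matrix.mul_apply]
    refine Finset.sum_congr rfl fun x _ => ?_
    have : Pi t (Fin.castAdd σ i) x = Q t i x := by
      simp [hPi]
    rw [this]
  rw [h1, Matrix.mul_nonsing_inv _ (hdet t ht), Matrix.one_apply]
  refine if_congr ?_ rfl rfl
  rw [Fin.ext_iff, Fin.val_castAdd]

theorem exists_smooth_columnOperation {δ : Type*} [Fintype δ] [DecidableEq δ]
    (hI : I.OrdConnected) (hI' : I.Nontrivial) {n : ℕ∞} (hn : 1 ≤ n) {μ : ℕ}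
    {l : Fin (μ + 1) → ℕ} (hl : Monotone l)
    {B : ℝ → Matrix (δ ⊕ BlockIdx fun i => l (Fin.castSucc i)) (Fin (l (Fin.last μ))) ℝ}
    (hB : SmoothOn n I B)
    (hsurj : ∀ t ∈ I, ∀ y, ∃ u v,
      fromBlocks (1 : Matrix δ δ ℝ) 0 0 (elemNilpotent fun i => l (Fin.castSucc i)) *ᵥ u +
        B t *ᵥ v = y) :
    ∃ (P Pi : ℝ → Matrix (Fin (l (Fin.last μ))) (Fin (l (Fin.last μ))) ℝ)
      (X : ℝ → Matrix (δ ⊕ BlockIdx fun i => l (Fin.castSucc i)) (Fin (l (Fin.last μ))) ℝ),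
      SmoothOn n I P ∧ SmoothOn n I Pi ∧ SmoothOn n I X ∧ ∀ t ∈ I,
        P t * Pi t = 1 ∧ Pi t * P t = 1 ∧
        B t * P t - fromBlocks (1 : Matrix δ δ ℝ) 0 0
          (elemNilpotent fun i => l (Fin.castSucc i)) * X t =
          fromRows 0 ((elemNilpotent l).submatrix (initIdx l) (lastIdx l)) := by
  have hl' : Monotone fun i => l (Fin.castSucc i) := fun i j hij =>
    hl (Fin.castSucc_le_castSucc_iff.2 hij)
  obtain ⟨P, Pi, hP, hPi, h⟩ : ∃ P Pi : ℝ → Matrix (Fin (l (Fin.last μ))) (Fin (l (Fin.last μ))) ℝ,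
      SmoothOn n I P ∧ SmoothOn n I Pi ∧ ∀ t ∈ I, P t * Pi t = 1 ∧ Pi t * P t = 1 ∧
      ∀ (p : BlockIdx fun i => l (Fin.castSucc i)) j, (p.1 : ℕ) + 1 = μ →
        (B t * P t) (Sum.inr p) j = if (p.2 : ℕ) = j then 1 else 0 := by
    cases μ with
    | zero => exact ⟨fun _ => 1, fun _ => 1, smoothOn_const _, smoothOn_const _, fun t _ =>
        ⟨Matrix.one_mul _, Matrix.one_mul _, fun p => p.1.elim0⟩⟩
    | succ μ =>
      obtain ⟨P, Pi, hP, hPi, h⟩ := exists_smooth_rightNormalForm hI hI' hn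
        (hl (Fin.le_last (Fin.castSucc (Fin.last μ))))
        (hB.submatrix (fun k => Sum.inr (lastIdx (fun i => l (Fin.castSucc i)) k)) id)
        (fun t ht => surjective_lastRows (hsurj t ht))
      refine ⟨P, Pi, hP, hPi, fun t ht => ⟨(h t ht).1, (h t ht).2.1, ?_⟩⟩
      rintro ⟨i, k⟩ j hi
      obtain rfl : i = Fin.last μ := Fin.ext (Nat.succ_injective hi)
      exact (h t ht).2.2 k j
  have hBP := hB.mul hP
  -- `N Nᵀ` is the identity on all blocks but the last, so this `X` clears all rows of `B P` except
  -- those of the last block, which are already `[I 0]`.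
  refine ⟨P, Pi, fun t => fromRows ((B t * P t).submatrix Sum.inl id)
    ((elemNilpotent fun i => l (Fin.castSucc i))ᵀ * (B t * P t).submatrix Sum.inr id), hP, hPi,
    (hBP.submatrix _ _).fromRows ((smoothOn_const _).mul (hBP.submatrix _ _)),
    fun t ht => ⟨(h t ht).1, (h t ht).2.1, ?_⟩⟩
  beta_reduce
  rw [fromBlocks_mul_fromRows, ← Matrix.mul_assoc (elemNilpotent _), elemNilpotent_mul_transpose hl']
  ext (i | p) j
  · simp
  · have h1 : (fromRows (0 : Matrix δ _ ℝ) ((elemNilpotent l).submatrix (initIdx l) (lastIdx l)))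
        (Sum.inr p) j = if (p.1 : ℕ) + 1 = μ ∧ (p.2 : ℕ) = j then 1 else 0 := rfl
    rw [h1, Matrix.sub_apply, fromRows_apply_inr, Matrix.zero_mul, zero_add,
      Matrix.diagonal_mul, submatrix_apply, id]
    have hp := p.1.2
    by_cases hμ : (p.1 : ℕ) + 1 = μ
    · simp [(h t ht).2.2 p j hμ, hμ]
    · rw [if_pos (by omega), if_neg (by tauto), one_mul, sub_self]

theorem qForm_of_eqv_fromBlocks {ι : Type} [Fintype ι] [DecidableEq ι] {n : ℕ∞} (hn : 1 ≤ n)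
    {E F : ℝ → Matrix ι ι ℝ} {d μ : ℕ} {l : Fin (μ + 1) → ℕ} {Ω : ℝ → Matrix (Fin d) (Fin d) ℝ}
    {R : ℝ → Matrix (BlockIdx fun i => l (Fin.castSucc i)) _ ℝ}
    {H : ℝ → Matrix (Fin (l (Fin.last μ))) (Fin (l (Fin.last μ))) ℝ}
    (hR : ∀ t ∈ I, (R t).BlockTriangular Sigma.fst ∧ IsUnit (R t).det)
    (hH : ∀ t ∈ I, IsUnit (H t).det)
    (h : Eqv n n I E F
      (fun _ => fromBlocks (fromBlocks 1 0 0 (elemNilpotent fun i => l (Fin.castSucc i)))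
        (fromRows 0 ((elemNilpotent l).submatrix (initIdx l) (lastIdx l))) 0 0)
      (fun t => fromBlocks (fromBlocks (Ω t) 0 0 (R t)) 0 0 (H t))) :
    QForm n I E F d l := by
  have hS : ∀ t, (fromBlocks (Ω t) 0 0
      ((fromBlocks (R t) 0 0 (H t)).submatrix (lastEquiv l).symm (lastEquiv l).symm)).submatrix
      (sumLastEquiv (Fin d) l) (sumLastEquiv (Fin d) l) =
      fromBlocks (fromBlocks (Ω t) 0 0 (R t)) 0 0 (H t) := fun t => by
    ext ((i | i) | i) ((j | j) | j) <;> simp [sumLastEquiv]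
  have hE : (fromBlocks 1 0 0 (elemNilpotent l)).submatrix (sumLastEquiv (Fin d) l)
      (sumLastEquiv (Fin d) l) =
      fromBlocks (fromBlocks 1 0 0 (elemNilpotent fun i => l (Fin.castSucc i)))
        (fromRows 0 ((elemNilpotent l).submatrix (initIdx l) (lastIdx l))) 0 0 := by
    rw [submatrix_sumLastEquiv, elemNilpotent_submatrix_last, elemNilpotent_submatrix_last]
    congr 1
    exact fromCols_zero
  refine ⟨Ω, fun t => (fromBlocks (R t) 0 0 (H t)).submatrix (lastEquiv l).symm (lastEquiv l).symm,
    fun t ht => ⟨fun p q hpq => ?_, ?_⟩, (h.trans hn (eqv_submatrix n n I _ _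
      (sumLastEquiv (Fin d) l).symm)).of_eq (fun t ht => ?_) fun t ht => ?_⟩
  · obtain ⟨x, rfl⟩ := (lastEquiv l).surjective p
    obtain ⟨y, rfl⟩ := (lastEquiv l).surjective q
    simp only [submatrix_apply, Equiv.symm_apply_apply]
    rcases x with x | x <;> rcases y with y | y
    · exact (hR t ht).1 (Fin.castSucc_lt_castSucc_iff.1 hpq)
    · rfl
    · rfl
    · exact absurd hpq (lt_irrefl _)
  · rw [Matrix.det_submatrix_equiv_self, Matrix.det_fromBlocks_zero₂₁]
    exact (hR t ht).2.mul (hH t ht)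
  · rw [← hE]; simp
  · rw [← hS]; simp

/-- The end of the reduction: multiplication by `E⁻¹` gives a form without nilpotent part. -/
theorem qForm_of_isUnit {m : ℕ} {n : ℕ∞} (hn : 1 ≤ n) {E F : ℝ → Matrix (Fin m) (Fin m) ℝ}
    (hE : SmoothOn n I E) (h : ∀ t ∈ I, IsUnit (E t).det) (l : Fin 0 → ℕ) :
    QForm n I E F m l := by
  have h1 : Eqv n n I E F (fun _ => 1) (fun t => (E t)⁻¹ * F t) := by
    refine ⟨fun t => (E t)⁻¹, E, fun _ => 1, fun _ => 1, hE.inv h, hE, smoothOn_const _,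
      smoothOn_const _, fun t ht => ?_⟩
    have h2 := Matrix.nonsing_inv_mul _ (h t ht)
    simp [h2, Matrix.mul_nonsing_inv _ (h t ht)]
  refine ⟨fun t => (E t)⁻¹ * F t, fun _ => 1, fun t _ => ⟨Matrix.blockTriangular_one, by simp⟩,
    (h1.trans hn (eqv_submatrix n n I _ _ (Equiv.sumEmpty (Fin m) (BlockIdx l)))).of_eq
      (fun t ht => ?_) fun t ht => ?_⟩
  · ext (i | i) (j | j)
    · simp only [Matrix.submatrix_apply, fromBlocks_apply₁₁, Matrix.one_apply]
      rfl
    all_goals first | exact i.1.elim0 | exact j.1.elim0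
  · ext (i | i) (j | j)
    · simp
    all_goals first | exact i.1.elim0 | exact j.1.elim0

/-- One step from the reduced pair back to the original one. -/
theorem exists_qForm_succ (hI : I.OrdConnected) (hI' : I.Nontrivial) {m r θ μ : ℕ} {n k : ℕ∞}
    (hn : 1 ≤ n) (hr : r < m) (hnk : n + 1 ≤ k) {E F : ℝ → Matrix (Fin m) (Fin m) ℝ}
    (hE : SmoothOn (k + 1) I E) (hF : SmoothOn (k + 1) I F) (h : IsPreRegular I E F r θ)
    (ih : ∀ E₁ F₁ : ℝ → Matrix (Fin r) (Fin r) ℝ, SmoothOn k I E₁ → SmoothOn k I F₁ →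
      Red I E F E₁ F₁ → ∃ (d : ℕ) (l : Fin μ → ℕ), Monotone l ∧ (∀ i, 0 < l i) ∧
        QForm (n + 1) I E₁ F₁ d l) :
    ∃ (d : ℕ) (l : Fin (μ + 1) → ℕ), Monotone l ∧ (∀ i, 0 < l i) ∧ QForm n I E F d l := by
  obtain ⟨a, ha⟩ := Nat.exists_eq_add_of_le hr.le
  have hU := uniqueDiffOn_of_ordConnected hI hI'
  obtain ⟨E₁, F₁, B, G, H, hE₁, hF₁, hB, hG, hH, heqv, hsurj, hHu⟩ :=
    exists_eqv_fromBlocks hI hI' ha.symm le_rfl hE hF h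
  obtain ⟨t₀, ht₀⟩ := hI'.nonempty
  have hnk' : n ≤ k := le_self_add.trans hnk
  -- The corner of the block form is a reduction of the original pair, and a smooth one.
  have hred : Red I E F E₁ F₁ := (red_fromBlocks hsurj hHu).2.eqv_left
    ((heqv.mono zero_le le_add_self).symm le_rfl)
  obtain ⟨d, l', hl', hpos, Ω, R, hR, he⟩ := ih E₁ F₁ hE₁ hF₁ hred
  obtain ⟨B', G', hB', hG', hsurj', he'⟩ := he.exists_fromBlocks (H := H) (hB.mono hnk)
    (hG.mono hnk) hsurj
  have hlast : ∀ i, l' i ≤ a := fun i => by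
    simpa using le_card_of_surjective hl' (hsurj' t₀ ht₀) i
  have hF₂ : SmoothOn n I fun t => fromBlocks (Ω t) 0 0 (R t) := by
    obtain ⟨L, Li, K, Ki, hL, hLi, hK, hKi, hh⟩ := he
    have hL' := hL.mono (k := n) le_self_add
    exact (((hL'.mul (hF₁.mono hnk')).mul (hK.mono le_self_add)).add
      ((hL'.mul (hE₁.mono hnk')).mul (hK.derivOn hU le_rfl))).congr
        fun t ht => (hh t ht).2.2.2.2.2
  -- The appended block has size `a = m - r`.
  obtain ⟨l, h1, h2⟩ : ∃ l : Fin (μ + 1) → ℕ, (fun i => l (Fin.castSucc i)) = l' ∧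
      l (Fin.last μ) = a := ⟨Fin.snoc (α := fun _ => ℕ) l' a, by simp, by simp⟩
  subst h1 h2
  have hl : Monotone l := by
    intro i j hij
    induction j using Fin.lastCases with
    | last =>
      induction i using Fin.lastCases with
      | last => exact le_rfl
      | cast i => exact hlast i
    | cast j =>
      induction i using Fin.lastCases with
      | last => exact absurd hij (not_le.2 (Fin.castSucc_lt_last j))
      | cast i => exact hl' (Fin.castSucc_le_castSucc_iff.1 hij)
  refine ⟨d, l, hl, fun i => ?_, ?_⟩
  · induction i using Fin.lastCases with
    | last => omega
    | cast i => exact hpos i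
  obtain ⟨P, Pi, X, hP, hPi, hX, hPX⟩ := exists_smooth_columnOperation hI hI'
    le_add_self hl hB' hsurj'
  have hstep := eqv_fromBlocks_of_eq hU (smoothOn_const _) hF₂ (hB'.mono le_self_add)
    (hG'.mono le_self_add) (hH.mono hnk') hX hP hPi fun t ht =>
      ⟨(hPX t ht).1, (hPX t ht).2.1, (hPX t ht).2.2, hHu t ht⟩
  refine qForm_of_eqv_fromBlocks hn hR (fun t ht => ?_)
    (((heqv.mono (hnk'.trans le_self_add) (hnk'.trans le_self_add)).trans hn
      (he'.mono le_self_add le_self_add)).trans hn hstep)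
  rw [Matrix.det_mul]
  exact (hHu t ht).mul (Matrix.isUnit_det_of_right_inverse (hPX t ht).1)

theorem isUnit_det_of_rank_eq {α : Type*} [Fintype α] [DecidableEq α] {A : Matrix α α ℝ}
    (h : A.rank = Fintype.card α) : IsUnit A.det := by
  rw [← Matrix.isUnit_iff_isUnit_det, ← Matrix.mulVec_surjective_iff_isUnit,
    ← Matrix.coe_mulVecLin, ← LinearMap.range_eq_top]
  refine Submodule.eq_top_of_finrank_eq ?_
  rw [Module.finrank_fintype_fun_eq_card]
  exact h

/-- A step costs two derivatives, one for `C'`, `D'` and one for `X'`, `P'`, and the size drops by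
at least one; hence `2 m`. -/
theorem exists_qForm_of_isRegularOfIndex (hI : I.OrdConnected) (hI' : I.Nontrivial) {μ : ℕ} :
    ∀ {m : ℕ} {n : ℕ∞}, 1 ≤ n → ∀ {E F : ℝ → Matrix (Fin m) (Fin m) ℝ},
    SmoothOn (n + (2 * m : ℕ)) I E → SmoothOn (n + (2 * m : ℕ)) I F →
    IsRegularOfIndex I (μ + 1) E F →
    ∃ (d : ℕ) (l : Fin (μ + 1) → ℕ), Monotone l ∧ (∀ i, 0 < l i) ∧ QForm n I E F d l := by
  have hle : ∀ {m r : ℕ} {n : ℕ∞}, r < m → n + 1 + (2 * r : ℕ) + 1 ≤ n + (2 * m : ℕ) := by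
    intro m r n hr
    have : n + 1 + (2 * r : ℕ) + 1 = n + (2 * r + 2 : ℕ) := by push_cast; ring
    rw [this]
    gcongr
    omega
  induction μ with
  | zero =>
    intro m n hn E F hE hF h
    obtain ⟨r, hr, hp⟩ := h
    refine exists_qForm_succ hI hI' hn hr (k := n + 1 + (2 * r : ℕ)) le_self_add
      (hE.mono (hle hr)) (hF.mono (hle hr)) hp fun E₁ F₁ hE₁ hF₁ hred =>
        ⟨r, Fin.elim0, fun i => i.elim0, fun i => i.elim0,
          qForm_of_isUnit le_add_self (hE₁.mono le_self_add) (fun t ht => ?_) _⟩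
    have := hred.finrank_add_rank ht
    rw [(hp t ht).2.2, zero_add] at this
    exact isUnit_det_of_rank_eq this
  | succ μ ih =>
    intro m n hn E F hE hF h
    obtain ⟨r, θ, hθ, hp, E₂, F₂, hred₂, hreg₂⟩ := h
    obtain ⟨t₀, ht₀⟩ := hI'.nonempty
    -- A nonsingular `E t₀` would have trivial kernel, contradicting `θ > 0`.
    have hr : r < m := by
      by_contra hrm
      have hu : IsUnit (E t₀).det := isUnit_det_of_rank_eq (by
        refine le_antisymm (Matrix.rank_le_card_width _) ?_
        rw [(hp t₀ ht₀).2.1, Fintype.card_fin]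
        exact not_lt.1 hrm)
      have hk : LinearMap.ker (E t₀).mulVecLin = ⊥ := LinearMap.ker_eq_bot.2 (by
        rw [Matrix.coe_mulVecLin, Matrix.mulVec_injective_iff_isUnit,
          Matrix.isUnit_iff_isUnit_det]
        exact hu)
      have := (hp t₀ ht₀).2.2
      rw [hk, bot_inf_eq, finrank_bot] at this
      omega
    -- Regularity provides a reduced pair built from bases of class `0` and `1` only; uniqueness
    -- transfers its regularity to the smooth reduced pair.
    refine exists_qForm_succ hI hI' hn hr (k := n + 1 + (2 * r : ℕ)) le_self_add
      (hE.mono (hle hr)) (hF.mono (hle hr)) hp fun E₁ F₁ hE₁ hF₁ hred =>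
        ih le_add_self hE₁ hF₁ (hreg₂.eqv (hred₂.red.unique hred))

end RowStep

end LinearDAE

namespace LinearDAE

open Set Matrix

/-! ### Passage to the adjoint and the choice of the smoothness loss -/

section Main

variable {I : Set ℝ} {m : ℕ} {n : ℕ∞} {E F E' F' : ℝ → Matrix (Fin m) (Fin m) ℝ}

theorem PairEquiv.eqv (h : PairEquiv n I E F E' F') : Eqv n n I E F E' F' := by
  obtain ⟨L, K, hL, hK, h⟩ := h
  exact ⟨L, fun t => (L t)⁻¹, K, fun t => (K t)⁻¹, hL, hL.inv fun t ht => (h t ht).1, hK,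
    hK.inv fun t ht => (h t ht).2.1, fun t ht => ⟨Matrix.mul_nonsing_inv _ (h t ht).1,
      Matrix.nonsing_inv_mul _ (h t ht).1, Matrix.mul_nonsing_inv _ (h t ht).2.1,
      Matrix.nonsing_inv_mul _ (h t ht).2.1, (h t ht).2.2⟩⟩

theorem Eqv.pairEquiv (h : Eqv n n I E F E' F') : PairEquiv n I E F E' F' := by
  obtain ⟨L, Li, K, Ki, hL, -, hK, -, h⟩ := h
  exact ⟨L, K, hL, hK, fun t ht => ⟨Matrix.isUnit_det_of_right_inverse (h t ht).1,
    Matrix.isUnit_det_of_right_inverse (h t ht).2.2.1, (h t ht).2.2.2.2⟩⟩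

theorem QForm.sum_eq (hI : I.Nonempty) {d μ : ℕ} {l : Fin μ → ℕ} (h : QForm n I E F d l) :
    d + ∑ i, l i = m := by
  obtain ⟨Ω, R, -, he⟩ := h
  have := he.card_eq hI
  simpa using this.symm

theorem exists_pairEquiv_hasQuasiForm_iff (hI : I.Nonempty) (hn : 1 ≤ n) {d μ : ℕ}
    {l : Fin μ → ℕ} :
    (∃ E' F', PairEquiv n I E F E' F' ∧ ∃ h : d + ∑ i, l i = m, HasQuasiForm I l h E' F') ↔
      QForm n I E F d l := by
  constructor
  · rintro ⟨E', F', he, h, Ω, R, hR⟩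
    refine ⟨Ω, R, fun t ht => ⟨(hR t ht).1, (hR t ht).2.1⟩,
      (he.eqv.trans hn (eqv_submatrix n n I _ _ (blockEquiv l h))).of_eq
        (fun t ht => ?_) fun t ht => ?_⟩
    · rw [(hR t ht).2.2.1]
      ext i j
      simp [blockDiag]
    · rw [(hR t ht).2.2.2]
      ext i j
      simp [blockDiag]
  · intro hq
    have h := hq.sum_eq hI
    obtain ⟨Ω, R, hR, he⟩ := hq
    exact ⟨_, _, (he.trans hn (eqv_submatrix n n I _ _ (blockEquiv l h).symm)).pairEquiv, h, Ω, R,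
      fun t ht => ⟨(hR t ht).1, (hR t ht).2, rfl, rfl⟩⟩

/-- Blocks are nonempty. This bounds the number of reduction steps, and so the derivatives they use,
by `m`. -/
theorem QForm.le (hI : I.Nonempty) {d μ : ℕ} {l : Fin μ → ℕ} (h : QForm n I E F d l)
    (hpos : ∀ i, 0 < l i) : μ ≤ m := by
  rw [← h.sum_eq hI]
  calc μ = ∑ _i : Fin μ, 1 := by simp
    _ ≤ ∑ i, l i := Finset.sum_le_sum fun i _ => hpos i
    _ ≤ _ := Nat.le_add_left _ _

/-- The pair is equivalent to a pair in quasi-SCF of row type. -/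
def HasRowForm (n : ℕ∞) (I : Set ℝ) (E F : ℝ → Matrix (Fin m) (Fin m) ℝ) : Prop :=
  ∃ (d μ : ℕ) (l : Fin μ → ℕ), 1 ≤ μ ∧ (∀ i, 0 < l i) ∧ Monotone l ∧ QForm n I E F d l

/-- The pair is equivalent to a pair in quasi-SCF of column type. -/
def HasColumnForm (n : ℕ∞) (I : Set ℝ) (E F : ℝ → Matrix (Fin m) (Fin m) ℝ) : Prop :=
  ∃ (d μ : ℕ) (l : Fin μ → ℕ), 1 ≤ μ ∧ (∀ i, 0 < l i) ∧ Antitone l ∧ QForm n I E F d l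

theorem exists_pairEquiv_isQuasiSCFRow_iff (hI : I.Nonempty) (hn : 1 ≤ n) :
    (∃ E' F', PairEquiv n I E F E' F' ∧ IsQuasiSCFRow I E' F') ↔ HasRowForm n I E F := by
  constructor
  · rintro ⟨E', F', he, d, μ, l, h, hμ, hpos, hl, hq⟩
    exact ⟨d, μ, l, hμ, hpos, hl,
      (exists_pairEquiv_hasQuasiForm_iff hI hn).1 ⟨E', F', he, h, hq⟩⟩
  · rintro ⟨d, μ, l, hμ, hpos, hl, hq⟩
    obtain ⟨E', F', he, h, hq⟩ := (exists_pairEquiv_hasQuasiForm_iff hI hn).2 hq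
    exact ⟨E', F', he, d, μ, l, h, hμ, hpos, hl, hq⟩

theorem exists_pairEquiv_isQuasiSCFColumn_iff (hI : I.Nonempty) (hn : 1 ≤ n) :
    (∃ E' F', PairEquiv n I E F E' F' ∧ IsQuasiSCFColumn I E' F') ↔ HasColumnForm n I E F := by
  constructor
  · rintro ⟨E', F', he, d, μ, l, h, hμ, hpos, hl, hq⟩
    exact ⟨d, μ, l, hμ, hpos, hl,
      (exists_pairEquiv_hasQuasiForm_iff hI hn).1 ⟨E', F', he, h, hq⟩⟩
  · rintro ⟨d, μ, l, hμ, hpos, hl, hq⟩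
    obtain ⟨E', F', he, h, hq⟩ := (exists_pairEquiv_hasQuasiForm_iff hI hn).2 hq
    exact ⟨E', F', he, d, μ, l, h, hμ, hpos, hl, hq⟩

theorem HasRowForm.adj (hn : 1 ≤ n) (hE : SmoothOn 1 I E) (h : HasRowForm n I E F) :
    HasColumnForm n I (adjE E) (adjF I E F) := by
  obtain ⟨d, μ, l, hμ, hpos, hl, hq⟩ := h
  exact ⟨d, μ, _, hμ, fun i => hpos _, fun i j hij => hl (Fin.rev_le_rev.2 hij), hq.adj hn hE⟩

theorem HasColumnForm.adj (hn : 1 ≤ n) (hE : SmoothOn 1 I E) (h : HasColumnForm n I E F) :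
    HasRowForm n I (adjE E) (adjF I E F) := by
  obtain ⟨d, μ, l, hμ, hpos, hl, hq⟩ := h
  exact ⟨d, μ, _, hμ, fun i => hpos _, fun i j hij => hl (Fin.rev_le_rev.2 hij), hq.adj hn hE⟩

theorem HasRowForm.isRegular (hI : I.Nonempty) (hn : 1 ≤ n) (h : HasRowForm n I E F) :
    IsRegular I E F := by
  obtain ⟨d, μ, l, hμ, hpos, hl, hq⟩ := h
  obtain ⟨μ, rfl⟩ := Nat.exists_eq_add_of_le' hμ
  exact ⟨_, (hq.regT_of_monotone hI hn hl hpos).isRegularOfIndex hI⟩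

theorem HasColumnForm.isRegular (hI : UniqueDiffOn ℝ I) (hI' : I.Nonempty) (hn : m + 1 ≤ n)
    (hE : SmoothOn m I E) (hF : SmoothOn m I F) (h : HasColumnForm n I E F) :
    IsRegular I E F := by
  obtain ⟨d, μ, l, hμ, hpos, hl, hq⟩ := h
  have hm : (μ : ℕ∞) ≤ m := by exact_mod_cast hq.le hI' hpos
  obtain ⟨μ, rfl⟩ := Nat.exists_eq_add_of_le' hμ
  exact ⟨_, (hq.regT_of_antitone hI hI' ((add_le_add_left hm 1).trans hn) (hE.mono hm)
    (hF.mono hm) hl hpos).isRegularOfIndex hI'⟩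

theorem IsRegular.hasRowForm (hI : I.OrdConnected) (hI' : I.Nontrivial) (hn : 1 ≤ n)
    (hE : SmoothOn (n + (2 * m : ℕ)) I E) (hF : SmoothOn (n + (2 * m : ℕ)) I F)
    (h : IsRegular I E F) : HasRowForm n I E F := by
  obtain ⟨μ, h⟩ := h
  cases μ with
  | zero => exact h.elim
  | succ μ =>
    obtain ⟨d, l, hl, hpos, hq⟩ := exists_qForm_of_isRegularOfIndex hI hI' hn hE hF h
    exact ⟨d, μ + 1, l, Nat.le_add_left _ _, hpos, hl, hq⟩

theorem SmoothOn.adjE (hE : SmoothOn n I E) : SmoothOn n I (adjE E) := hE.transpose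

theorem SmoothOn.adjF (hI : UniqueDiffOn ℝ I) {k : ℕ∞} (hk : k + 1 ≤ n) (hE : SmoothOn n I E)
    (hF : SmoothOn n I F) : SmoothOn k I (adjF I E F) :=
  (hE.derivOn hI hk).transpose.sub (hF.mono (le_self_add.trans hk)).transpose

/-- A row form of class `C^(m+1)` gives the adjoint a column form smooth enough to be regular. The
adjoint then has a row form of class `C^n`, whose adjoint is the column form sought. -/
theorem IsRegular.hasColumnForm (hI : I.OrdConnected) (hI' : I.Nontrivial) (hn : 1 ≤ n)
    (hE : SmoothOn (n + (3 * m + 1 : ℕ)) I E) (hF : SmoothOn (n + (3 * m + 1 : ℕ)) I F)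
    (h : IsRegular I E F) : HasColumnForm n I E F := by
  have hU := uniqueDiffOn_of_ordConnected hI hI'
  have hm : ((m + 1 : ℕ) : ℕ∞) + (2 * m : ℕ) ≤ n + (3 * m + 1 : ℕ) := by
    rw [← Nat.cast_add]
    refine le_add_self.trans' (by exact_mod_cast (by omega))
  have hn2 : n + (2 * m : ℕ) + 1 ≤ n + (3 * m + 1 : ℕ) := by
    rw [add_assoc]
    gcongr
    exact_mod_cast (by omega)
  have hm1 : (m : ℕ∞) + 1 ≤ n + (3 * m + 1 : ℕ) :=
    le_add_self.trans' (by exact_mod_cast (by omega))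
  have h1 : SmoothOn 1 I E := hE.mono (hn.trans le_self_add)
  have hadj : IsRegular I (LinearDAE.adjE E) (LinearDAE.adjF I E F) :=
    ((h.hasRowForm hI hI' (by exact_mod_cast Nat.le_add_left 1 m) (hE.mono hm)
      (hF.mono hm)).adj (by exact_mod_cast Nat.le_add_left 1 m) h1).isRegular hU hI'.nonempty
        (by norm_cast) (hE.mono (le_self_add.trans hm1)).adjE (hE.adjF hU hm1 hF)
  have := (hadj.hasRowForm hI hI' hn (hE.mono (le_self_add.trans hn2)).adjE
    (hE.adjF hU hn2 hF)).adj hn h1.adjE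
  rwa [adjF_adjF] at this

/-- The given transformations may be too rough for reducing a column form directly. But the adjoint
is regular through its row form, and this in turn yields a column form of the pair with
transformations of class `C^(m+1)`. -/
theorem HasColumnForm.isRegular_of_smoothOn (hI : I.OrdConnected) (hI' : I.Nontrivial)
    (hn : 1 ≤ n) (hE : SmoothOn (n + (3 * m + 1 : ℕ)) I E)
    (hF : SmoothOn (n + (3 * m + 1 : ℕ)) I F) (h : HasColumnForm n I E F) : IsRegular I E F := by
  have hU := uniqueDiffOn_of_ordConnected hI hI'
  have hm : ((m + 1 : ℕ) : ℕ∞) + (2 * m : ℕ) + 1 ≤ n + (3 * m + 1 : ℕ) := by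
    refine (add_le_add_left hn _).trans' ?_
    exact_mod_cast (by omega)
  have hm1 : (m : ℕ∞) ≤ n + (3 * m + 1 : ℕ) :=
    le_add_self.trans' (by exact_mod_cast (by omega))
  have hm' : (1 : ℕ∞) ≤ (m + 1 : ℕ) := by exact_mod_cast Nat.le_add_left 1 m
  have h1 : SmoothOn 1 I E := hE.mono (hn.trans le_self_add)
  have hrow := ((h.adj hn h1).isRegular hI'.nonempty hn).hasRowForm hI hI' hm'
    (hE.mono (le_self_add.trans hm)).adjE (hE.adjF hU hm hF)
  have := hrow.adj hm' h1.adjE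
  rw [adjF_adjF] at this
  exact HasColumnForm.isRegular hU hI'.nonempty (by norm_cast) (hE.mono hm1) (hF.mono hm1) this

end Main

end LinearDAE

theorem mainTheorem3 (m : ℕ) :
    ∃ s : ℕ, ∀ (n : ℕ∞), 1 ≤ n →
      ∀ (I : Set ℝ), I.OrdConnected → I.Nontrivial →
      ∀ (E F : ℝ → Matrix (Fin m) (Fin m) ℝ),
        LinearDAE.SmoothOn (n + (s : ℕ∞)) I E → LinearDAE.SmoothOn (n + (s : ℕ∞)) I F →
        (LinearDAE.IsRegular I E F ↔
          ∃ E' F' : ℝ → Matrix (Fin m) (Fin m) ℝ,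
            LinearDAE.PairEquiv n I E F E' F' ∧ LinearDAE.IsQuasiSCFColumn I E' F') ∧
        (LinearDAE.IsRegular I E F ↔
          ∃ E' F' : ℝ → Matrix (Fin m) (Fin m) ℝ,
            LinearDAE.PairEquiv n I E F E' F' ∧ LinearDAE.IsQuasiSCFRow I E' F') := by
  -- A row form of class `C^(m+1)` uses `(m + 1) + 2 m` derivatives of the pair. For the adjoint one
  -- more is needed, which `n ≥ 1` supplies.
  refine ⟨3 * m + 1, fun n hn I hI hI' E F hE hF => ?_⟩
  rw [LinearDAE.exists_pairEquiv_isQuasiSCFColumn_iff hI'.nonempty hn,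
    LinearDAE.exists_pairEquiv_isQuasiSCFRow_iff hI'.nonempty hn]
  have h2 : n + (2 * m : ℕ) ≤ n + (3 * m + 1 : ℕ) := by
    gcongr
    omega
  exact ⟨⟨fun h => h.hasColumnForm hI hI' hn hE hF,
    fun h => h.isRegular_of_smoothOn hI hI' hn hE hF⟩,
    ⟨fun h => h.hasRowForm hI hI' hn (hE.mono h2) (hF.mono h2),
    fun h => h.isRegular hI'.nonempty hn⟩⟩
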